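/- Let $k,m\ge 2$ be integers, $n=km$, $\Omega_n=\{1,\dots,n\}$ and $I_i=\{(i-1)m+1,\dots,im\}$ for $1\le i\le k$. For $x\in\Omega_n$ let $i_x$ be the index with $x\in I_{i_x}$. Maps act on the right and are composed from left to right. Let $\mathcal{POI}_{k\times m}$ be the monoid of all partial permutations $\alpha$ of $\Omega_n$ such that, for all $x,y\in\mathrm{Dom}(\alpha)$, $I_{i_x}\subseteq \mathrm{Dom}(\alpha)$, $I_{i_x}\alpha=I_{i_{x\alpha}}$, and $i_x\le i_y$ implies $i_{x\alpha}\le i_{y\alpha}$. In $\mathcal S_m$ put $a=(1\ 2)$, $b=(1\ 2\cdots m)$ and $c=ab=(1\ 3\ 4\cdots m)$. Let $b_i$, respectively $c_i$, be the element of $\mathcal S_m^k$ with $b$, respectively $c$, in position $i$ and $1$ elsewhere, and put $d_i=b_ic_{i+1}$ for $1\le i\le k-1$ and $d_k=b_kc_1$. Let $\bar d_i\in\mathcal{POI}_{k\times m}$ be the permutation of $\Omega_n$ that acts on each interval $I_j$, identified with $\{1,\dots,m\}$ by translation, as the $j$-th component of $d_i$. Let $\bar x_0\in\mathcal{POI}_{k\times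 m}$ have domain $\Omega_n\setminus I_1$ and translate $I_p$ onto $I_{p-1}$ for $2\le p\le k$. For $1\le i\le k-1$ let $\bar x_i\in\mathcal{POI}_{k\times m}$ have domain $\Omega_n\setminus I_{k-i+1}$, translate $I_{k-i}$ onto $I_{k-i+1}$ and fix every other point of its domain. Let $D=\{d_1,\dots,d_k\}$ and $X=\{x_0,\dots,x_{k-1}\}$ be disjoint alphabets with $k$ letters each, and put $q=(m-1)^2$. A range of indices such as $1\le i\le k-2$ may be empty. $V$ is the set of the following relations: - $(d_k^m d_1^{m-1})^2=1$; $(d_i^m d_{i+1}^{m-1})^2=1$ for $1\le i\le k-1$; - $d_i^{m(m-1)}=1$ for $1\le i\le k$; - $(d_1^{q}d_k^md_1^{m-1})^{m-1}=1$; $(d_{i+1}^{q}d_i^md_{i+1}^{m-1})^{m-1}=1$ for $1\le i\le k-1$; - $(d_k^md_1^{q(m-2)}d_k^m)^3=1$; $(d_i^md_{i+1}^{q(m-2)}d_i^m)^3=1$ for $1\le i\le k-1$; - $(d_k^md_1^{q(m-j-1)}d_k^md_1^{q(j-1)})^2=1$ for $2\le j\le m-2$; $(d_i^md_{i+1}^{q(m-j-1)}d_i^md_{i+1}^{q(j-1)})^2=1$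 for $2\le j\le m-2$, $1\le i\le k-1$; - $d_i^md_j^m=d_j^md_i^m$ and $d_i^{q}d_j^{q}=d_j^{q}d_i^{q}$ for $1\le i<j\le k$; $d_i^{q}d_k^m=d_k^md_i^{q}$ for $2\le i\le k-1$; $d_i^{q}d_j^m=d_j^md_i^{q}$ for $1\le i\le k$, $1\le j\le k-1$, $i\notin\{j,j+1\}$. $W$ is the set of the following relations: - $x_ix_0=x_0x_{i+1}$ for $1\le i\le k-2$; - $x_jx_i=x_ix_j$ for $2\le i+1<j\le k-1$; - $x_0^2x_1=x_0^2$ and $x_0^2=x_{k-1}x_0^2$; - $x_{i+1}x_ix_{i+1}=x_{i+1}x_i$ and $x_{i+1}x_i=x_ix_{i+1}x_i$ for $1\le i\le k-2$; - $x_ix_{i+1}\cdots x_{k-1}x_0x_1\cdots x_{i-1}x_i=x_i$ for $0\le i\le k-1$; - $x_{i+1}\cdots x_{k-1}x_0x_1\cdots x_{i-1}x_i^2=x_i^2$ for $1\le i\le k-1$. $V'$ is the set of the following relations: - $d_k^md_1^{m-1}x_0=x_0$; $d_1^{q}x_0=x_0$; - $x_0d_k^md_1^{m-1}=d_1^md_2^{m-1}x_0$;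 $x_0d_i^md_{i+1}^{m-1}=d_{i+1}^md_{i+2}^{m-1}x_0$ for $1\le i\le k-2$; $x_0d_i^{q}=d_{i+1}^{q}x_0$ for $1\le i\le k-1$; - $x_id_{k-i-1}^md_{k-i}^{m-1}=x_i$ for $0\le i\le k-2$; $x_{k-1}d_k^md_1^{m-1}=x_{k-1}$; $x_id_{k-i}^{q}=x_i$ for $0\le i\le k-1$; - $d_i^md_{i+1}^{m-1}x_{k-i}=x_{k-i}$ and $d_{i+1}^{q}x_{k-i}=x_{k-i}$ for $1\le i\le k-1$; - $x_id_{k-i}^md_{k-i+1}^{m-1}=d_{k-i-1}^md_{k-i}^{m-1}x_i$ for $1\le i\le k-2$; $x_{k-1}d_1^md_2^{m-1}=d_k^md_1^{m-1}x_{k-1}$; $x_id_{k-i+1}^{q}=d_{k-i}^{q}x_i$ for $1\le i\le k-1$; - $x_id_k^md_1^{m-1}=d_k^md_1^{m-1}x_i$ for $1\le i\le k-2$; $x_id_j^md_{j+1}^{m-1}=d_j^md_{j+1}^{m-1}x_i$ for $1\le i,j\le k-1$, $j\notin\{k-i-1,k-i\}$; $x_id_j^{q}=d_j^{q}x_i$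 for $1\le i\le k-1$, $1\le j\le k$, $j\notin\{k-i,k-i+1\}$. **Theorem.** For $k,m\ge2$ the monoid $\mathcal{POI}_{k\times m}$ is defined by the monoid presentation $\langle D\cup X\mid V\cup W\cup V'\rangle$ on $2k$ generators. That is, the quotient of the free monoid $(D\cup X)^*$ by the smallest congruence containing $V\cup W\cup V'$ is isomorphic to $\mathcal{POI}_{k\times m}$, by an isomorphism that sends the class of each letter $d_i$ to $\bar d_i$ and the class of each letter $x_i$ to $\bar x_i$. The set $V\cup W\cup V'$ consists of $\frac12\bigl(9k^2+(2m+5)k-4\bigr)$ relations if $m\ge3$, and of $\frac12\bigl(9k^2+11k-4\bigr)$ relations if $m=2$. -/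

import Mathlib

namespace POIPresentation

/-! Partial permutations act on the right, so `α * β` means "first `α`, then `β`". -/

/-- Partial permutations (injective partial maps) of `Ω`. -/
def PartialPerm (Ω : Type*) : Type _ := Ω ≃. Ω

/-- The symmetric inverse monoid on `Ω`, with composition from left to right. -/
instance instMonoidPartialPerm (Ω : Type*) : Monoid (PartialPerm Ω) where
  mul α β := PEquiv.trans α β
  one := PEquiv.refl Ω
  mul_assoc α β γ := PEquiv.trans_assoc α β γ
  one_mul α := PEquiv.refl_trans α
  mul_one α := PEquiv.trans_refl α

/-- `Maps α x y`: the point `x` lies in the domain of `α` and `xα = y`. -/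
def Maps {Ω : Type*} (α : PartialPerm Ω) (x y : Ω) : Prop :=
  y ∈ (PEquiv.toFun α x)

theorem maps_one {Ω : Type*} {x y : Ω} : Maps (1 : PartialPerm Ω) x y ↔ x = y := by
  change some x = some y ↔ x = y
  simp

theorem maps_mul {Ω : Type*} {α β : PartialPerm Ω} {x z : Ω} :
    Maps (α * β) x z ↔ ∃ y, Maps α x y ∧ Maps β y z :=
  PEquiv.mem_trans α β x z

/-- An ordered partition `{X₁ < ⋯ < X_k}` of `Ω` is given by the map `blk` that sends a point to
the index of its block.  `α` is stable if, whenever `x` is in the domain and `xα = y`, the whole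
block of `x` is in the domain and its image under `α` is the whole block of `y`. -/
def IsStable {Ω : Type*} {k : ℕ} (blk : Ω → Fin k) (α : PartialPerm Ω) : Prop :=
  ∀ x y, Maps α x y →
    (∀ x', blk x' = blk x → ∃ y', Maps α x' y') ∧
    {y' | ∃ x', blk x' = blk x ∧ Maps α x' y'} = {y' | blk y' = blk y}

/-- `α` preserves the order of the blocks. -/
def IsBlockOrderPreserving {Ω : Type*} {k : ℕ} (blk : Ω → Fin k) (α : PartialPerm Ω) : Prop :=
  ∀ x x' y y', Maps α x y → Maps α x' y' → blk x ≤ blk x' → blk y ≤ blk y'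

/-- The monoid of all stable and block-order-preserving partial permutations of `Ω`, for the
ordered partition given by `blk`. -/
def POIPartition {Ω : Type*} {k : ℕ} (blk : Ω → Fin k) : Submonoid (PartialPerm Ω) where
  carrier := {α | IsStable blk α ∧ IsBlockOrderPreserving blk α}
  one_mem' := by
    refine ⟨fun x y h => ?_, fun x x' y y' h h' hb => ?_⟩
    · obtain rfl := maps_one.1 h
      refine ⟨fun x' _ => ⟨x', maps_one.2 rfl⟩, ?_⟩
      ext y'
      constructor
      · rintro ⟨x', hx', hm⟩
        obtain rfl := maps_one.1 hm
        exact hx'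
      · exact fun hy => ⟨y', hy, maps_one.2 rfl⟩
    · obtain rfl := maps_one.1 h
      obtain rfl := maps_one.1 h'
      exact hb
  mul_mem' := by
    rintro α β ⟨hα, hα'⟩ ⟨hβ, hβ'⟩
    refine ⟨fun x z h => ?_, fun x x' z z' h h' hb => ?_⟩
    · obtain ⟨y, hxy, hyz⟩ := maps_mul.1 h
      obtain ⟨hd, hi⟩ := hα x y hxy
      obtain ⟨hd2, hi2⟩ := hβ y z hyz
      have key : ∀ x' y', blk x' = blk x → Maps α x' y' → blk y' = blk y := by
        intro x' y' hx' hm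
        have : y' ∈ {y' | ∃ x', blk x' = blk x ∧ Maps α x' y'} := ⟨x', hx', hm⟩
        rw [hi] at this
        exact this
      refine ⟨fun x' hx' => ?_, ?_⟩
      · obtain ⟨y', hy'⟩ := hd x' hx'
        obtain ⟨z', hz'⟩ := hd2 y' (key x' y' hx' hy')
        exact ⟨z', maps_mul.2 ⟨y', hy', hz'⟩⟩
      · rw [← hi2]
        ext z'
        constructor
        · rintro ⟨x', hx', hm⟩
          obtain ⟨y', hy', hz'⟩ := maps_mul.1 hm
          exact ⟨y', key x' y' hx' hy', hz'⟩
        · rintro ⟨y', hy', hz'⟩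
          have : y' ∈ {y' | blk y' = blk y} := hy'
          rw [← hi] at this
          obtain ⟨x', hx', hm⟩ := this
          exact ⟨x', hx', maps_mul.2 ⟨y', hm, hz'⟩⟩
    · obtain ⟨y, hxy, hyz⟩ := maps_mul.1 h
      obtain ⟨y', hxy', hyz'⟩ := maps_mul.1 h'
      exact hβ' y y' z z' hyz hyz' (hα' x x' y y' hxy hxy' hb)

/-- The monoid for `k` consecutive intervals of length `m` in a chain with `k * m` elements
(numbered from `0`): the point `x` lies in the interval with number `x / m`. -/
abbrev POI (k m : ℕ) : Submonoid (PartialPerm (Fin (k * m))) :=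
  POIPartition (fun x : Fin (k * m) => x.divNat)

/-! ### The generators as transformations -/

/-- The `m`-cycle `b = (1 2 ⋯ m)`. -/
def cycB (m : ℕ) : Equiv.Perm (Fin m) := finRotate m

/-- The transposition `a = (1 2)` (for `m ≥ 2`). -/
def transA (m : ℕ) : Equiv.Perm (Fin m) :=
  if h : 2 ≤ m then Equiv.swap ⟨0, by omega⟩ ⟨1, by omega⟩ else 1

/-- `c = (1 3 4 ⋯ m)`: first `a`, then `b`. -/
def cycC (m : ℕ) : Equiv.Perm (Fin m) := (transA m).trans (cycB m)

/-- The tuple with `b` in the place `i`, `c` in the cyclically next place, and `1` elsewhere. -/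
def tupleD (k m : ℕ) (i : Fin k) : Fin k → Equiv.Perm (Fin m) :=
  Pi.mulSingle i (cycB m) * Pi.mulSingle (finRotate k i) (cycC m)

/-- The permutation of the chain that acts on the `i`-th interval as `z i`. -/
def unitOf {k m : ℕ} (z : Fin k → Equiv.Perm (Fin m)) : PartialPerm (Fin (k * m)) :=
  ((finProdFinEquiv.symm.trans (Equiv.prodShear (Equiv.refl (Fin k)) z)).trans
    finProdFinEquiv).toPEquiv

/-- The generator `d̄` of the group of units, for the place `i`. -/
def dBar (k m : ℕ) (i : Fin k) : PartialPerm (Fin (k * m)) := unitOf (tupleD k m i)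

/-- The order preserving partial permutations `x_0, …, x_{k-1}` of the chain `1 < ⋯ < k`:
`x_0` sends `p` to `p - 1` for `p ≥ 2`; for `i ≥ 1`, `x_i` sends `k - i` to `k - i + 1`, is
undefined at `k - i + 1` and fixes all other points.  In `Fin k` the element `k - i` of the chain
is `Fin.rev i`, and `finRotate k` of it is `k - i + 1` (which is `1` if `i = 0`). -/
def xSmall (k : ℕ) (i : Fin k) : PartialPerm (Fin k) :=
  (PEquiv.ofSet {p : Fin k | p ≠ finRotate k (Fin.rev i)}).trans
    (if (i : ℕ) = 0 then (finRotate k).symm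
      else Equiv.swap (Fin.rev i) (finRotate k (Fin.rev i))).toPEquiv

/-- The blow-up of a partial permutation of the `k` indices: if `θ` sends `i` to `j`, then the
`i`-th interval is translated onto the `j`-th one. -/
def blowUp {k : ℕ} (m : ℕ) (θ : PartialPerm (Fin k)) : PartialPerm (Fin (k * m)) where
  toFun x := (PEquiv.toFun θ x.divNat).map fun j => finProdFinEquiv (j, x.modNat)
  invFun y := (PEquiv.invFun θ y.divNat).map fun j => finProdFinEquiv (j, y.modNat)
  inv := by
    intro x y
    have e : ∀ (j : Fin k) (u v : Fin (k * m)),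
        finProdFinEquiv (j, u.modNat) = v ↔ j = v.divNat ∧ u.modNat = v.modNat := by
      intro j u v
      rw [← Equiv.eq_symm_apply]
      exact Prod.ext_iff
    simp only [Option.map_eq_some_iff, e]
    constructor
    · rintro ⟨j, hj, rfl, h⟩
      exact ⟨_, (PEquiv.inv θ _ _).1 hj, rfl, h.symm⟩
    · rintro ⟨j, hj, rfl, h⟩
      exact ⟨_, (PEquiv.inv θ _ _).2 hj, rfl, h.symm⟩

/-- The generator `x̄_i`. -/
def xBar (k m : ℕ) (i : Fin k) : PartialPerm (Fin (k * m)) := blowUp m (xSmall k i)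

/-! ### The presentation -/

/-- The alphabet `D ∪ X`: the letters `d_1, …, d_k` (here `d i` stands for the letter with index
`i + 1`) and `x_0, …, x_{k-1}`. -/
inductive Letter (k : ℕ) : Type
  | d (i : Fin k) : Letter k
  | x (i : Fin k) : Letter k

/-- The one-letter word `d_i`, for `1 ≤ i ≤ k` (the relations use no other indices). -/
def d (k i : ℕ) : FreeMonoid (Letter k) :=
  if h : 1 ≤ i ∧ i ≤ k then FreeMonoid.of (Letter.d ⟨i - 1, by omega⟩) else 1

/-- The one-letter word `x_i`, for `0 ≤ i ≤ k - 1` (the relations use no other indices). -/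
def x (k i : ℕ) : FreeMonoid (Letter k) :=
  if h : i < k then FreeMonoid.of (Letter.x ⟨i, h⟩) else 1

/-- The word `x_i x_{i+1} ⋯ x_{j-1}`, which is empty if `j ≤ i`. -/
def xRun (k i j : ℕ) : FreeMonoid (Letter k) :=
  ((List.range' i (j - i)).map (x k)).prod

/-- The relations `V`, on the letters `d_1, …, d_k`. -/
inductive V (k m : ℕ) : FreeMonoid (Letter k) → FreeMonoid (Letter k) → Prop
  | v1_first : V k m ((d k k ^ m * d k 1 ^ (m - 1)) ^ 2) 1
  | v1 (i : ℕ) (h1 : 1 ≤ i) (h2 : i ≤ k - 1) :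
      V k m ((d k i ^ m * d k (i + 1) ^ (m - 1)) ^ 2) 1
  | v2 (i : ℕ) (h1 : 1 ≤ i) (h2 : i ≤ k) : V k m (d k i ^ (m * (m - 1))) 1
  | v3_first : V k m ((d k 1 ^ (m - 1) ^ 2 * d k k ^ m * d k 1 ^ (m - 1)) ^ (m - 1)) 1
  | v3 (i : ℕ) (h1 : 1 ≤ i) (h2 : i ≤ k - 1) :
      V k m ((d k (i + 1) ^ (m - 1) ^ 2 * d k i ^ m * d k (i + 1) ^ (m - 1)) ^ (m - 1)) 1
  | v4_first : V k m ((d k k ^ m * d k 1 ^ ((m - 1) ^ 2 * (m - 2)) * d k k ^ m) ^ 3) 1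
  | v4 (i : ℕ) (h1 : 1 ≤ i) (h2 : i ≤ k - 1) :
      V k m ((d k i ^ m * d k (i + 1) ^ ((m - 1) ^ 2 * (m - 2)) * d k i ^ m) ^ 3) 1
  | v5_first (j : ℕ) (hj1 : 2 ≤ j) (hj2 : j ≤ m - 2) :
      V k m ((d k k ^ m * d k 1 ^ ((m - 1) ^ 2 * (m - j - 1)) *
        d k k ^ m * d k 1 ^ ((m - 1) ^ 2 * (j - 1))) ^ 2) 1
  | v5 (i j : ℕ) (hj1 : 2 ≤ j) (hj2 : j ≤ m - 2) (h1 : 1 ≤ i) (h2 : i ≤ k - 1) :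
      V k m ((d k i ^ m * d k (i + 1) ^ ((m - 1) ^ 2 * (m - j - 1)) *
        d k i ^ m * d k (i + 1) ^ ((m - 1) ^ 2 * (j - 1))) ^ 2) 1
  | v6_cc (i j : ℕ) (h1 : 1 ≤ i) (h2 : i < j) (h3 : j ≤ k) :
      V k m (d k i ^ m * d k j ^ m) (d k j ^ m * d k i ^ m)
  | v6_bb (i j : ℕ) (h1 : 1 ≤ i) (h2 : i < j) (h3 : j ≤ k) :
      V k m (d k i ^ (m - 1) ^ 2 * d k j ^ (m - 1) ^ 2)
        (d k j ^ (m - 1) ^ 2 * d k i ^ (m - 1) ^ 2)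
  | v6_bc_first (i : ℕ) (h1 : 2 ≤ i) (h2 : i ≤ k - 1) :
      V k m (d k i ^ (m - 1) ^ 2 * d k k ^ m) (d k k ^ m * d k i ^ (m - 1) ^ 2)
  | v6_bc (i j : ℕ) (h1 : 1 ≤ i) (h2 : i ≤ k) (h3 : 1 ≤ j) (h4 : j ≤ k - 1)
      (h5 : i ≠ j) (h6 : i ≠ j + 1) :
      V k m (d k i ^ (m - 1) ^ 2 * d k j ^ m) (d k j ^ m * d k i ^ (m - 1) ^ 2)

/-- The relations `W`, on the letters `x_0, …, x_{k-1}`. -/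
inductive W (k : ℕ) : FreeMonoid (Letter k) → FreeMonoid (Letter k) → Prop
  | w1 (i : ℕ) (h1 : 1 ≤ i) (h2 : i ≤ k - 2) : W k (x k i * x k 0) (x k 0 * x k (i + 1))
  | w2 (i j : ℕ) (h1 : 2 ≤ i + 1) (h2 : i + 1 < j) (h3 : j ≤ k - 1) :
      W k (x k j * x k i) (x k i * x k j)
  | w3_left : W k (x k 0 ^ 2 * x k 1) (x k 0 ^ 2)
  | w3_right : W k (x k 0 ^ 2) (x k (k - 1) * x k 0 ^ 2)
  | w4_left (i : ℕ) (h1 : 1 ≤ i) (h2 : i ≤ k - 2) :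
      W k (x k (i + 1) * x k i * x k (i + 1)) (x k (i + 1) * x k i)
  | w4_right (i : ℕ) (h1 : 1 ≤ i) (h2 : i ≤ k - 2) :
      W k (x k (i + 1) * x k i) (x k i * x k (i + 1) * x k i)
  | w5 (i : ℕ) (h : i ≤ k - 1) : W k (xRun k i k * xRun k 0 i * x k i) (x k i)
  | w6 (i : ℕ) (h1 : 1 ≤ i) (h2 : i ≤ k - 1) :
      W k (xRun k (i + 1) k * xRun k 0 i * x k i ^ 2) (x k i ^ 2)

/-- The relations `V'`, which involve both kinds of letters. -/
inductive V' (k m : ℕ) : FreeMonoid (Letter k) → FreeMonoid (Letter k) → Prop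
  | v1_a : V' k m (d k k ^ m * d k 1 ^ (m - 1) * x k 0) (x k 0)
  | v1_b : V' k m (d k 1 ^ (m - 1) ^ 2 * x k 0) (x k 0)
  | v2_a_first :
      V' k m (x k 0 * d k k ^ m * d k 1 ^ (m - 1)) (d k 1 ^ m * d k 2 ^ (m - 1) * x k 0)
  | v2_a (i : ℕ) (h1 : 1 ≤ i) (h2 : i ≤ k - 2) :
      V' k m (x k 0 * d k i ^ m * d k (i + 1) ^ (m - 1))
        (d k (i + 1) ^ m * d k (i + 2) ^ (m - 1) * x k 0)
  | v2_b (i : ℕ) (h1 : 1 ≤ i) (h2 : i ≤ k - 1) :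
      V' k m (x k 0 * d k i ^ (m - 1) ^ 2) (d k (i + 1) ^ (m - 1) ^ 2 * x k 0)
  | v3_a (i : ℕ) (h : i ≤ k - 2) :
      V' k m (x k i * d k (k - i - 1) ^ m * d k (k - i) ^ (m - 1)) (x k i)
  | v3_a_last : V' k m (x k (k - 1) * d k k ^ m * d k 1 ^ (m - 1)) (x k (k - 1))
  | v3_b (i : ℕ) (h : i ≤ k - 1) : V' k m (x k i * d k (k - i) ^ (m - 1) ^ 2) (x k i)
  | v4_a (i : ℕ) (h1 : 1 ≤ i) (h2 : i ≤ k - 1) :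
      V' k m (d k i ^ m * d k (i + 1) ^ (m - 1) * x k (k - i)) (x k (k - i))
  | v4_b (i : ℕ) (h1 : 1 ≤ i) (h2 : i ≤ k - 1) :
      V' k m (d k (i + 1) ^ (m - 1) ^ 2 * x k (k - i)) (x k (k - i))
  | v5_a (i : ℕ) (h1 : 1 ≤ i) (h2 : i ≤ k - 2) :
      V' k m (x k i * d k (k - i) ^ m * d k (k - i + 1) ^ (m - 1))
        (d k (k - i - 1) ^ m * d k (k - i) ^ (m - 1) * x k i)
  | v5_a_last :
      V' k m (x k (k - 1) * d k 1 ^ m * d k 2 ^ (m - 1))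
        (d k k ^ m * d k 1 ^ (m - 1) * x k (k - 1))
  | v5_b (i : ℕ) (h1 : 1 ≤ i) (h2 : i ≤ k - 1) :
      V' k m (x k i * d k (k - i + 1) ^ (m - 1) ^ 2) (d k (k - i) ^ (m - 1) ^ 2 * x k i)
  | v6_a_first (i : ℕ) (h1 : 1 ≤ i) (h2 : i ≤ k - 2) :
      V' k m (x k i * d k k ^ m * d k 1 ^ (m - 1)) (d k k ^ m * d k 1 ^ (m - 1) * x k i)
  | v6_a (i j : ℕ) (h1 : 1 ≤ i) (h2 : i ≤ k - 1) (h3 : 1 ≤ j) (h4 : j ≤ k - 1)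
      (h5 : j ≠ k - i - 1) (h6 : j ≠ k - i) :
      V' k m (x k i * d k j ^ m * d k (j + 1) ^ (m - 1))
        (d k j ^ m * d k (j + 1) ^ (m - 1) * x k i)
  | v6_b (i j : ℕ) (h1 : 1 ≤ i) (h2 : i ≤ k - 1) (h3 : 1 ≤ j) (h4 : j ≤ k)
      (h5 : j ≠ k - i) (h6 : j ≠ k - i + 1) :
      V' k m (x k i * d k j ^ (m - 1) ^ 2) (d k j ^ (m - 1) ^ 2 * x k i)

/-- The relations `V ∪ W ∪ V'`. -/
def Rels (k m : ℕ) (u v : FreeMonoid (Letter k)) : Prop :=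
  V k m u v ∨ W k u v ∨ V' k m u v

end POIPresentation

/-! A stable, block-order-preserving partial permutation is determined by two things: the order
preserving partial permutation `θ` of the `k` indices that it induces, and a permutation of `{1, …,
m}` for each block of the domain. Hence every element is a unit (a tuple in `S_m^k`) times the
blow-up of some `θ`, and two such products agree exactly when the `θ` agree and the tuples agree on
the domain of `θ`. The proof produces the same normal form in the presented monoid, one set of
relations for each ingredient.

The relations `V` give the units. Since `b^m = 1` and `c^{m-1} = 1`, the powers `d_{i-1}^m`,
`d_i^{m-1}` and `d_i^q` isolate `c_i`, `b_i⁻¹` and `b_i`, so that `d_{i-1}^m d_i^{m-1}` stands for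
`a_i`. In these terms `V` yields Moore's relations for each pair `a_i, b_i` and commutation between
different places. Moore's presentation of `S_m` is proved by passing to the conjugates of `a`, which
satisfy the Coxeter relations (`IsMoorePair.exists_hom`). The result is a homomorphism from `S_m^k`
whose image contains every `d_i` (`IsUnitSystem.exists_monoidHom`).

The relations `W` give the partial permutations of the index chain: products of letters `x_i` that
induce the same `θ` are equal (`pairClosure_fst_eq`). For each set `A` there is a canonical product
`v` that sends an initial segment onto `A`, independent of the order of the moves (`Reach.unique`).
If `u` and `u'` both induce `θ`, with domain `A`, then `v u` and `v u'` are canonical products for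
the same image, hence equal, and `v` can be cancelled (`Reach.cancel`). That the letters generate
all order preserving `θ` is an induction on the total displacement.

The relations `V'` say that each `x_i` carries the component of a tuple at `p` to the component at
the image of `p`, and absorbs components at points outside its domain or image (`Intertwines`). So
units can be collected on the left, every element becomes `F z * u`, and `u` absorbs precisely the
ambiguity in `z`.

Permutations compose from right to left, whereas partial permutations act on the right. Therefore
tuples act through their inverses, and `b⁻¹` appears where the presentation has `b`.

For the number of relations, each set is written as a union of injectively parametrised families of
pairs of words. The families are told apart by letter counts, first letters and sums of indices. -/

namespace POIPresentation

open Equiv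

/-! ### Descending products and braid relations in a monoid -/

section DescendingRuns

variable {M : Type*} [Monoid M]

/-- The product `y_{j-1} y_{j-2} ⋯ y_i`, which is empty if `j ≤ i`. -/
def descRun (y : ℕ → M) (i : ℕ) : ℕ → M
  | 0 => 1
  | j + 1 => if i ≤ j then y j * descRun y i j else 1

theorem descRun_succ (y : ℕ → M) {i j : ℕ} (h : i ≤ j) :
    descRun y i (j + 1) = y j * descRun y i j := by
  simp [descRun, h]

theorem descRun_of_le (y : ℕ → M) {i j : ℕ} (h : j ≤ i) : descRun y i j = 1 := by
  cases j with
  | zero => rfl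
  | succ j => simp [descRun, show ¬ i ≤ j by omega]

@[simp]
theorem descRun_self (y : ℕ → M) (i : ℕ) : descRun y i i = 1 := descRun_of_le y le_rfl

theorem descRun_single (y : ℕ → M) (i : ℕ) : descRun y i (i + 1) = y i := by
  simp [descRun_succ]

theorem descRun_split (y : ℕ → M) {i l j : ℕ} (h : i ≤ l) (h' : l ≤ j) :
    descRun y i j = descRun y l j * descRun y i l := by
  induction j, h' using Nat.le_induction with
  | base => simp
  | succ j hj ih => rw [descRun_succ y (h.trans hj), descRun_succ y hj, ih, mul_assoc]

theorem descRun_eq_mul_last (y : ℕ → M) {i j : ℕ} (h : i < j) :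
    descRun y i j = descRun y (i + 1) j * y i := by
  rw [descRun_split y (Nat.le_succ i) h, descRun_single]

theorem commute_descRun {y : ℕ → M} {a : M} {i j : ℕ}
    (h : ∀ q, i ≤ q → q < j → Commute a (y q)) : Commute a (descRun y i j) := by
  induction j with
  | zero => exact Commute.one_right a
  | succ j ih =>
    by_cases hij : i ≤ j
    · rw [descRun_succ y hij]
      exact (h j hij (Nat.lt_succ_self j)).mul_right
        (ih fun q h1 h2 => h q h1 (h2.trans (Nat.lt_succ_self j)))
    · rw [descRun_of_le y (by omega)]
      exact Commute.one_right a

theorem map_descRun {N : Type*} [Monoid N] (f : M →* N) (y : ℕ → M) (i j : ℕ) :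
    f (descRun y i j) = descRun (fun p => f (y p)) i j := by
  induction j with
  | zero => exact map_one f
  | succ j ih =>
    by_cases h : i ≤ j
    · rw [descRun_succ _ h, descRun_succ _ h, map_mul, ih]
    · rw [descRun_of_le _ (by omega), descRun_of_le _ (by omega), map_one]

/-- The braid relations for `y_0, …, y_{n-1}`. -/
structure IsBraided (n : ℕ) (y : ℕ → M) : Prop where
  far : ∀ p q, p + 1 < q → q < n → Commute (y p) (y q)
  braid : ∀ p, p + 1 < n → y (p + 1) * y p * y (p + 1) = y p * y (p + 1) * y p

/-- The run contains `y_{p+1} y_p`, where one braid relation applies. The factors to the right of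
this pair commute with `y_{p+1}` and those to its left commute with `y_p`. -/
theorem IsBraided.descRun_mul {n : ℕ} {y : ℕ → M} (H : IsBraided n y) {i j p : ℕ} (hi : i ≤ p)
    (hp : p + 1 < j) (hj : j ≤ n) :
    descRun y i j * y (p + 1) = y p * descRun y i j := by
  have e : descRun y i j = descRun y (p + 2) j * (y (p + 1) * (y p * descRun y i p)) := by
    rw [descRun_split y (show i ≤ p + 2 by omega) (show p + 2 ≤ j by omega),
      descRun_succ y (show i ≤ p + 1 by omega), descRun_succ y hi]
  have c1 : Commute (y (p + 1)) (descRun y i p) :=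
    commute_descRun fun q _ h2 => (H.far q (p + 1) (by omega) (by omega)).symm
  have c2 : Commute (y p) (descRun y (p + 2) j) :=
    commute_descRun fun q h1 h2 => H.far p q (by omega) (by omega)
  have b := H.braid p (by omega)
  calc descRun y i j * y (p + 1)
      = descRun y (p + 2) j * (y (p + 1) * (y p * (descRun y i p * y (p + 1)))) := by
        rw [e]; simp only [mul_assoc]
    _ = descRun y (p + 2) j * (y (p + 1) * y p * y (p + 1)) * descRun y i p := by
        rw [← c1.eq]; simp only [mul_assoc]
    _ = descRun y (p + 2) j * y p * (y (p + 1) * (y p * descRun y i p)) := by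
        rw [b]; simp only [mul_assoc]
    _ = y p * descRun y i j := by
        rw [← c2.eq, e]; simp only [mul_assoc]

end DescendingRuns

/-! ### Coxeter relations of type A determine the symmetric group -/

section Coxeter

variable {Γ : Type*} [Group Γ] {m : ℕ}

/-- The runs represent the cosets of the smaller subgroup. Right multiplication by `t_i` commutes
with the run if `i + 1 < j`, lengthens it if `i + 1 = j`, shortens it if `i = j`, and crosses it as
`t_{i-1}` if `i > j`. -/
theorem mem_closure_Iio_succ {n : ℕ} {t : ℕ → Γ} (H : IsBraided (n + 1) t)
    (sq : ∀ i ≤ n, t i * t i = 1) {g : Γ}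
    (hg : g ∈ Subgroup.closure (t '' Set.Iio (n + 1))) :
    ∃ j ≤ n + 1, ∃ h ∈ Subgroup.closure (t '' Set.Iio n), g = h * descRun t j (n + 1) := by
  have step : ∀ x : Γ, (∃ j ≤ n + 1, ∃ h ∈ Subgroup.closure (t '' Set.Iio n),
      x = h * descRun t j (n + 1)) → ∀ i < n + 1,
      ∃ j ≤ n + 1, ∃ h ∈ Subgroup.closure (t '' Set.Iio n),
        x * t i = h * descRun t j (n + 1) := by
    rintro _ ⟨j, hj, h, hh, rfl⟩ i hi
    have mem : ∀ p < n, h * t p ∈ Subgroup.closure (t '' Set.Iio n) := fun p hp =>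
      mul_mem hh (Subgroup.subset_closure ⟨p, hp, rfl⟩)
    rcases lt_trichotomy (i + 1) j with h1 | h1 | h1
    · refine ⟨j, hj, h * t i, mem i (by omega), ?_⟩
      have : Commute (t i) (descRun t j (n + 1)) :=
        commute_descRun fun q h2 h3 => H.far i q (by omega) h3
      rw [mul_assoc, mul_assoc, this.eq]
    · subst h1
      exact ⟨i, by omega, h, hh, by rw [descRun_eq_mul_last t hi, mul_assoc]⟩
    · rcases Nat.eq_or_lt_of_le (show j ≤ i by omega) with rfl | h2
      · refine ⟨j + 1, by omega, h, hh, ?_⟩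
        rw [descRun_eq_mul_last t hi, mul_assoc, mul_assoc, sq j (by omega), mul_one]
      · obtain ⟨p, rfl⟩ : ∃ p, i = p + 1 := ⟨i - 1, by omega⟩
        refine ⟨j, hj, h * t p, mem p (by omega), ?_⟩
        rw [mul_assoc, H.descRun_mul (by omega) hi le_rfl, mul_assoc]
  induction hg using Subgroup.closure_induction_right with
  | one => exact ⟨n + 1, le_rfl, 1, one_mem _, by simp⟩
  | mul_right x hx y hy ih =>
    obtain ⟨i, hi, rfl⟩ := hy
    exact step x ih i hi
  | mul_inv_cancel x hx y hy ih =>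
    obtain ⟨i, hi, rfl⟩ := hy
    rw [inv_eq_of_mul_eq_one_left (sq i (Nat.le_of_lt_succ hi))]
    exact step x ih i hi

/-- In a group with elements that satisfy the Coxeter relations of type `A`, a homomorphism that
sends them to the adjacent transpositions is injective on the subgroup that they generate. -/
theorem eq_one_of_mem_closure_of_map_eq_one (π : Γ →* Perm (Fin m)) {t : ℕ → Γ} {n : ℕ}
    (hn : n < m) (H : IsBraided n t) (sq : ∀ i < n, t i * t i = 1)
    (hπ : ∀ i (hi : i < n), π (t i) = swap ⟨i, by omega⟩ ⟨i + 1, by omega⟩) {g : Γ}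
    (hg : g ∈ Subgroup.closure (t '' Set.Iio n)) (h1 : π g = 1) : g = 1 := by
  induction n generalizing g with
  | zero => simpa using hg
  | succ n ih =>
    obtain ⟨j, hj, h, hh, rfl⟩ := mem_closure_Iio_succ H (fun i hi => sq i (by omega)) hg
    -- The image of `h` fixes `n + 1` and that of the run sends `j` to `n + 1`, so a trivial image
    -- forces `j = n + 1`, that is, an empty run.
    have run : ∀ l, j ≤ l → (hl : l ≤ n + 1) →
        π (descRun t j l) ⟨j, by omega⟩ = ⟨l, by omega⟩ := by
      intro l hjl
      induction l, hjl using Nat.le_induction with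
      | base => intro; simp
      | succ l hjl ihl =>
        intro hl
        rw [descRun_succ t hjl, map_mul, Perm.mul_apply, ihl (by omega), hπ l (by omega),
          swap_apply_left]
    have fix : π h ⟨n + 1, hn⟩ = ⟨n + 1, hn⟩ := by
      have : Subgroup.closure (t '' Set.Iio n) ≤
          (MulAction.stabilizer (Perm (Fin m)) (⟨n + 1, hn⟩ : Fin m)).comap π := by
        rw [Subgroup.closure_le]
        rintro _ ⟨i, hi, rfl⟩
        have hi' : i < n := hi
        change π (t i) ⟨n + 1, hn⟩ = ⟨n + 1, hn⟩
        rw [hπ i (by omega)]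
        apply swap_apply_of_ne_of_ne <;> simp only [ne_eq, Fin.mk.injEq] <;> omega
      exact this hh
    have hjn : j = n + 1 := by
      have := congrArg (fun σ : Perm (Fin m) => σ ⟨j, by omega⟩) h1
      simp only [map_mul, Perm.mul_apply, run (n + 1) hj le_rfl, fix, Perm.one_apply,
        Fin.mk.injEq] at this
      exact this.symm
    subst hjn
    rw [descRun_self, mul_one] at h1 ⊢
    exact ih (by omega) ⟨fun p q a b => H.far p q a (by omega), fun p a => H.braid p (by omega)⟩
      (fun i hi => sq i (by omega)) (fun i hi => hπ i (by omega)) hh h1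

end Coxeter

/-! ### Moore's presentation of the symmetric group -/

section Moore

/-- Moore's relations for the generators `(1 2)` and `(1 2 ⋯ m)` of the symmetric group. -/
structure IsMoorePair {Γ : Type*} [Group Γ] (m : ℕ) (α β : Γ) : Prop where
  sq : α * α = 1
  pow : β ^ m = 1
  mul_pow : (α * β) ^ (m - 1) = 1
  braid : (α * (β * α * β⁻¹)) ^ 3 = 1
  far : ∀ j, 2 ≤ j → j ≤ m - 2 → (α * (β ^ j * α * (β ^ j)⁻¹)) ^ 2 = 1

namespace IsMoorePair

variable {Γ : Type*} [Group Γ] {m : ℕ} {α β : Γ}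

/-- The conjugates of the first generator, which satisfy the Coxeter relations. -/
def conj (α β : Γ) (i : ℕ) : Γ := β ^ i * α * (β ^ i)⁻¹

theorem conj_sq (H : IsMoorePair m α β) (i : ℕ) : conj α β i * conj α β i = 1 := by
  have : conj α β i * conj α β i = β ^ i * (α * α) * (β ^ i)⁻¹ := by
    simp only [conj]; group
  rw [this, H.sq]; group

/-- Conjugation by `β^i` shifts indices, so a product of two of these elements is conjugate to one
of Moore's words. For involutions, `(xy)^2 = 1` means commutation and `(xy)^3 = 1` is the braid
relation. -/
theorem conj_isBraided (H : IsMoorePair m α β) : IsBraided (m - 1) (conj α β) := by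
  have inv : ∀ i, (conj α β i)⁻¹ = conj α β i := fun i =>
    inv_eq_of_mul_eq_one_left (H.conj_sq i)
  have shift : ∀ i j, conj α β i * conj α β (i + j) =
      β ^ i * (α * (β ^ j * α * (β ^ j)⁻¹)) * (β ^ i)⁻¹ := by
    intro i j
    simp only [conj, pow_add]; group
  constructor
  · intro p q h1 h2
    obtain ⟨j, rfl⟩ : ∃ j, q = p + j := ⟨q - p, by omega⟩
    have e : (conj α β p * conj α β (p + j)) ^ 2 = 1 := by
      rw [shift, conj_pow, H.far j (by omega) (by omega)]; group
    have e' := eq_inv_of_mul_eq_one_left ((pow_two _).symm.trans e)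
    rw [mul_inv_rev, inv, inv] at e'
    exact e'
  · intro p h
    have e : (conj α β p * conj α β (p + 1)) ^ 3 = 1 := by
      rw [shift, conj_pow, pow_one, H.braid]; group
    have e2 : (conj α β p * conj α β (p + 1) * conj α β p) *
        (conj α β (p + 1) * conj α β p * conj α β (p + 1)) = 1 := by
      rw [← e]; simp only [pow_succ, pow_zero, one_mul, mul_assoc]
    have e3 := eq_inv_of_mul_eq_one_left e2
    rw [mul_inv_rev, mul_inv_rev, inv, inv, ← mul_assoc] at e3
    exact e3.symm

/-- The element `(αβ)^n β^{-n}` is the product of the first `n` conjugates. For `n = m - 1` it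
equals `β^{-(m-1)} = β`. -/
theorem mem_closure_conj (H : IsMoorePair m α β) (hm : 2 ≤ m) :
    Subgroup.closure {α, β} ≤ Subgroup.closure (conj α β '' Set.Iio (m - 1)) := by
  have mem : ∀ i < m - 1, conj α β i ∈ Subgroup.closure (conj α β '' Set.Iio (m - 1)) :=
    fun i hi => Subgroup.subset_closure ⟨i, hi, rfl⟩
  have key : ∀ n, n ≤ m - 1 →
      (α * β) ^ n * (β ^ n)⁻¹ ∈ Subgroup.closure (conj α β '' Set.Iio (m - 1)) := by
    intro n hn
    induction n with
    | zero => simp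
    | succ n ih =>
      have : (α * β) ^ (n + 1) * (β ^ (n + 1))⁻¹ =
          (α * β) ^ n * (β ^ n)⁻¹ * conj α β n := by
        simp only [conj, pow_succ]; group
      rw [this]
      exact mul_mem (ih (by omega)) (mem n (by omega))
  rw [Subgroup.closure_le]
  refine Set.insert_subset (by simpa [conj] using mem 0 (by omega)) (Set.singleton_subset_iff.2 ?_)
  · have h := key (m - 1) le_rfl
    have e : β⁻¹ ^ (m - 1) = β := by
      rw [inv_pow]
      apply inv_eq_of_mul_eq_one_left
      rw [← pow_succ', Nat.sub_add_cancel (by omega), H.pow]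
    rwa [H.mul_pow, one_mul, ← inv_pow, e] at h

end IsMoorePair

variable {m : ℕ}

theorem transA_eq (hm : 2 ≤ m) : transA m = swap ⟨0, by omega⟩ ⟨1, by omega⟩ := dif_pos hm

theorem cycB_of_lt {x : Fin m} (h : (x : ℕ) + 1 < m) : cycB m x = ⟨x + 1, h⟩ := by
  obtain ⟨n, rfl⟩ : ∃ n, m = n + 1 := ⟨m - 1, by omega⟩
  exact finRotate_of_lt (k := x) (by omega)

theorem cycB_last {x : Fin m} (h : (x : ℕ) + 1 = m) : cycB m x = ⟨0, by omega⟩ := by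
  obtain ⟨n, rfl⟩ : ∃ n, m = n + 1 := ⟨m - 1, by omega⟩
  have : x = Fin.last n := Fin.ext (by simpa using h)
  subst this
  exact finRotate_last

theorem cycB_pow_zero {i : ℕ} (hi : i < m) : (cycB m ^ i) ⟨0, by omega⟩ = ⟨i, hi⟩ := by
  induction i with
  | zero => rfl
  | succ i ih => rw [pow_succ', Perm.mul_apply, ih (by omega), cycB_of_lt hi]

theorem closure_transA_cycB (hm : 2 ≤ m) : Subgroup.closure {transA m, cycB m} = ⊤ := by
  have h := Perm.closure_cycle_adjacent_swap (isCycle_finRotate_of_le hm)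
    (support_finRotate_of_le hm) ⟨0, by omega⟩
  rw [Set.pair_comm, transA_eq hm]
  rw [← h]
  have : (finRotate m) ⟨0, by omega⟩ = (⟨1, by omega⟩ : Fin m) := cycB_of_lt (x := ⟨0, by omega⟩) hm
  rw [this]
  rfl

theorem conj_transA (hm : 2 ≤ m) {i : ℕ} (hi : i < m - 1) :
    IsMoorePair.conj (transA m) (cycB m) i = swap ⟨i, by omega⟩ ⟨i + 1, by omega⟩ := by
  have e : (⟨1, by omega⟩ : Fin m) = cycB m ⟨0, by omega⟩ := (cycB_of_lt (x := ⟨0, by omega⟩) hm).symm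
  rw [IsMoorePair.conj, transA_eq hm, ← swap_apply_apply, cycB_pow_zero (by omega), e,
    ← Perm.mul_apply, ← pow_succ, cycB_pow_zero (by omega)]

/-- Composed from right to left, the product fixes `0` and permutes `1, …, m - 1` cyclically. -/
theorem transA_mul_cycB_pow (hm : 2 ≤ m) : (transA m * cycB m) ^ (m - 1) = 1 := by
  have step : ∀ x : Fin m, 1 ≤ (x : ℕ) → (hx : (x : ℕ) + 1 < m) →
      (transA m * cycB m) x = ⟨x + 1, hx⟩ := by
    intro x h1 hx
    rw [Perm.mul_apply, cycB_of_lt hx, transA_eq hm]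
    apply swap_apply_of_ne_of_ne <;> simp only [ne_eq, Fin.mk.injEq] <;> omega
  have run : ∀ j, (hj : j + 1 < m) →
      ((transA m * cycB m) ^ j) ⟨1, by omega⟩ = ⟨j + 1, hj⟩ := by
    intro j hj
    induction j with
    | zero => rfl
    | succ j ih =>
      rw [pow_succ', Perm.mul_apply, ih (by omega), step _ (by simp) (by simpa using hj)]
  have h0 : (transA m * cycB m) ⟨0, by omega⟩ = ⟨0, by omega⟩ := by
    rw [Perm.mul_apply, cycB_of_lt (x := ⟨0, by omega⟩) (show 0 + 1 < m by omega), transA_eq hm]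
    exact swap_apply_right _ _
  have h1 : ((transA m * cycB m) ^ (m - 1)) ⟨1, by omega⟩ = ⟨1, by omega⟩ := by
    obtain ⟨n, rfl⟩ : ∃ n, m = n + 2 := ⟨m - 2, by omega⟩
    rw [show n + 2 - 1 = n + 1 from rfl, pow_succ', Perm.mul_apply, run n (by omega),
      Perm.mul_apply, cycB_last rfl, transA_eq hm]
    exact swap_apply_left _ _
  ext x : 1
  rcases Nat.eq_zero_or_pos (x : ℕ) with h | h
  · have : x = ⟨0, by omega⟩ := Fin.ext h
    rw [this]
    exact Perm.pow_apply_eq_self_of_apply_eq_self h0 _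
  · have hx := run (x - 1) (by omega)
    have e : (⟨x - 1 + 1, by omega⟩ : Fin m) = x := Fin.ext (by simp; omega)
    rw [e] at hx
    rw [← hx, ← Perm.mul_apply, ← pow_add, add_comm, pow_add, Perm.mul_apply, h1]
    rfl

theorem isMoorePair_perm (hm : 2 ≤ m) : IsMoorePair m (transA m) (cycB m) where
  sq := by rw [transA_eq hm, swap_mul_self]
  pow := by
    have h := (isCycle_finRotate_of_le hm).orderOf
    rw [support_finRotate_of_le hm, Finset.card_univ, Fintype.card_fin] at h
    exact orderOf_dvd_iff_pow_eq_one.1 (dvd_of_eq h)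
  mul_pow := transA_mul_cycB_pow hm
  braid := by
    -- For `m = 2` the two transpositions coincide; for `m ≥ 3` they share one point and their
    -- product is a three-cycle.
    rcases Nat.eq_or_lt_of_le hm with rfl | h
    · decide
    · have e := conj_transA hm (i := 1) (by omega)
      rw [IsMoorePair.conj, pow_one] at e
      rw [e, transA_eq hm, swap_comm]
      have := Perm.isThreeCycle_swap_mul_swap_same (a := (⟨1, by omega⟩ : Fin m))
        (b := ⟨0, by omega⟩) (c := ⟨2, by omega⟩) (by simp) (by simp) (by simp)
      rw [← this.orderOf]
      exact pow_orderOf_eq_one _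
  far j h1 h2 := by
    have e := conj_transA hm (i := j) (by omega)
    rw [IsMoorePair.conj] at e
    rw [e, transA_eq hm]
    have c : Commute (swap (⟨0, by omega⟩ : Fin m) ⟨1, by omega⟩)
        (swap ⟨j, by omega⟩ ⟨j + 1, by omega⟩) := by
      apply Perm.Disjoint.commute
      apply Perm.disjoint_swap_swap
      simp
      omega
    rw [c.mul_pow, pow_two, pow_two, swap_mul_self, swap_mul_self, one_mul]

/-- A pair of elements of a group that satisfies Moore's relations is the image of
`(1 2), (1 2 ⋯ m)` under a homomorphism from the symmetric group. -/
theorem IsMoorePair.exists_hom {G : Type*} [Group G] {a b : G} (hm : 2 ≤ m)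
    (H : IsMoorePair m a b) :
    ∃ f : Perm (Fin m) →* G, f (transA m) = a ∧ f (cycB m) = b := by
  -- The subgroup of the direct product generated by the two pairs turns out to be the graph of the
  -- required homomorphism: its first projection is injective by the Coxeter argument and surjective
  -- because `a` and `b` generate.
  let α : Perm (Fin m) × G := (transA m, a)
  let β : Perm (Fin m) × G := (cycB m, b)
  have P := isMoorePair_perm hm
  have HH : IsMoorePair m α β :=
    ⟨Prod.ext P.sq H.sq, Prod.ext P.pow H.pow, Prod.ext P.mul_pow H.mul_pow,
      Prod.ext P.braid H.braid, fun j h1 h2 => Prod.ext (P.far j h1 h2) (H.far j h1 h2)⟩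
  let K := Subgroup.closure {α, β}
  let π : K →* Perm (Fin m) := (MonoidHom.fst _ _).comp K.subtype
  have inj : Function.Injective π := by
    rw [injective_iff_map_eq_one]
    rintro ⟨g, hg⟩ h1
    have := eq_one_of_mem_closure_of_map_eq_one (MonoidHom.fst (Perm (Fin m)) G) (n := m - 1)
      (by omega) HH.conj_isBraided (fun i _ => HH.conj_sq i)
      (fun i hi => (conj_transA hm hi : _)) (HH.mem_closure_conj hm hg) h1
    exact Subtype.ext this
  have surj : Function.Surjective π := by
    rw [← MonoidHom.range_eq_top, eq_top_iff, ← closure_transA_cycB hm, Subgroup.closure_le]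
    rintro _ (rfl | rfl)
    · exact ⟨⟨α, Subgroup.subset_closure (by simp)⟩, rfl⟩
    · exact ⟨⟨β, Subgroup.subset_closure (by simp)⟩, rfl⟩
  let e := MulEquiv.ofBijective π ⟨inj, surj⟩
  refine ⟨(MonoidHom.snd _ _).comp (K.subtype.comp e.symm.toMonoidHom), ?_, ?_⟩
  · have : e.symm (transA m) = ⟨α, Subgroup.subset_closure (by simp)⟩ := by
      rw [MulEquiv.symm_apply_eq]; rfl
    change ((e.symm (transA m) : K) : Perm (Fin m) × G).2 = a
    rw [this]
  · have : e.symm (cycB m) = ⟨β, Subgroup.subset_closure (by simp)⟩ := by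
      rw [MulEquiv.symm_apply_eq]; rfl
    change ((e.symm (cycB m) : K) : Perm (Fin m) × G).2 = b
    rw [this]

end Moore

/-! ### Consequences of the relations `W`: moves, their inverses and partial identities -/

variable {M : Type*} [Monoid M]

/-- The relations for a shift `s` (sending `p + 1` to `p` on the chain `0 < ⋯ < n`) and for
elementary moves `y_p` (sending `p` to `p + 1`, for `p < n`) that are satisfied in the monoid of
order preserving partial permutations of the chain. -/
structure IsShiftMoveSystem (n : ℕ) (s : M) (y : ℕ → M) : Prop where
  far : ∀ p q, p + 1 < q → q < n → Commute (y p) (y q)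
  absorb : ∀ p, p + 1 < n → y p * y (p + 1) * y p = y p * y (p + 1)
  absorb' : ∀ p, p + 1 < n → y (p + 1) * y p * y (p + 1) = y p * y (p + 1)
  move_shift : ∀ p, p + 1 < n → y (p + 1) * s = s * y p
  sq_mul : s * s * y (n - 1) = s * s
  mul_sq : y 0 * (s * s) = s * s
  shift_regular : s * descRun y 0 n * s = s
  regular : ∀ p, p < n → descRun y 0 (p + 1) * s * descRun y (p + 1) n * y p = y p
  sq_regular : ∀ p, p < n →
    descRun y 0 p * s * descRun y (p + 1) n * (y p * y p) = y p * y p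

/-- The partial identity that omits the point `q`, as a product of generators. -/
def omitPoint (n : ℕ) (s : M) (y : ℕ → M) (q : ℕ) : M := descRun y 0 q * s * descRun y q n

/-- The inverse of the move `y_p`, as a product of generators. -/
def moveInv (n : ℕ) (s : M) (y : ℕ → M) (p : ℕ) : M := descRun y 0 p * s * descRun y (p + 1) n

namespace IsShiftMoveSystem

variable {n : ℕ} {s : M} {y : ℕ → M} (H : IsShiftMoveSystem n s y)
include H

theorem isBraided : IsBraided n y :=
  ⟨H.far, fun p hp => by rw [H.absorb' p hp, H.absorb p hp]⟩

omit H in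
theorem move_mul_moveInv (p : ℕ) : y p * moveInv n s y p = omitPoint n s y (p + 1) := by
  rw [moveInv, omitPoint, descRun_succ y (Nat.zero_le p)]
  simp only [mul_assoc]

omit H in
theorem moveInv_mul_move {p : ℕ} (hp : p < n) : moveInv n s y p * y p = omitPoint n s y p := by
  rw [moveInv, omitPoint, descRun_eq_mul_last y hp]
  simp only [mul_assoc]

theorem omitPoint_succ_mul_move {p : ℕ} (hp : p < n) : omitPoint n s y (p + 1) * y p = y p :=
  H.regular p hp

theorem move_mul_omitPoint {p : ℕ} (hp : p < n) : y p * omitPoint n s y p = y p := by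
  rw [← moveInv_mul_move hp, ← mul_assoc, move_mul_moveInv, H.omitPoint_succ_mul_move hp]

theorem omitPoint_zero_mul_shift : omitPoint n s y 0 * s = s := by
  rw [omitPoint, descRun_self, one_mul, H.shift_regular]

theorem shift_mul_omitPoint_last : s * omitPoint n s y n = s := by
  rw [omitPoint, descRun_self, mul_one, ← mul_assoc, H.shift_regular]

/-- The last factor of the product, the shift if `q = n` and `y_q` otherwise, absorbs the whole
product on its right. -/
theorem omitPoint_idem {q : ℕ} (hq : q ≤ n) :
    omitPoint n s y q * omitPoint n s y q = omitPoint n s y q := by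
  rcases Nat.eq_or_lt_of_le hq with rfl | h
  · conv_lhs => lhs; rw [omitPoint, descRun_self, mul_one]
    rw [mul_assoc, H.shift_mul_omitPoint_last, omitPoint, descRun_self, mul_one]
  · conv_lhs => lhs; rw [omitPoint, descRun_eq_mul_last y h]
    rw [mul_assoc, mul_assoc (descRun y (q + 1) n), H.move_mul_omitPoint h,
      ← descRun_eq_mul_last y h, omitPoint]

theorem shift_mul_descRun {p : ℕ} (hp : p < n) :
    s * descRun y 0 p = descRun y 1 (p + 1) * s := by
  induction p with
  | zero => simp
  | succ p ih =>
    rw [descRun_succ y (Nat.zero_le p), descRun_succ y (show 1 ≤ p + 1 by omega), mul_assoc,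
      ← ih (by omega), ← mul_assoc, ← mul_assoc, H.move_shift p hp]

theorem descRun_mul_shift {p : ℕ} (hp : p < n) :
    descRun y (p + 1) n * s = s * descRun y p (n - 1) := by
  obtain ⟨l, rfl⟩ : ∃ l, n = l + 1 := ⟨n - 1, by omega⟩
  have aux : ∀ j, p ≤ j → j ≤ l → descRun y (p + 1) (j + 1) * s = s * descRun y p j := by
    intro j hj
    induction j, hj using Nat.le_induction with
    | base => simp
    | succ j hj ih =>
      intro hjl
      rw [descRun_succ y hj, descRun_succ y (show p + 1 ≤ j + 1 by omega), mul_assoc,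
        ih (by omega), ← mul_assoc, ← mul_assoc, H.move_shift j (by omega)]
  exact aux l (by omega) le_rfl

/-- `s²` between the two runs that make up the square of the inverse of a move. -/
theorem moveInv_sq {p : ℕ} (hp : p < n) :
    moveInv n s y p * moveInv n s y p =
      descRun y 0 p * descRun y 1 (p + 1) * (s * s) *
        (descRun y p (n - 1) * descRun y (p + 1) n) := by
  have c1 : Commute (descRun y (p + 1) n) (descRun y 0 p) :=
    (commute_descRun fun q _ h2 => Commute.symm <| commute_descRun fun r h3 h4 =>
      H.far q r (by omega) h4)
  have down := H.shift_mul_descRun (show p < n from hp)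
  have up' := H.descRun_mul_shift (show p < n from hp)
  calc moveInv n s y p * moveInv n s y p
      = descRun y 0 p * s * (descRun y (p + 1) n * descRun y 0 p) * s * descRun y (p + 1) n := by
        simp only [moveInv, mul_assoc]
    _ = descRun y 0 p * (s * descRun y 0 p) * (descRun y (p + 1) n * s) *
          descRun y (p + 1) n := by
        rw [c1.eq]; simp only [mul_assoc]
    _ = _ := by rw [down, up']; simp only [mul_assoc]

/-- Each factor of the right run crosses the left run with its index lowered by one. Read from right
to left, this brings `y_{n-1}` to the front, where it meets `s²`. -/
theorem descRun_mul_descRun_right {p : ℕ} (hp : p < n) :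
    descRun y p n * descRun y (p + 1) n = descRun y p (n - 1) * descRun y p n := by
  have aux : ∀ j, p ≤ j → j + 1 ≤ n →
      descRun y p n * descRun y (p + 1) (j + 1) = descRun y p j * descRun y p n := by
    intro j hj
    induction j, hj using Nat.le_induction with
    | base => simp
    | succ j hj ih =>
      intro hjn
      rw [descRun_succ y (show p + 1 ≤ j + 1 by omega), descRun_succ y hj, ← mul_assoc,
        H.isBraided.descRun_mul hj (by omega) le_rfl, mul_assoc, ih (by omega), mul_assoc]
  have := aux (n - 1) (by omega) (by omega)
  rwa [Nat.sub_add_cancel (by omega)] at this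

/-- By `moveInv_sq` the square is `s²` between pairs of runs. The factor `y_p` lengthens the last
run, and the exchange of runs turns it into a factor `y_{n-1}` next to `s²`, which absorbs it. -/
theorem moveInv_sq_mul_move {p : ℕ} (hp : p < n) :
    moveInv n s y p * moveInv n s y p * y p = moveInv n s y p * moveInv n s y p := by
  rw [H.moveInv_sq hp]
  calc _ = descRun y 0 p * descRun y 1 (p + 1) * (s * s) *
        (descRun y p (n - 1) * (descRun y (p + 1) n * y p)) := by simp only [mul_assoc]
    _ = descRun y 0 p * descRun y 1 (p + 1) * ((s * s * y (n - 1)) * descRun y p (n - 1)) *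
        descRun y (p + 1) n := by
      rw [← descRun_eq_mul_last y hp, ← H.descRun_mul_descRun_right hp]
      conv_lhs => rw [show n = n - 1 + 1 by omega, descRun_succ y (show p ≤ n - 1 by omega)]
      rw [Nat.sub_add_cancel (by omega)]
      simp only [mul_assoc]
    _ = _ := by rw [H.sq_mul]; simp only [mul_assoc]

/-- Using `sq_regular` twice puts the square of the inverse in front of `y_p²`, and that square then
absorbs both factors `y_p`. On the chain, both sides are the partial identity that omits `p` and `p
+ 1`. -/
theorem move_sq {p : ℕ} (hp : p < n) : y p * y p = moveInv n s y p * moveInv n s y p := by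
  have h : moveInv n s y p * (y p * y p) = y p * y p := H.sq_regular p hp
  calc y p * y p = moveInv n s y p * (moveInv n s y p * (y p * y p)) := by rw [h, h]
    _ = (moveInv n s y p * moveInv n s y p * y p) * y p := by simp only [mul_assoc]
    _ = _ := by rw [H.moveInv_sq_mul_move hp, H.moveInv_sq_mul_move hp]

theorem omitPoint_mul_move_eq_sq {p : ℕ} (hp : p < n) : omitPoint n s y p * y p = y p * y p := by
  rw [← moveInv_mul_move hp, mul_assoc]
  exact H.sq_regular p hp

/-- With `w = moveInv n s y p` and `y_p² = w²`, the left side is `y_p² w = w³ = w y_p² = y_p²`. -/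
theorem move_mul_omitPoint_succ_eq_sq {p : ℕ} (hp : p < n) :
    y p * omitPoint n s y (p + 1) = y p * y p := by
  rw [← move_mul_moveInv, ← mul_assoc, H.move_sq hp]
  conv_rhs => rw [← H.move_sq hp, ← H.sq_regular p hp]
  rw [H.move_sq hp, moveInv, mul_assoc]

theorem omitPoint_mul_omitPoint_succ {p : ℕ} (hp : p < n) :
    omitPoint n s y p * omitPoint n s y (p + 1) = y p * y p := by
  conv_lhs => rw [← move_mul_moveInv]
  rw [← mul_assoc, H.omitPoint_mul_move_eq_sq hp, mul_assoc, move_mul_moveInv,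
    H.move_mul_omitPoint_succ_eq_sq hp]

/-- The move crosses the three factors of `omitPoint`: one run changes its index by one, the shift
changes it back or in advance, and the other run commutes with it. -/
theorem commute_omitPoint_move {p q : ℕ} (hp : p < n) (hq : q ≤ n) (h1 : q ≠ p)
    (h2 : q ≠ p + 1) : Commute (omitPoint n s y q) (y p) := by
  change omitPoint n s y q * y p = y p * omitPoint n s y q
  rcases lt_or_gt_of_ne h1 with h | h
  · obtain ⟨r, rfl⟩ : ∃ r, p = r + 1 := ⟨p - 1, by omega⟩
    have c : Commute (y (r + 1)) (descRun y 0 q) :=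
      commute_descRun fun t _ h4 => (H.far t (r + 1) (by omega) hp).symm
    calc omitPoint n s y q * y (r + 1)
        = descRun y 0 q * s * (descRun y q n * y (r + 1)) := by simp only [omitPoint, mul_assoc]
      _ = descRun y 0 q * (s * y r) * descRun y q n := by
        rw [H.isBraided.descRun_mul (by omega) hp le_rfl]; simp only [mul_assoc]
      _ = (descRun y 0 q * y (r + 1)) * s * descRun y q n := by
        rw [← H.move_shift r hp]; simp only [mul_assoc]
      _ = _ := by rw [← c.eq, omitPoint]; simp only [mul_assoc]
  · have c : Commute (y p) (descRun y q n) :=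
      commute_descRun fun t h3 h4 => H.far p t (by omega) h4
    calc omitPoint n s y q * y p
        = descRun y 0 q * s * (descRun y q n * y p) := by simp only [omitPoint, mul_assoc]
      _ = descRun y 0 q * (s * y p) * descRun y q n := by
        rw [← c.eq]; simp only [mul_assoc]
      _ = (descRun y 0 q * y (p + 1)) * s * descRun y q n := by
        rw [← H.move_shift p (by omega)]; simp only [mul_assoc]
      _ = _ := by
        rw [H.isBraided.descRun_mul (Nat.zero_le p) (by omega) hq, omitPoint]
        simp only [mul_assoc]

/-- Moving `s` to the middle creates `s²`, which absorbs `y_{n-1}` on its right and `y_0` on its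
left. Trading one for the other shifts the omitted point by one. -/
theorem shift_mul_omitPoint {q : ℕ} (hq : q < n) :
    s * omitPoint n s y q = omitPoint n s y (q + 1) * s := by
  have down := H.shift_mul_descRun (show q < n from hq)
  have up' := H.descRun_mul_shift (show q < n from hq)
  have split : descRun y q n = y (n - 1) * descRun y q (n - 1) := by
    conv_lhs => rw [show n = n - 1 + 1 by omega, descRun_succ y (show q ≤ n - 1 by omega)]
  calc s * omitPoint n s y q = (s * descRun y 0 q) * s * descRun y q n := by
        simp only [omitPoint, mul_assoc]
    _ = descRun y 1 (q + 1) * ((s * s * y (n - 1)) * descRun y q (n - 1)) := by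
        rw [down, split]; simp only [mul_assoc]
    _ = descRun y 1 (q + 1) * ((y 0 * (s * s)) * descRun y q (n - 1)) := by
        rw [H.sq_mul, H.mul_sq]
    _ = (descRun y 1 (q + 1) * y 0) * s * (s * descRun y q (n - 1)) := by
        simp only [mul_assoc]
    _ = _ := by
        rw [← up', ← descRun_eq_mul_last y (Nat.succ_pos q), omitPoint]; simp only [mul_assoc]

/-- For `p < q = r + 1`, write `e_q` for `omitPoint n s y q`. Inside the upper run of `e_p` the
factor `e_{r+1}` turns into `e_r` at `y_r`, because `y_r e_{r+1} = y_r² = e_r y_r`. The shift turns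
it back into `e_{r+1}`, which commutes with the lower run. -/
theorem commute_omitPoint {p q : ℕ} (hp : p ≤ n) (hq : q ≤ n) :
    Commute (omitPoint n s y p) (omitPoint n s y q) := by
  wlog h : p < q generalizing p q
  · rcases Nat.eq_or_lt_of_le (not_lt.1 h) with rfl | h'
    · exact Commute.refl _
    · exact (this hq hp h').symm
  obtain ⟨r, rfl⟩ : ∃ r, q = r + 1 := ⟨q - 1, by omega⟩
  have c1 : ∀ j, j ≤ p → Commute (omitPoint n s y (r + 1)) (descRun y 0 j) := fun j hj =>
    commute_descRun fun t _ ht => H.commute_omitPoint_move (by omega) hq (by omega) (by omega)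
  have c2 : Commute (omitPoint n s y (r + 1)) (descRun y p r) :=
    commute_descRun fun t _ ht => H.commute_omitPoint_move (by omega) hq (by omega) (by omega)
  have c3 : Commute (omitPoint n s y r) (descRun y (r + 1) n) :=
    commute_descRun fun t _ ht => H.commute_omitPoint_move (by omega) (by omega) (by omega)
      (by omega)
  have pass : descRun y p n * omitPoint n s y (r + 1) = omitPoint n s y r * descRun y p n := by
    rw [descRun_split y (show p ≤ r + 1 by omega) hq, descRun_succ y (show p ≤ r by omega),
      mul_assoc, mul_assoc, ← c2.eq, ← mul_assoc (y r), H.move_mul_omitPoint_succ_eq_sq hq,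
      ← H.omitPoint_mul_move_eq_sq hq, ← mul_assoc, ← mul_assoc, ← mul_assoc, ← c3.eq]
    simp only [mul_assoc]
  change _ * _ = _ * _
  calc omitPoint n s y p * omitPoint n s y (r + 1)
      = descRun y 0 p * s * (descRun y p n * omitPoint n s y (r + 1)) := by
        conv_lhs => rw [omitPoint]
        simp only [mul_assoc]
    _ = descRun y 0 p * (s * omitPoint n s y r) * descRun y p n := by
        rw [pass]; simp only [mul_assoc]
    _ = (descRun y 0 p * omitPoint n s y (r + 1)) * s * descRun y p n := by
        rw [H.shift_mul_omitPoint hq]; simp only [mul_assoc]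
    _ = _ := by
        rw [← (c1 p le_rfl).eq]
        conv_rhs => rw [omitPoint.eq_1 n s y p]
        simp only [mul_assoc]

end IsShiftMoveSystem

/-! ### Moving single points of finite sets -/

section MoveSets

/-- The set `A` after the point `p ∈ A` has been moved to `p + 1`. -/
def moveUp (p : ℕ) (A : Finset ℕ) : Finset ℕ := insert (p + 1) (A.erase p)

/-- The set `A` after the point `p + 1 ∈ A` has been moved to `p`. -/
def moveDown (p : ℕ) (A : Finset ℕ) : Finset ℕ := insert p (A.erase (p + 1))

theorem mem_moveUp {p a : ℕ} {A : Finset ℕ} : a ∈ moveUp p A ↔ a = p + 1 ∨ a ≠ p ∧ a ∈ A := by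
  simp [moveUp]

theorem mem_moveDown {p a : ℕ} {A : Finset ℕ} :
    a ∈ moveDown p A ↔ a = p ∨ a ≠ p + 1 ∧ a ∈ A := by
  simp [moveDown]

theorem moveDown_moveUp {p : ℕ} {A : Finset ℕ} (h : p ∈ A) (h' : p + 1 ∉ A) :
    moveDown p (moveUp p A) = A := by
  ext a; simp only [mem_moveUp, mem_moveDown]; grind

theorem moveUp_moveDown {p : ℕ} {A : Finset ℕ} (h : p + 1 ∈ A) (h' : p ∉ A) :
    moveUp p (moveDown p A) = A := by
  ext a; simp only [mem_moveUp, mem_moveDown]; grind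

/-- The sum of the elements is the measure for the inductions on `Reach`. -/
theorem sum_moveDown {p : ℕ} {A : Finset ℕ} (h : p + 1 ∈ A) (h' : p ∉ A) :
    (moveDown p A).sum id + 1 = A.sum id := by
  rw [moveDown, Finset.sum_insert (by simp [h']), ← Finset.add_sum_erase A id h]
  simp only [id]
  omega

/-- A finite set of naturals that is closed under predecessors is an initial segment. -/
theorem exists_moveDown {A : Finset ℕ} (hA : A ≠ Finset.range A.card) :
    ∃ p, p + 1 ∈ A ∧ p ∉ A := by
  by_contra! hc
  have down : ∀ d a, a + d ∈ A → a ∈ A := by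
    intro d
    induction d with
    | zero => exact fun a h => h
    | succ d ih => exact fun a h => ih a (hc _ h)
  apply hA
  have sub : ∀ a ∈ A, Finset.range (a + 1) ⊆ A := fun a ha b hb => by
    have hb' := Finset.mem_range.1 hb
    exact down (a - b) b (by rwa [Nat.add_sub_cancel' (by omega)])
  refine Finset.eq_of_subset_of_card_le (fun a ha => ?_) (by simp)
  have := Finset.card_le_card (sub a ha)
  rw [Finset.card_range] at this
  exact Finset.mem_range.2 this

end MoveSets

/-! ### Canonical products that send an initial segment onto a given set -/

variable {M : Type*} [Monoid M]

/-- `Reach n s y A v`: the product `v`, which starts with the partial identity with domain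
`{0, …, r - 1}` and continues with moves, sends `{0, …, r - 1}` onto `A`. -/
inductive Reach (n : ℕ) (s : M) (y : ℕ → M) : Finset ℕ → M → Prop
  | base (r : ℕ) (hr : r ≤ n + 1) :
      Reach n s y (Finset.range r) (descRun (omitPoint n s y) r (n + 1))
  | step (A : Finset ℕ) (v : M) (p : ℕ) (hp : p < n) (h1 : p ∈ A) (h2 : p + 1 ∉ A)
      (h : Reach n s y A v) : Reach n s y (moveUp p A) (v * y p)

namespace Reach

variable {n : ℕ} {s : M} {y : ℕ → M} (H : IsShiftMoveSystem n s y) {A : Finset ℕ} {v : M}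

theorem subset_range (h : Reach n s y A v) : A ⊆ Finset.range (n + 1) := by
  induction h with
  | base r hr => simpa using hr
  | step A v p hp h1 h2 h ih =>
    intro a ha
    rcases mem_moveUp.1 ha with rfl | ⟨_, ha⟩
    · simpa using hp
    · exact ih ha

theorem eq_base_or_step (h : Reach n s y A v) :
    (∃ r, A = Finset.range r ∧ v = descRun (omitPoint n s y) r (n + 1)) ∨
      ∃ p w, p < n ∧ p + 1 ∈ A ∧ p ∉ A ∧ Reach n s y (moveDown p A) w ∧ v = w * y p := by
  cases h with
  | base r hr => exact Or.inl ⟨r, rfl, rfl⟩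
  | step A w p hp h1 h2 h =>
    refine Or.inr ⟨p, w, hp, mem_moveUp.2 (Or.inl rfl), ?_, ?_, rfl⟩
    · simp [mem_moveUp]
    · rwa [moveDown_moveUp h1 h2]

theorem of_moveDown {p : ℕ} {w : M} (h1 : p + 1 ∈ A) (h2 : p ∉ A)
    (h : Reach n s y (moveDown p A) w) (hA : A ⊆ Finset.range (n + 1)) :
    Reach n s y A (w * y p) := by
  have := Reach.step _ _ p (by simpa using hA h1) (mem_moveDown.2 (Or.inl rfl))
    (by simp [mem_moveDown]) h
  rwa [moveUp_moveDown h1 h2] at this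

theorem moveDown_subset {p : ℕ} (h1 : p + 1 ∈ A) (hA : A ⊆ Finset.range (n + 1)) :
    moveDown p A ⊆ Finset.range (n + 1) := by
  intro a ha
  have := Finset.mem_range.1 (hA h1)
  rcases mem_moveDown.1 ha with rfl | ⟨_, ha⟩
  · exact Finset.mem_range.2 (by omega)
  · exact hA ha

theorem exists_of_subset (s : M) (y : ℕ → M) (hA : A ⊆ Finset.range (n + 1)) :
    ∃ v, Reach n s y A v := by
  induction hN : A.sum id using Nat.strong_induction_on generalizing A with
  | _ N ih =>
    by_cases hr : A = Finset.range A.card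
    · rw [hr]
      exact ⟨_, base _ (by simpa using Finset.card_le_card hA)⟩
    · obtain ⟨p, h1, h2⟩ := exists_moveDown hr
      have hs := sum_moveDown h1 h2
      obtain ⟨w, hw⟩ := ih _ (by omega) (moveDown_subset h1 hA) rfl
      exact ⟨_, of_moveDown h1 h2 hw hA⟩

include H

/-- Confluence, by induction on the sum of `A`. Two different last moves `p` and `q` are not
adjacent, since `p + 1` and `q + 1` lie in `A` but `p` and `q` do not. Hence `y_p` and `y_q`
commute, and undoing both moves gives a common predecessor. -/
theorem unique {v' : M} (h : Reach n s y A v) (h' : Reach n s y A v') : v = v' := by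
  induction hN : A.sum id using Nat.strong_induction_on generalizing A v v' with
  | _ N ih =>
    have hA := h.subset_range
    rcases h.eq_base_or_step with ⟨r, rfl, rfl⟩ | ⟨p, w, hp, h1, h2, hw, rfl⟩
    · rcases h'.eq_base_or_step with ⟨r', hr, rfl⟩ | ⟨q, w', hq, h1', h2', hw', rfl⟩
      · rw [show r = r' by simpa using congrArg Finset.card hr]
      · simp only [Finset.mem_range] at h1' h2'
        omega
    · rcases h'.eq_base_or_step with ⟨r', rfl, rfl⟩ | ⟨q, w', hq, h1', h2', hw', rfl⟩
      · simp only [Finset.mem_range] at h1 h2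
        omega
      have hs := sum_moveDown h1 h2
      have hs' := sum_moveDown h1' h2'
      by_cases hpq : p = q
      · subst hpq
        rw [ih _ (by omega) hw hw' rfl]
      have hne1 : p + 1 ≠ q := by rintro rfl; exact h2' h1
      have hne2 : q + 1 ≠ p := by rintro rfl; exact h2 h1'
      have hcomm : Commute (y p) (y q) := by
        rcases lt_or_gt_of_ne hpq with h | h
        · exact H.far p q (by omega) hq
        · exact (H.far q p (by omega) hp).symm
      have e : moveDown q (moveDown p A) = moveDown p (moveDown q A) := by
        ext a; simp only [mem_moveDown]; grind
      have m1 : q + 1 ∈ moveDown p A := mem_moveDown.2 (Or.inr ⟨by omega, h1'⟩)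
      have m2 : q ∉ moveDown p A := by simp only [mem_moveDown]; grind
      have m3 : p + 1 ∈ moveDown q A := mem_moveDown.2 (Or.inr ⟨by omega, h1⟩)
      have m4 : p ∉ moveDown q A := by simp only [mem_moveDown]; grind
      obtain ⟨u, hu⟩ := exists_of_subset s y (moveDown_subset m1 (moveDown_subset h1 hA))
      have e1 := ih _ (by omega) hw (of_moveDown m1 m2 hu (moveDown_subset h1 hA)) rfl
      rw [e] at hu
      have e2 := ih _ (by omega) hw' (of_moveDown m3 m4 hu (moveDown_subset h1' hA)) rfl
      rw [e1, e2, mul_assoc, mul_assoc, hcomm.eq]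

theorem mul_omitPoint (h : Reach n s y A v) {q : ℕ} (hq : q ≤ n) (hqA : q ∉ A) :
    v * omitPoint n s y q = v := by
  induction h with
  | base r hr =>
    have hqr : r ≤ q := by simpa using hqA
    have c : Commute (omitPoint n s y q) (descRun (omitPoint n s y) r q) :=
      commute_descRun fun t _ ht => H.commute_omitPoint hq (by omega)
    rw [descRun_split _ (show r ≤ q + 1 by omega) (show q + 1 ≤ n + 1 by omega),
      descRun_succ _ hqr, mul_assoc, mul_assoc, ← c.eq, ← mul_assoc (omitPoint n s y q),
      H.omitPoint_idem hq]
  | step A v p hp h1 h2 h ih =>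
    rw [mem_moveUp] at hqA
    by_cases hqp : q = p
    · subst hqp
      rw [mul_assoc, H.move_mul_omitPoint hp]
    · rw [mul_assoc, ← (H.commute_omitPoint_move hp hq hqp (by omega)).eq, ← mul_assoc,
        ih (by grind)]

/-- With `e_p` for `omitPoint n s y p`, the product `v` absorbs `e_p` and `e_{p+1}`, while `e_p y_p
= y_p² = e_p e_{p+1}`. -/
theorem mul_move_of_notMem (h : Reach n s y A v) {p : ℕ} (hp : p < n) (h1 : p ∉ A)
    (h2 : p + 1 ∉ A) : v * y p = v := by
  calc v * y p = v * omitPoint n s y p * y p := by rw [h.mul_omitPoint H hp.le h1]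
    _ = v * omitPoint n s y p * omitPoint n s y (p + 1) := by
      rw [mul_assoc, mul_assoc, H.omitPoint_mul_omitPoint_succ hp, H.omitPoint_mul_move_eq_sq hp]
    _ = v := by rw [h.mul_omitPoint H hp.le h1, h.mul_omitPoint H hp h2]

theorem mul_moveInv_of_notMem (h : Reach n s y A v) {p : ℕ} (hp : p < n) (h1 : p ∉ A)
    (h2 : p + 1 ∉ A) : v * moveInv n s y p = v := by
  conv_lhs => rw [← h.mul_move_of_notMem H hp h1 h2]
  rw [mul_assoc, IsShiftMoveSystem.move_mul_moveInv, h.mul_omitPoint H hp h2]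

/-- By uniqueness the last factor of `v` may be taken to be `y_p`, and the inverse then cancels it
up to an absorbed partial identity. -/
theorem mul_moveInv (h : Reach n s y A v) {p : ℕ} (h1 : p + 1 ∈ A) (h2 : p ∉ A) :
    Reach n s y (moveDown p A) (v * moveInv n s y p) := by
  have hA := h.subset_range
  have hp : p < n := by simpa using hA h1
  obtain ⟨w, hw⟩ := exists_of_subset s y (moveDown_subset h1 hA)
  rw [h.unique H (of_moveDown h1 h2 hw hA), mul_assoc, IsShiftMoveSystem.move_mul_moveInv,
    hw.mul_omitPoint H hp (by simp [mem_moveDown])]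
  exact hw

/-- The shift is resolved into inverse moves. As `0 ∉ A`, the product `v * (s * descRun y 0 n)` is
`v`, and passing from `descRun y j n` to `descRun y (j + 1) n` amounts to a factor `moveInv n s y
j`. At stage `j` exactly the points up to `j` have been lowered. -/
theorem mul_shift (h : Reach n s y A v) (h0 : 0 ∉ A) :
    Reach n s y (A.image fun a => a - 1) (v * s) := by
  have hA := h.subset_range
  have aux : ∀ j, j ≤ n → Reach n s y (A.image fun a => if a ≤ j then a - 1 else a)
      (v * (s * descRun y j n)) := by
    intro j
    induction j with
    | zero =>
      intro _
      have e : (A.image fun a => if a ≤ 0 then a - 1 else a) = A := by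
        conv_rhs => rw [← Finset.image_id (s := A)]
        apply Finset.image_congr
        intro a _
        by_cases ha : a ≤ 0 <;> simp [ha]
        omega
      have := h.mul_omitPoint H (Nat.zero_le n) h0
      rw [omitPoint, descRun_self, one_mul] at this
      rwa [this, e]
    | succ j ih =>
      intro hj
      have hR := ih (by omega)
      have hnot : j ∉ A.image fun a => if a ≤ j then a - 1 else a := by
        simp only [Finset.mem_image, not_exists, not_and]
        intro a ha hc
        have : a ≠ 0 := by rintro rfl; exact h0 ha
        split_ifs at hc <;> omega
      have e : v * (s * descRun y (j + 1) n) =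
          v * (s * descRun y j n) * moveInv n s y j := by
        conv_lhs => rw [← H.shift_regular, descRun_split y (Nat.zero_le j) (show j ≤ n by omega)]
        simp only [moveInv, mul_assoc]
      rw [e]
      by_cases hj1 : j + 1 ∈ A
      · have hmem : j + 1 ∈ A.image fun a => if a ≤ j then a - 1 else a :=
          Finset.mem_image.2 ⟨j + 1, hj1, by simp⟩
        convert hR.mul_moveInv H hmem hnot using 1
        ext b
        simp only [mem_moveDown, Finset.mem_image]
        constructor
        · rintro ⟨a, ha, rfl⟩
          by_cases haj : a = j + 1
          · subst haj; simp
          · refine Or.inr ⟨?_, a, ha, ?_⟩ <;> split_ifs <;> omega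
        · rintro (rfl | ⟨hb, a, ha, rfl⟩)
          · exact ⟨b + 1, hj1, by simp⟩
          · refine ⟨a, ha, ?_⟩
            split_ifs at hb ⊢ <;> omega
      · have hmem : j + 1 ∉ A.image fun a => if a ≤ j then a - 1 else a := by
          simp only [Finset.mem_image, not_exists, not_and]
          intro a ha hc
          have : a ≠ j + 1 := by rintro rfl; exact hj1 ha
          split_ifs at hc <;> omega
        rw [hR.mul_moveInv_of_notMem H hj hnot hmem]
        convert hR using 1
        apply Finset.image_congr
        intro a ha
        have : a ≠ j + 1 := by rintro rfl; exact hj1 ha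
        simp only
        split_ifs <;> omega
  have hn := aux n le_rfl
  rw [descRun_self, mul_one] at hn
  convert hn using 1
  apply Finset.image_congr
  intro a ha
  have := Finset.mem_range.1 (hA ha)
  simp only
  rw [if_pos (by omega)]

/-- Left cancellation of products of moves. -/
theorem cancel (h : Reach n s y A v) {u u' : M}
    (hu : ∀ q ≤ n, q ∉ A → omitPoint n s y q * u = u)
    (hu' : ∀ q ≤ n, q ∉ A → omitPoint n s y q * u' = u') (e : v * u = v * u') : u = u' := by
  induction h generalizing u u' with
  | base r hr =>
    -- Here `v` is a product of partial identities that omit points outside `A`, each of which `w`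
    -- absorbs.
    have aux : ∀ w : M, (∀ q ≤ n, q ∉ Finset.range r → omitPoint n s y q * w = w) →
        ∀ j, r ≤ j → j ≤ n + 1 → descRun (omitPoint n s y) r j * w = w := by
      intro w hw j hj
      induction j, hj using Nat.le_induction with
      | base => simp
      | succ j hj ih =>
        intro hjn
        rw [descRun_succ _ hj, mul_assoc, ih (by omega), hw j (by omega) (by simpa using hj)]
    rwa [aux u hu _ hr le_rfl, aux u' hu' _ hr le_rfl] at e
  | step A v p hp h1 h2 h ih =>
    -- The element `y_p w` satisfies the absorption hypothesis for `A`, so the induction cancels `v`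
    -- and leaves `y_p u = y_p u'`. Multiplying by the inverse move gives the partial identity
    -- omitting `p`, which is absorbed because `p ∉ moveUp p A`.
    have aux : ∀ w : M, (∀ q ≤ n, q ∉ moveUp p A → omitPoint n s y q * w = w) →
        ∀ q ≤ n, q ∉ A → omitPoint n s y q * (y p * w) = y p * w := by
      intro w hw q hq hqA
      by_cases hqp : q = p + 1
      · subst hqp
        rw [← mul_assoc, H.omitPoint_succ_mul_move hp]
      · have hne : q ≠ p := by rintro rfl; exact hqA h1
        rw [← mul_assoc, (H.commute_omitPoint_move hp hq hne hqp).eq, mul_assoc,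
          hw q hq (by simp [mem_moveUp, hqp, hqA])]
    have key := ih (aux u hu) (aux u' hu') (by simpa only [mul_assoc] using e)
    have hp' : p ∉ moveUp p A := by simp [mem_moveUp]
    rw [← hu p hp.le hp', ← hu' p hp.le hp', ← IsShiftMoveSystem.moveInv_mul_move hp, mul_assoc,
      mul_assoc, key]

end Reach

/-! ### The generators of the index chain as relations between points -/

section Maps

variable {Ω : Type*}

theorem partialPerm_ext {α β : PartialPerm Ω} (h : ∀ x y, Maps α x y ↔ Maps β x y) : α = β :=
  PEquiv.ext fun x => Option.ext fun y => h x y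

theorem Maps.right_unique {α : PartialPerm Ω} {x y y' : Ω} (h : Maps α x y) (h' : Maps α x y') :
    y = y' := Option.mem_unique h h'

theorem Maps.left_unique {α : PartialPerm Ω} {x x' y : Ω} (h : Maps α x y) (h' : Maps α x' y) :
    x = x' := PEquiv.inj α h h'

theorem maps_toPEquiv {σ : Equiv.Perm Ω} {x y : Ω} : Maps σ.toPEquiv x y ↔ σ x = y := by
  change some (σ x) = some y ↔ _
  exact Option.some_inj

theorem maps_ofSet_trans {S : Set Ω} [DecidablePred (· ∈ S)] {σ : Equiv.Perm Ω} {x y : Ω} :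
    Maps ((PEquiv.ofSet S).trans σ.toPEquiv) x y ↔ x ∈ S ∧ σ x = y := by
  refine (PEquiv.mem_trans _ _ _ _).trans ⟨?_, fun h => ⟨x, ?_, maps_toPEquiv.2 h.2⟩⟩
  · rintro ⟨z, h1, h2⟩
    obtain ⟨rfl, h3⟩ := PEquiv.mem_ofSet_iff.1 h1
    exact ⟨h3, maps_toPEquiv.1 h2⟩
  · exact PEquiv.mem_ofSet_iff.2 ⟨rfl, h.1⟩

theorem finRotate_val {k : ℕ} (p : Fin k) :
    (finRotate k p : ℕ) = if (p : ℕ) + 1 = k then 0 else (p : ℕ) + 1 := by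
  split_ifs with h
  · exact congrArg Fin.val (cycB_last h)
  · exact congrArg Fin.val (cycB_of_lt (x := p) (by omega))

theorem maps_xSmall_zero {k : ℕ} {i : Fin k} (hi : (i : ℕ) = 0) {p q : Fin k} :
    Maps (xSmall k i) p q ↔ (p : ℕ) = q + 1 := by
  rw [xSmall, if_pos hi, maps_ofSet_trans, Set.mem_ofPred_eq]
  simp only [Equiv.symm_apply_eq, ne_eq, Fin.ext_iff, finRotate_val,
    Fin.val_rev, hi]
  constructor
  · rintro ⟨h4, h5⟩
    split_ifs at h4 h5 <;> omega
  · intro h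
    refine ⟨?_, ?_⟩ <;> split_ifs <;> omega

/-- With points counted from `0`, the point that `x_i` moves is `j = k - i - 1`; the hypothesis is
written additively to avoid truncated subtraction. -/
theorem maps_xSmall_pos {k : ℕ} {i : Fin k} {j : ℕ} (hj : (i : ℕ) + j + 1 = k)
    (hi : (i : ℕ) ≠ 0) {p q : Fin k} :
    Maps (xSmall k i) p q ↔
      ((p : ℕ) = j ∧ (q : ℕ) = j + 1) ∨ ((p : ℕ) ≠ j ∧ (p : ℕ) ≠ j + 1 ∧ q = p) := by
  have hv : (Fin.rev i : ℕ) = j := by rw [Fin.val_rev]; omega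
  have hw : (finRotate k (Fin.rev i) : ℕ) = j + 1 := by
    rw [finRotate_val, hv, if_neg (by omega)]
  rw [xSmall, if_neg hi, maps_ofSet_trans, Set.mem_ofPred_eq]
  constructor
  · rintro ⟨h4, h5⟩
    by_cases hp : p = Fin.rev i
    · subst hp
      rw [Equiv.swap_apply_left] at h5
      subst h5
      exact Or.inl ⟨hv, hw⟩
    · rw [Equiv.swap_apply_of_ne_of_ne hp h4] at h5
      rw [Fin.ext_iff] at hp
      rw [ne_eq, Fin.ext_iff] at h4
      exact Or.inr ⟨by omega, by omega, h5.symm⟩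
  · rintro (⟨h3, h4⟩ | ⟨h3, h4, rfl⟩)
    · have hp : p = Fin.rev i := Fin.ext (by omega)
      have hq : q = finRotate k (Fin.rev i) := Fin.ext (by omega)
      refine ⟨?_, by rw [hp, hq, Equiv.swap_apply_left]⟩
      rw [ne_eq, Fin.ext_iff]; omega
    · refine ⟨?_, ?_⟩
      · rw [ne_eq, Fin.ext_iff]; omega
      · apply Equiv.swap_apply_of_ne_of_ne <;> rw [ne_eq, Fin.ext_iff] <;> omega

end Maps

/-! ### Passing elements attached to points through a partial permutation -/

section Intertwines

variable {M : Type*} [Monoid M] {Ω : Type*}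

/-- The element `u` passes elements `f p` attached to the points in the same way as the partial
permutation `θ`: an element attached to a point outside the domain or the image is absorbed. -/
structure Intertwines (f : Ω → M) (u : M) (θ : PartialPerm Ω) : Prop where
  maps : ∀ p q, Maps θ p q → f p * u = u * f q
  not_dom : ∀ p, (∀ q, ¬ Maps θ p q) → f p * u = u
  not_im : ∀ q, (∀ p, ¬ Maps θ p q) → u * f q = u

theorem Intertwines.one (f : Ω → M) : Intertwines f 1 (1 : PartialPerm Ω) where
  maps p q h := by rw [maps_one.1 h, mul_one, one_mul]
  not_dom p h := absurd (maps_one.2 rfl) (h p)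
  not_im q h := absurd (maps_one.2 rfl) (h q)

theorem Intertwines.mul {f : Ω → M} {u v : M} {θ χ : PartialPerm Ω} (hu : Intertwines f u θ)
    (hv : Intertwines f v χ) : Intertwines f (u * v) (θ * χ) where
  maps p q h := by
    obtain ⟨r, h1, h2⟩ := maps_mul.1 h
    rw [← mul_assoc, hu.maps p r h1, mul_assoc, hv.maps r q h2, mul_assoc]
  not_dom p h := by
    by_cases hp : ∃ r, Maps θ p r
    · obtain ⟨r, hr⟩ := hp
      rw [← mul_assoc, hu.maps p r hr, mul_assoc,
        hv.not_dom r fun q hq => h q (maps_mul.2 ⟨r, hr, hq⟩)]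
    · push Not at hp
      rw [← mul_assoc, hu.not_dom p hp]
  not_im q h := by
    by_cases hq : ∃ r, Maps χ r q
    · obtain ⟨r, hr⟩ := hq
      rw [mul_assoc, ← hv.maps r q hr, ← mul_assoc,
        hu.not_im r fun p hp => h p (maps_mul.2 ⟨r, hp, hr⟩)]
    · push Not at hq
      rw [mul_assoc, hv.not_im q hq]

/-- The submonoid generated by the pairs `(x_i, θ_i)`, where `θ_i` is the partial permutation of
the chain that belongs to `x_i`. -/
def pairClosure (k : ℕ) (x : ℕ → M) : Submonoid (M × PartialPerm (Fin k)) :=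
  Submonoid.closure (Set.range fun i : Fin k => (x i, xSmall k i))

theorem intertwines_of_mem_pairClosure {k : ℕ} {x : ℕ → M} {f : Fin k → M}
    (h : ∀ i : Fin k, Intertwines f (x i) (xSmall k i)) {w : M × PartialPerm (Fin k)}
    (hw : w ∈ pairClosure k x) : Intertwines f w.1 w.2 := by
  induction hw using Submonoid.closure_induction with
  | mem w hw =>
    obtain ⟨i, rfl⟩ := hw
    exact h i
  | one => exact Intertwines.one f
  | mul w w' _ _ h1 h2 => exact h1.mul h2

end Intertwines

/-! ### Products of the `x_i` are determined by the partial permutation they induce -/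

section Uniqueness

/-- The partial permutation `θ` is defined on `A` and sends it onto `B`. -/
structure SendsOnto {k : ℕ} (θ : PartialPerm (Fin k)) (A B : Finset ℕ) : Prop where
  forth : ∀ a ∈ A, ∃ b ∈ B, ∃ (ha : a < k) (hb : b < k), Maps θ ⟨a, ha⟩ ⟨b, hb⟩
  back : ∀ b ∈ B, ∃ a ∈ A, ∃ (ha : a < k) (hb : b < k), Maps θ ⟨a, ha⟩ ⟨b, hb⟩

theorem SendsOnto.of_mul {k : ℕ} {θ χ : PartialPerm (Fin k)} {A C : Finset ℕ}
    (h : SendsOnto (θ * χ) A C) : ∃ B, SendsOnto θ A B ∧ SendsOnto χ B C := by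
  classical
  refine ⟨(Finset.range k).filter fun b =>
    ∃ a ∈ A, ∃ (ha : a < k) (hb : b < k), Maps θ ⟨a, ha⟩ ⟨b, hb⟩, ⟨?_, ?_⟩, ?_, ?_⟩
  · intro a haA
    obtain ⟨c, _, ha, hc, hm⟩ := h.forth a haA
    obtain ⟨b, hb, _⟩ := maps_mul.1 hm
    refine ⟨b, Finset.mem_filter.2 ⟨Finset.mem_range.2 b.2, a, haA, ha, b.2, hb⟩, ha, b.2, hb⟩
  · intro b hb
    exact (Finset.mem_filter.1 hb).2
  · intro b hb
    obtain ⟨_, a, haA, ha, hb', hm⟩ := Finset.mem_filter.1 hb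
    obtain ⟨c, hcC, _, hc, hm'⟩ := h.forth a haA
    obtain ⟨b', h1, h2⟩ := maps_mul.1 hm'
    obtain rfl := hm.right_unique h1
    exact ⟨c, hcC, hb', hc, h2⟩
  · intro c hcC
    obtain ⟨a, haA, ha, hc, hm⟩ := h.back c hcC
    obtain ⟨b, h1, h2⟩ := maps_mul.1 hm
    exact ⟨b, Finset.mem_filter.2 ⟨Finset.mem_range.2 b.2, a, haA, ha, b.2, h1⟩, b.2, hc, h2⟩

variable {M : Type*} [Monoid M] {n : ℕ} {x : ℕ → M}
  (H : IsShiftMoveSystem n (x 0) fun p => x (n - p))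
include H

/-- Through products this shows that an element inducing `θ` absorbs the partial identities at
points outside the domain of `θ`, which is what `Reach.cancel` requires. -/
theorem intertwines_omitPoint (i : Fin (n + 1)) :
    Intertwines (fun q : Fin (n + 1) => omitPoint n (x 0) (fun p => x (n - p)) q) (x i)
      (xSmall (n + 1) i) := by
  by_cases hi : (i : ℕ) = 0
  · constructor
    · intro p q h
      rw [maps_xSmall_zero hi] at h
      simp only [hi, h]
      exact (H.shift_mul_omitPoint (by omega)).symm
    · intro p h
      have hp : (p : ℕ) = 0 := by
        by_contra hne
        exact h ⟨p - 1, by omega⟩ ((maps_xSmall_zero hi).2 (by simp; omega))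
      simp only [hi, hp]
      exact H.omitPoint_zero_mul_shift
    · intro q h
      have hq : (q : ℕ) = n := by
        by_contra hne
        exact h ⟨q + 1, by omega⟩ ((maps_xSmall_zero hi).2 rfl)
      simp only [hi, hq]
      exact H.shift_mul_omitPoint_last
  · obtain ⟨j, hj⟩ : ∃ j, (i : ℕ) + j + 1 = n + 1 := ⟨n - i, by omega⟩
    have hx : (i : ℕ) = n - j := by omega
    have hjn : j < n := by omega
    constructor
    · intro p q h
      rcases (maps_xSmall_pos hj hi).1 h with ⟨h1, h2⟩ | ⟨h1, h2, rfl⟩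
      · simp only [h1, h2, hx]
        exact (H.omitPoint_mul_move_eq_sq hjn).trans (H.move_mul_omitPoint_succ_eq_sq hjn).symm
      · simp only [hx]
        exact H.commute_omitPoint_move hjn (by omega) h1 h2
    · intro p h
      have hp : (p : ℕ) = j + 1 := by
        by_contra hne
        by_cases hpj : (p : ℕ) = j
        · exact h ⟨j + 1, by omega⟩ ((maps_xSmall_pos hj hi).2 (Or.inl ⟨hpj, rfl⟩))
        · exact h p ((maps_xSmall_pos hj hi).2 (Or.inr ⟨hpj, hne, rfl⟩))
      simp only [hp, hx]
      exact H.omitPoint_succ_mul_move hjn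
    · intro q h
      have hq : (q : ℕ) = j := by
        by_contra hne
        by_cases hpj : (q : ℕ) = j + 1
        · exact h ⟨j, by omega⟩ ((maps_xSmall_pos hj hi).2 (Or.inl ⟨rfl, hpj⟩))
        · exact h q ((maps_xSmall_pos hj hi).2 (Or.inr ⟨hne, hpj, rfl⟩))
      simp only [hq, hx]
      exact H.move_mul_omitPoint hjn

/-- Since `A` lies in the domain of the generator, `0 ∉ A` for the shift and `j + 1 ∉ A` for the
move of `j`. The move is then a step of `Reach` if `j ∈ A`, and is absorbed otherwise. -/
theorem reach_mul_generator (i : Fin (n + 1)) {A B : Finset ℕ} {v : M}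
    (hv : Reach n (x 0) (fun p => x (n - p)) A v) (hAB : SendsOnto (xSmall (n + 1) i) A B) :
    Reach n (x 0) (fun p => x (n - p)) B (v * x i) := by
  by_cases hi : (i : ℕ) = 0
  · have h0 : 0 ∉ A := by
      intro h
      obtain ⟨b, _, ha, hb, hm⟩ := hAB.forth 0 h
      rw [maps_xSmall_zero hi] at hm
      simp at hm
    convert hv.mul_shift H h0 using 1
    · ext b
      rw [Finset.mem_image]
      constructor
      · intro hb
        obtain ⟨a, ha, _, _, hm⟩ := hAB.back b hb
        rw [maps_xSmall_zero hi] at hm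
        simp only at hm
        exact ⟨a, ha, by omega⟩
      · rintro ⟨a, ha, rfl⟩
        obtain ⟨b, hb, _, _, hm⟩ := hAB.forth a ha
        rw [maps_xSmall_zero hi] at hm
        simp only at hm
        rwa [hm, Nat.add_sub_cancel]
    · rw [hi]
  · obtain ⟨j, hj⟩ : ∃ j, (i : ℕ) + j + 1 = n + 1 := ⟨n - i, by omega⟩
    have hx : (i : ℕ) = n - j := by omega
    have hjn : j < n := by omega
    have forth : ∀ a ∈ A, (a = j ∧ j + 1 ∈ B) ∨ (a ≠ j ∧ a ≠ j + 1 ∧ a ∈ B) := by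
      intro a ha
      obtain ⟨b, hb, _, _, hm⟩ := hAB.forth a ha
      rw [maps_xSmall_pos hj hi, Fin.ext_iff] at hm
      simp only at hm
      rcases hm with ⟨h1, rfl⟩ | ⟨h1, h2, rfl⟩
      · exact Or.inl ⟨h1, hb⟩
      · exact Or.inr ⟨h1, h2, hb⟩
    have back : ∀ b ∈ B, (b = j + 1 ∧ j ∈ A) ∨ (b ≠ j ∧ b ≠ j + 1 ∧ b ∈ A) := by
      intro b hb
      obtain ⟨a, ha, _, _, hm⟩ := hAB.back b hb
      rw [maps_xSmall_pos hj hi, Fin.ext_iff] at hm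
      simp only at hm
      rcases hm with ⟨rfl, h1⟩ | ⟨h1, h2, rfl⟩
      · exact Or.inl ⟨h1, ha⟩
      · exact Or.inr ⟨h1, h2, ha⟩
    have h1 : j + 1 ∉ A := fun h => by have := forth _ h; omega
    rw [hx]
    by_cases hjA : j ∈ A
    · convert Reach.step A v j hjn hjA h1 hv using 1
      ext b
      rw [mem_moveUp]
      grind
    · rw [show v * x (n - j) = v from hv.mul_move_of_notMem H hjn hjA h1]
      convert hv using 1
      ext b
      grind

theorem reach_mul {w : M × PartialPerm (Fin (n + 1))} (hw : w ∈ pairClosure (n + 1) x)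
    {A B : Finset ℕ} {v : M} (hv : Reach n (x 0) (fun p => x (n - p)) A v)
    (hAB : SendsOnto w.2 A B) : Reach n (x 0) (fun p => x (n - p)) B (v * w.1) := by
  induction hw using Submonoid.closure_induction generalizing A B v with
  | mem w hw =>
    obtain ⟨i, rfl⟩ := hw
    exact reach_mul_generator H i hv hAB
  | one =>
    have : A = B := by
      ext a
      constructor
      · intro ha
        obtain ⟨b, hb, _, _, hm⟩ := hAB.forth a ha
        have := congrArg Fin.val (maps_one.1 hm)
        simp only at this
        rwa [this]
      · intro hb
        obtain ⟨b, ha, _, _, hm⟩ := hAB.back a hb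
        have := congrArg Fin.val (maps_one.1 hm)
        simp only at this
        rwa [← this]
    subst this
    rwa [Prod.fst_one, mul_one]
  | mul w w' _ _ h1 h2 =>
    obtain ⟨C, hC, hC'⟩ := hAB.of_mul
    rw [Prod.fst_mul, ← mul_assoc]
    exact h2 (h1 hv hC) hC'

/-- Products of the `x_i` that induce the same partial permutation are equal. -/
theorem pairClosure_fst_eq {u u' : M} {θ : PartialPerm (Fin (n + 1))}
    (hu : (u, θ) ∈ pairClosure (n + 1) x) (hu' : (u', θ) ∈ pairClosure (n + 1) x) : u = u' := by
  classical
  -- `A` is the domain and `B` the image of `θ`. With `v` canonical for `A`, both `v * u` and `v *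
  -- u'` are canonical for `B`, hence equal, and `v` cancels.
  let A := (Finset.range (n + 1)).filter fun a => ∃ (ha : a < n + 1) (b : _), Maps θ ⟨a, ha⟩ b
  let B := (Finset.range (n + 1)).filter fun b => ∃ (hb : b < n + 1) (a : _), Maps θ a ⟨b, hb⟩
  have hAB : SendsOnto θ A B := by
    constructor
    · intro a haA
      obtain ⟨_, ha, b, hm⟩ := Finset.mem_filter.1 haA
      exact ⟨b, Finset.mem_filter.2 ⟨Finset.mem_range.2 b.2, b.2, _, hm⟩, ha, b.2, hm⟩
    · intro b hbB
      obtain ⟨_, hb, a, hm⟩ := Finset.mem_filter.1 hbB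
      exact ⟨a, Finset.mem_filter.2 ⟨Finset.mem_range.2 a.2, a.2, _, hm⟩, a.2, hb, hm⟩
  obtain ⟨v, hv⟩ := Reach.exists_of_subset (n := n) (x 0) (fun p => x (n - p))
    (Finset.filter_subset _ _ : A ⊆ _)
  have absorb : ∀ w : M, (w, θ) ∈ pairClosure (n + 1) x → ∀ q ≤ n, q ∉ A →
      omitPoint n (x 0) (fun p => x (n - p)) q * w = w := by
    intro w hw q hq hqA
    refine (intertwines_of_mem_pairClosure (intertwines_omitPoint H) hw).not_dom
      ⟨q, by omega⟩ fun r hr => hqA ?_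
    exact Finset.mem_filter.2 ⟨Finset.mem_range.2 (by omega), by omega, r, hr⟩
  exact hv.cancel H (absorb u hu) (absorb u' hu')
    ((reach_mul H hu hv hAB).unique H (reach_mul H hu' hv hAB))

end Uniqueness

/-! ### Intertwining conditions for single generators, with indices from 1 -/

section IntertwinesGenerators

variable {M : Type*} [Monoid M] {k : ℕ} {g : ℕ → M} {u : M}

theorem intertwines_xSmall_zero_iff {i : Fin k} (hi : (i : ℕ) = 0) :
    Intertwines (fun p : Fin k => g (p + 1)) u (xSmall k i) ↔
      g 1 * u = u ∧ u * g k = u ∧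
        ∀ j, 1 ≤ j → j ≤ k - 1 → u * g j = g (j + 1) * u := by
  have hk := i.2
  constructor
  · intro h
    refine ⟨?_, ?_, fun j h1 h2 => ?_⟩
    · exact h.not_dom ⟨0, by omega⟩ fun q hq => by
        rw [maps_xSmall_zero hi] at hq
        simp at hq
    · have := h.not_im ⟨k - 1, by omega⟩ fun q hq => by
        rw [maps_xSmall_zero hi] at hq
        simp only at hq
        omega
      simpa only [Nat.sub_add_cancel (show 1 ≤ k by omega)] using this
    · have := h.maps ⟨j, by omega⟩ ⟨j - 1, by omega⟩ (by
        rw [maps_xSmall_zero hi]; simp only; omega)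
      simpa only [Nat.sub_add_cancel h1] using this.symm
  · rintro ⟨h1, h2, h3⟩
    refine ⟨fun p q h => ?_, fun p h => ?_, fun q h => ?_⟩
    · rw [maps_xSmall_zero hi] at h
      simp only [h]
      exact (h3 _ (by omega) (by omega)).symm
    · have hp : (p : ℕ) = 0 := by
        by_contra hne
        exact h ⟨p - 1, by omega⟩ ((maps_xSmall_zero hi).2 (by simp only; omega))
      simpa only [hp] using h1
    · have hq : (q : ℕ) + 1 = k := by
        by_contra hne
        exact h ⟨q + 1, by omega⟩ ((maps_xSmall_zero hi).2 rfl)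
      simpa only [hq] using h2

theorem intertwines_xSmall_pos_iff {i : Fin k} (hi : (i : ℕ) ≠ 0) :
    Intertwines (fun p : Fin k => g (p + 1)) u (xSmall k i) ↔
      g (k - i + 1) * u = u ∧ u * g (k - i) = u ∧ u * g (k - i + 1) = g (k - i) * u ∧
        ∀ j, 1 ≤ j → j ≤ k → j ≠ k - i → j ≠ k - i + 1 → u * g j = g j * u := by
  have hk := i.2
  obtain ⟨t, ht⟩ : ∃ t, (i : ℕ) + t + 1 = k := ⟨k - 1 - i, by omega⟩
  have e : k - i = t + 1 := by omega
  rw [e]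
  constructor
  · intro h
    refine ⟨?_, ?_, ?_, fun j h1 h2 h3 h4 => ?_⟩
    · refine h.not_dom ⟨t + 1, by omega⟩ fun q hq => ?_
      rw [maps_xSmall_pos ht hi] at hq
      simp at hq
    · refine h.not_im ⟨t, by omega⟩ fun q hq => ?_
      rw [maps_xSmall_pos ht hi, Fin.ext_iff] at hq
      simp only at hq
      omega
    · exact (h.maps ⟨t, by omega⟩ ⟨t + 1, by omega⟩
        ((maps_xSmall_pos ht hi).2 (Or.inl ⟨rfl, rfl⟩))).symm
    · have := h.maps ⟨j - 1, by omega⟩ ⟨j - 1, by omega⟩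
        ((maps_xSmall_pos ht hi).2 (Or.inr ⟨by simp only; omega, by simp only; omega, rfl⟩))
      simpa only [Nat.sub_add_cancel h1] using this.symm
  · rintro ⟨h1, h2, h3, h4⟩
    refine ⟨fun p q h => ?_, fun p h => ?_, fun q h => ?_⟩
    · rcases (maps_xSmall_pos ht hi).1 h with ⟨h5, h6⟩ | ⟨h5, h6, rfl⟩
      · simp only [h5, h6]
        exact h3.symm
      · exact (h4 _ (by omega) (by omega) (by omega) (by omega)).symm
    · have hp : (p : ℕ) = t + 1 := by
        by_contra hne
        by_cases hpt : (p : ℕ) = t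
        · exact h ⟨t + 1, by omega⟩ ((maps_xSmall_pos ht hi).2 (Or.inl ⟨hpt, rfl⟩))
        · exact h p ((maps_xSmall_pos ht hi).2 (Or.inr ⟨hpt, hne, rfl⟩))
      simpa only [hp] using h1
    · have hq : (q : ℕ) = t := by
        by_contra hne
        by_cases hqt : (q : ℕ) = t + 1
        · exact h ⟨t, by omega⟩ ((maps_xSmall_pos ht hi).2 (Or.inl ⟨rfl, hqt⟩))
        · exact h q ((maps_xSmall_pos ht hi).2 (Or.inr ⟨hne, hqt, rfl⟩))
      simpa only [hq] using h2

end IntertwinesGenerators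

/-! ### The sets `V`, `W` and `V'` as structural conditions -/

section Relations

variable {M : Type*} [Monoid M] {k m : ℕ}

/-- The index that precedes `i` in the cyclic order of `1, …, k`. -/
def prevIdx (k i : ℕ) : ℕ := if i = 1 then k else i - 1

theorem prevIdx_one (k : ℕ) : prevIdx k 1 = k := rfl

theorem prevIdx_succ (k : ℕ) {i : ℕ} (hi : 1 ≤ i) : prevIdx k (i + 1) = i := by
  rw [prevIdx, if_neg (by omega), Nat.add_sub_cancel]

theorem prevIdx_mem {i : ℕ} (h1 : 1 ≤ i) (h2 : i ≤ k) : 1 ≤ prevIdx k i ∧ prevIdx k i ≤ k := by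
  rw [prevIdx]; split_ifs <;> omega

/-- The relations `V`, with cyclic indices. -/
structure IsUnitSystem (k m : ℕ) (δ : ℕ → M) : Prop where
  sq : ∀ i, 1 ≤ i → i ≤ k → (δ (prevIdx k i) ^ m * δ i ^ (m - 1)) ^ 2 = 1
  pow : ∀ i, 1 ≤ i → i ≤ k → δ i ^ (m * (m - 1)) = 1
  conj_pow : ∀ i, 1 ≤ i → i ≤ k →
    (δ i ^ (m - 1) ^ 2 * δ (prevIdx k i) ^ m * δ i ^ (m - 1)) ^ (m - 1) = 1
  braid : ∀ i, 1 ≤ i → i ≤ k →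
    (δ (prevIdx k i) ^ m * δ i ^ ((m - 1) ^ 2 * (m - 2)) * δ (prevIdx k i) ^ m) ^ 3 = 1
  far : ∀ i j, 1 ≤ i → i ≤ k → 2 ≤ j → j ≤ m - 2 →
    (δ (prevIdx k i) ^ m * δ i ^ ((m - 1) ^ 2 * (m - j - 1)) *
      δ (prevIdx k i) ^ m * δ i ^ ((m - 1) ^ 2 * (j - 1))) ^ 2 = 1
  comm_cc : ∀ i j, 1 ≤ i → i ≤ k → 1 ≤ j → j ≤ k → Commute (δ i ^ m) (δ j ^ m)
  comm_bb : ∀ i j, 1 ≤ i → i ≤ k → 1 ≤ j → j ≤ k →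
    Commute (δ i ^ (m - 1) ^ 2) (δ j ^ (m - 1) ^ 2)
  comm_bc : ∀ i j, 1 ≤ i → i ≤ k → 1 ≤ j → j ≤ k → i ≠ j →
    Commute (δ i ^ (m - 1) ^ 2) (δ (prevIdx k j) ^ m)

variable (ψ : FreeMonoid (Letter k) →* M)

theorem isUnitSystem_of_V (h : ∀ u v, V k m u v → ψ u = ψ v) :
    IsUnitSystem k m fun i => ψ (d k i) where
  sq i h1 h2 := by
    rcases Nat.eq_or_lt_of_le h1 with rfl | h3
    · simpa [prevIdx_one] using h _ _ V.v1_first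
    · obtain ⟨j, rfl⟩ : ∃ j, i = j + 1 := ⟨i - 1, by omega⟩
      rw [prevIdx_succ k (by omega)]
      simpa using h _ _ (V.v1 j (by omega) (by omega))
  pow i h1 h2 := by simpa using h _ _ (V.v2 i h1 h2)
  conj_pow i h1 h2 := by
    rcases Nat.eq_or_lt_of_le h1 with rfl | h3
    · simpa [prevIdx_one] using h _ _ V.v3_first
    · obtain ⟨j, rfl⟩ : ∃ j, i = j + 1 := ⟨i - 1, by omega⟩
      rw [prevIdx_succ k (by omega)]
      simpa using h _ _ (V.v3 j (by omega) (by omega))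
  braid i h1 h2 := by
    rcases Nat.eq_or_lt_of_le h1 with rfl | h3
    · simpa [prevIdx_one] using h _ _ V.v4_first
    · obtain ⟨j, rfl⟩ : ∃ j, i = j + 1 := ⟨i - 1, by omega⟩
      rw [prevIdx_succ k (by omega)]
      simpa using h _ _ (V.v4 j (by omega) (by omega))
  far i l h1 h2 hl hl' := by
    rcases Nat.eq_or_lt_of_le h1 with rfl | h3
    · simpa [prevIdx_one] using h _ _ (V.v5_first l hl hl')
    · obtain ⟨j, rfl⟩ : ∃ j, i = j + 1 := ⟨i - 1, by omega⟩
      rw [prevIdx_succ k (by omega)]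
      simpa using h _ _ (V.v5 j l hl hl' (by omega) (by omega))
  comm_cc i j h1 h2 h3 h4 := by
    rcases lt_trichotomy i j with hij | rfl | hij
    · simpa [commute_iff_eq] using h _ _ (V.v6_cc i j h1 hij h4)
    · exact Commute.refl _
    · exact Eq.symm (by simpa using h _ _ (V.v6_cc j i h3 hij h2))
  comm_bb i j h1 h2 h3 h4 := by
    rcases lt_trichotomy i j with hij | rfl | hij
    · simpa [commute_iff_eq] using h _ _ (V.v6_bb i j h1 hij h4)
    · exact Commute.refl _
    · exact Eq.symm (by simpa using h _ _ (V.v6_bb j i h3 hij h2))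
  comm_bc i j h1 h2 h3 h4 hij := by
    -- The presentation omits this pair of indices; here both sides are powers of the same letter.
    by_cases hp : i = prevIdx k j
    · rw [← hp]
      exact (Commute.refl _).pow_pow _ _
    · rcases Nat.eq_or_lt_of_le h3 with rfl | h5
      · rw [prevIdx_one] at hp ⊢
        simpa [commute_iff_eq] using h _ _ (V.v6_bc_first i (by omega) (by omega))
      · obtain ⟨l, rfl⟩ : ∃ l, j = l + 1 := ⟨j - 1, by omega⟩
        rw [prevIdx_succ k (by omega)] at hp ⊢
        simpa [commute_iff_eq] using h _ _ (V.v6_bc i l h1 h2 (by omega) (by omega) hp hij)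

theorem V_of_isUnitSystem (hk : 2 ≤ k) (H : IsUnitSystem k m fun i => ψ (d k i))
    {u v : FreeMonoid (Letter k)} (h : V k m u v) : ψ u = ψ v := by
  have p1 : prevIdx k 1 = k := rfl
  cases h with
  | v1_first => simpa [p1] using H.sq 1 le_rfl (by omega)
  | v1 i h1 h2 => simpa [prevIdx_succ k h1] using H.sq (i + 1) (by omega) (by omega)
  | v2 i h1 h2 => simpa using H.pow i h1 h2
  | v3_first => simpa [p1] using H.conj_pow 1 le_rfl (by omega)
  | v3 i h1 h2 => simpa [prevIdx_succ k h1] using H.conj_pow (i + 1) (by omega) (by omega)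
  | v4_first => simpa [p1] using H.braid 1 le_rfl (by omega)
  | v4 i h1 h2 => simpa [prevIdx_succ k h1] using H.braid (i + 1) (by omega) (by omega)
  | v5_first j hj1 hj2 => simpa [p1] using H.far 1 j le_rfl (by omega) hj1 hj2
  | v5 i j hj1 hj2 h1 h2 =>
    simpa [prevIdx_succ k h1] using H.far (i + 1) j (by omega) (by omega) hj1 hj2
  | v6_cc i j h1 h2 h3 => simpa using (H.comm_cc i j h1 (by omega) (by omega) h3).eq
  | v6_bb i j h1 h2 h3 => simpa using (H.comm_bb i j h1 (by omega) (by omega) h3).eq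
  | v6_bc_first i h1 h2 =>
    simpa [p1] using (H.comm_bc i 1 (by omega) (by omega) le_rfl (by omega) (by omega)).eq
  | v6_bc i j h1 h2 h3 h4 h5 h6 =>
    simpa [prevIdx_succ k h3] using
      (H.comm_bc i (j + 1) h1 h2 (by omega) (by omega) h6).eq

/-- The reversal `y_p = x_{n-p}` turns increasing runs of letters into descending runs of moves. -/
theorem map_xRun {n : ℕ} (ψ : FreeMonoid (Letter (n + 1)) →* M) (i : ℕ) {j : ℕ} (hj : j ≤ n) :
    ψ (xRun (n + 1) (n + 1 - j) (n + 1 - i)) = descRun (fun p => ψ (x (n + 1) (n - p))) i j := by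
  induction j with
  | zero => simp [xRun, descRun]
  | succ j ih =>
    by_cases hij : i ≤ j
    · rw [descRun_succ _ hij, ← ih (by omega), xRun, xRun,
        show n + 1 - i - (n + 1 - (j + 1)) = (n + 1 - i - (n + 1 - j)) + 1 by omega,
        List.range'_succ, show n + 1 - (j + 1) + 1 = n + 1 - j by omega,
        show n + 1 - (j + 1) = n - j by omega]
      simp
    · rw [descRun_of_le _ (by omega), xRun,
        show n + 1 - i - (n + 1 - (j + 1)) = 0 by omega]
      simp

theorem xRun_zero {i : ℕ} (hi : 1 ≤ i) : xRun k 0 i = x k 0 * xRun k 1 i := by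
  obtain ⟨l, rfl⟩ : ∃ l, i = l + 1 := ⟨i - 1, by omega⟩
  simp [xRun, List.range'_succ]

/-- With `i = n - p`, the word in front of the last `x_i` in `w5` is `omitPoint` at `p + 1`, and the
word in front of `x_i²` in `w6` is `moveInv` at `p`. The case `i = 0` of `w5` says that the full run
is an inverse of the shift. -/
theorem W_iff_isShiftMoveSystem {n : ℕ} (hn : 1 ≤ n) (ψ : FreeMonoid (Letter (n + 1)) →* M) :
    (∀ u v, W (n + 1) u v → ψ u = ψ v) ↔
      IsShiftMoveSystem n (ψ (x (n + 1) 0)) fun p => ψ (x (n + 1) (n - p)) := by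
  have run : ∀ p, p ≤ n → ψ (xRun (n + 1) (n + 1 - p) (n + 1)) =
      descRun (fun p => ψ (x (n + 1) (n - p))) 0 p := fun p hp => map_xRun ψ 0 hp
  have run' : ∀ p, p < n → ψ (xRun (n + 1) 0 (n - p)) = ψ (x (n + 1) 0) *
      descRun (fun p => ψ (x (n + 1) (n - p))) (p + 1) n := fun p hp => by
    rw [xRun_zero (by omega), map_mul, ← map_xRun ψ (p + 1) le_rfl,
      show n + 1 - n = 1 by omega, show n + 1 - (p + 1) = n - p by omega]
  have run0 : ψ (xRun (n + 1) 0 (n + 1)) = ψ (x (n + 1) 0) *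
      descRun (fun p => ψ (x (n + 1) (n - p))) 0 n := by
    rw [xRun_zero (by omega), map_mul, ← map_xRun ψ 0 le_rfl, show n + 1 - n = 1 by omega]
    rfl
  have nil : ψ (xRun (n + 1) 0 0) = 1 := by simp [xRun]
  constructor
  · intro h
    have e : ∀ p, p < n → n - (p + 1) + 1 = n - p := fun p hp => by omega
    refine ⟨fun p q h1 h2 => ?_, fun p hp => ?_, fun p hp => ?_, fun p hp => ?_, ?_, ?_, ?_,
      fun p hp => ?_, fun p hp => ?_⟩
    · simpa [commute_iff_eq] using h _ _ (W.w2 (n - q) (n - p) (by omega) (by omega) (by omega))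
    · simpa [e p (by omega)] using h _ _ (W.w4_left (n - (p + 1)) (by omega) (by omega))
    · simpa [e p (by omega)] using
        (h _ _ (W.w4_right (n - (p + 1)) (by omega) (by omega))).symm
    · simpa [e p (by omega)] using h _ _ (W.w1 (n - (p + 1)) (by omega) (by omega))
    · simpa [pow_two, show n - (n - 1) = 1 by omega] using h _ _ W.w3_left
    · simpa [pow_two] using (h _ _ W.w3_right).symm
    · have := h _ _ (W.w5 0 (by omega))
      rwa [map_mul, map_mul, run0, nil, mul_one] at this
    · have := h _ _ (W.w5 (n - p) (by omega))
      rwa [map_mul, map_mul, run' p hp, show n - p = n + 1 - (p + 1) by omega,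
        run (p + 1) hp, show n + 1 - (p + 1) = n - p by omega, ← mul_assoc] at this
    · have := h _ _ (W.w6 (n - p) (by omega) (by omega))
      rwa [map_mul, map_mul, run' p hp, show n - p + 1 = n + 1 - p by omega,
        run p hp.le, map_pow, pow_two, ← mul_assoc (descRun _ 0 p)] at this
  · intro H u v h
    cases h with
    | w1 i h1 h2 =>
      have := H.move_shift (n - i - 1) (by omega)
      simpa only [map_mul, show n - (n - i - 1 + 1) = i by omega,
        show n - (n - i - 1) = i + 1 by omega] using this
    | w2 i j h1 h2 h3 =>
      have := (H.far (n - j) (n - i) (by omega) (by omega)).eq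
      simpa only [map_mul, show n - (n - j) = j by omega, show n - (n - i) = i by omega] using this
    | w3_left =>
      have := H.sq_mul
      simpa only [map_mul, map_pow, pow_two, show n - (n - 1) = 1 by omega] using this
    | w3_right =>
      have := H.mul_sq.symm
      simpa only [map_mul, map_pow, pow_two, Nat.sub_zero, Nat.add_sub_cancel] using this
    | w4_left i h1 h2 =>
      have := H.absorb (n - i - 1) (by omega)
      simpa only [map_mul, show n - (n - i - 1 + 1) = i by omega,
        show n - (n - i - 1) = i + 1 by omega] using this
    | w4_right i h1 h2 =>
      have := (H.absorb' (n - i - 1) (by omega)).symm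
      simpa only [map_mul, show n - (n - i - 1 + 1) = i by omega,
        show n - (n - i - 1) = i + 1 by omega] using this
    | w5 i h =>
      rcases Nat.eq_zero_or_pos i with rfl | hi
      · rw [map_mul, map_mul, run0, nil, mul_one]
        exact H.shift_regular
      · obtain ⟨p, hp, rfl⟩ : ∃ p, p < n ∧ i = n - p := ⟨n - i, by omega, by omega⟩
        rw [map_mul, map_mul, run' p hp, show n - p = n + 1 - (p + 1) by omega,
          run (p + 1) hp, show n + 1 - (p + 1) = n - p by omega, ← mul_assoc]
        exact H.regular p hp
    | w6 i h1 h2 =>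
      obtain ⟨p, hp, rfl⟩ : ∃ p, p < n ∧ i = n - p := ⟨n - i, by omega, by omega⟩
      rw [map_mul, map_mul, run' p hp, show n - p + 1 = n + 1 - p by omega,
        run p hp.le, map_pow, pow_two, ← mul_assoc (descRun _ 0 p)]
      exact H.sq_regular p hp

/-- The elements `d_{i-1}^m d_i^{m-1}` and `d_i^{(m-1)^2}`, which stand for the generators of the
`i`-th symmetric group. -/
def transElt (k m : ℕ) (δ : ℕ → M) (i : ℕ) : M := δ (prevIdx k i) ^ m * δ i ^ (m - 1)

theorem transElt_one (δ : ℕ → M) : transElt k m δ 1 = δ k ^ m * δ 1 ^ (m - 1) := rfl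

theorem transElt_succ (δ : ℕ → M) {i : ℕ} (hi : 1 ≤ i) :
    transElt k m δ (i + 1) = δ i ^ m * δ (i + 1) ^ (m - 1) := by
  rw [transElt, prevIdx_succ k hi]

/-- The relations `V'` are exactly the intertwining conditions for the stand-ins of `a_i` and `b_i`.
The separately listed relations are those in which `transElt` at index `1` wraps around to `d_k`. -/
theorem intertwines_of_V' (hk : 2 ≤ k) (h : ∀ u v, V' k m u v → ψ u = ψ v) (i : Fin k) :
    Intertwines (fun p : Fin k => transElt k m (fun j => ψ (d k j)) (p + 1)) (ψ (x k i))
        (xSmall k i) ∧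
      Intertwines (fun p : Fin k => ψ (d k (p + 1)) ^ (m - 1) ^ 2) (ψ (x k i)) (xSmall k i) := by
  have hik := i.2
  by_cases hi : (i : ℕ) = 0
  · rw [intertwines_xSmall_zero_iff hi,
      intertwines_xSmall_zero_iff (g := fun j => ψ (d k j) ^ (m - 1) ^ 2) hi, hi]
    refine ⟨⟨?_, ?_, fun j h1 h2 => ?_⟩, ?_, ?_, fun j h1 h2 => ?_⟩
    · simpa [transElt_one] using h _ _ V'.v1_a
    · obtain ⟨l, rfl⟩ : ∃ l, k = l + 1 := ⟨k - 1, by omega⟩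
      rw [transElt_succ _ (by omega)]
      simpa [mul_assoc] using h _ _ (V'.v3_a 0 (by omega))
    · rw [transElt_succ _ h1]
      rcases Nat.eq_or_lt_of_le h1 with rfl | h3
      · rw [transElt_one]
        simpa [mul_assoc] using h _ _ V'.v2_a_first
      · obtain ⟨l, rfl⟩ : ∃ l, j = l + 1 := ⟨j - 1, by omega⟩
        rw [transElt_succ _ (by omega)]
        simpa [mul_assoc] using h _ _ (V'.v2_a l (by omega) (by omega))
    · simpa using h _ _ V'.v1_b
    · simpa using h _ _ (V'.v3_b 0 (by omega))
    · simpa using h _ _ (V'.v2_b j h1 h2)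
  · rw [intertwines_xSmall_pos_iff hi,
      intertwines_xSmall_pos_iff (g := fun j => ψ (d k j) ^ (m - 1) ^ 2) hi]
    obtain ⟨i, hik'⟩ := i
    dsimp only at hi hik ⊢
    obtain ⟨t, rfl⟩ : ∃ t, k = i + t + 1 := ⟨k - i - 1, by omega⟩
    have e : i + t + 1 - i = t + 1 := by omega
    have e' : i + t + 1 - (t + 1) = i := by omega
    rw [e]
    refine ⟨⟨?_, ?_, ?_, fun j h1 h2 h3 h4 => ?_⟩, ?_, ?_, ?_, fun j h1 h2 h3 h4 => ?_⟩
    · rw [transElt_succ _ (by omega)]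
      simpa [e'] using h _ _ (V'.v4_a (t + 1) (by omega) (by omega))
    · rcases Nat.eq_zero_or_pos t with rfl | ht
      · rw [transElt_one]
        simpa [mul_assoc] using h _ _ V'.v3_a_last
      · rw [transElt_succ _ ht]
        simpa [mul_assoc, e] using h _ _ (V'.v3_a i (by omega))
    · rw [transElt_succ _ (by omega)]
      rcases Nat.eq_zero_or_pos t with rfl | ht
      · rw [transElt_one]
        simpa [mul_assoc] using h _ _ V'.v5_a_last
      · rw [transElt_succ _ ht]
        simpa [mul_assoc, e] using h _ _ (V'.v5_a i (by omega) (by omega))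
    · rcases Nat.eq_or_lt_of_le h1 with rfl | h5
      · rw [transElt_one]
        simpa [mul_assoc] using h _ _ (V'.v6_a_first i (by omega) (by omega))
      · obtain ⟨l, rfl⟩ : ∃ l, j = l + 1 := ⟨j - 1, by omega⟩
        rw [transElt_succ _ (by omega)]
        simpa [mul_assoc] using
          h _ _ (V'.v6_a i l (by omega) (by omega) (by omega) (by omega) (by omega) (by omega))
    · simpa [e'] using h _ _ (V'.v4_b (t + 1) (by omega) (by omega))
    · simpa [e] using h _ _ (V'.v3_b i (by omega))
    · simpa [e] using h _ _ (V'.v5_b i (by omega) (by omega))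
    · simpa using h _ _ (V'.v6_b i j (by omega) (by omega) h1 h2 (by omega) (by omega))

theorem V'_of_intertwines (hk : 2 ≤ k)
    (H1 : ∀ i : Fin k, Intertwines (fun p : Fin k => transElt k m (fun j => ψ (d k j)) (p + 1))
      (ψ (x k i)) (xSmall k i))
    (H2 : ∀ i : Fin k, Intertwines (fun p : Fin k => ψ (d k (p + 1)) ^ (m - 1) ^ 2)
      (ψ (x k i)) (xSmall k i))
    {u v : FreeMonoid (Letter k)} (h : V' k m u v) : ψ u = ψ v := by
  have A0 := (intertwines_xSmall_zero_iff (i := ⟨0, by omega⟩) rfl).1 (H1 ⟨0, by omega⟩)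
  have B0 := (intertwines_xSmall_zero_iff (g := fun j => ψ (d k j) ^ (m - 1) ^ 2)
    (i := ⟨0, by omega⟩) rfl).1 (H2 ⟨0, by omega⟩)
  have A : ∀ i, 1 ≤ i → (hi : i < k) → _ := fun i h1 hi =>
    (intertwines_xSmall_pos_iff (i := ⟨i, hi⟩) (by simp only; omega)).1 (H1 ⟨i, hi⟩)
  have B : ∀ i, 1 ≤ i → (hi : i < k) → _ := fun i h1 hi =>
    (intertwines_xSmall_pos_iff (g := fun j => ψ (d k j) ^ (m - 1) ^ 2) (i := ⟨i, hi⟩)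
      (by simp only; omega)).1 (H2 ⟨i, hi⟩)
  simp only at A0 B0 A B
  cases h with
  | v1_a => simpa [transElt_one] using A0.1
  | v1_b => simpa using B0.1
  | v2_a_first => simpa [transElt_one, transElt_succ, mul_assoc] using A0.2.2 1 le_rfl (by omega)
  | v2_a i h1 h2 =>
    simpa [transElt_succ, h1, mul_assoc] using A0.2.2 (i + 1) (by omega) (by omega)
  | v2_b i h1 h2 => simpa using B0.2.2 i h1 h2
  | v3_a i h =>
    rcases Nat.eq_zero_or_pos i with rfl | hi
    · obtain ⟨l, rfl⟩ : ∃ l, k = l + 1 := ⟨k - 1, by omega⟩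
      have := A0.2.1
      rw [transElt_succ _ (by omega)] at this
      simpa [mul_assoc] using this
    · obtain ⟨t, rfl⟩ : ∃ t, k = i + t + 2 := ⟨k - i - 2, by omega⟩
      have e : i + t + 2 - i = t + 1 + 1 := by omega
      have := (A i hi (by omega)).2.1
      rw [e, transElt_succ _ (by omega)] at this
      simpa [mul_assoc, e] using this
  | v3_a_last =>
    have := (A (k - 1) (by omega) (by omega)).2.1
    rw [show k - (k - 1) = 1 by omega, transElt_one] at this
    simpa [mul_assoc] using this
  | v3_b i h =>
    rcases Nat.eq_zero_or_pos i with rfl | hi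
    · simpa using B0.2.1
    · simpa using (B i hi (by omega)).2.1
  | v4_a i h1 h2 =>
    have := (A (k - i) (by omega) (by omega)).1
    rw [show k - (k - i) = i by omega, transElt_succ _ h1] at this
    simpa using this
  | v4_b i h1 h2 =>
    have := (B (k - i) (by omega) (by omega)).1
    rw [show k - (k - i) = i by omega] at this
    simpa using this
  | v5_a i h1 h2 =>
    obtain ⟨t, rfl⟩ : ∃ t, k = i + t + 2 := ⟨k - i - 2, by omega⟩
    have e : i + t + 2 - i = t + 1 + 1 := by omega
    have := (A i h1 (by omega)).2.2.1
    rw [e, transElt_succ _ (by omega), transElt_succ _ (by omega)] at this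
    simpa [mul_assoc, e] using this
  | v5_a_last =>
    have := (A (k - 1) (by omega) (by omega)).2.2.1
    rw [show k - (k - 1) = 1 by omega, transElt_succ _ le_rfl, transElt_one] at this
    simpa [mul_assoc] using this
  | v5_b i h1 h2 => simpa using (B i h1 (by omega)).2.2.1
  | v6_a_first i h1 h2 =>
    have := (A i h1 (by omega)).2.2.2 1 le_rfl (by omega) (by omega) (by omega)
    rw [transElt_one] at this
    simpa [mul_assoc] using this
  | v6_a i j h1 h2 h3 h4 h5 h6 =>
    have := (A i h1 (by omega)).2.2.2 (j + 1) (by omega) (by omega) (by omega) (by omega)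
    rw [transElt_succ _ h3] at this
    simpa [mul_assoc] using this
  | v6_b i j h1 h2 h3 h4 h5 h6 => simpa using (B i h1 (by omega)).2.2.2 j h3 h4 h5 h6

end Relations

theorem exists_prevIdx_eq {k i : ℕ} (h1 : 1 ≤ i) (h2 : i ≤ k) :
    ∃ i', 1 ≤ i' ∧ i' ≤ k ∧ prevIdx k i' = i := by
  by_cases h : i = k
  · exact ⟨1, le_rfl, by omega, by rw [prevIdx_one, h]⟩
  · exact ⟨i + 1, by omega, by omega, prevIdx_succ k h1⟩

/-! ### The relations `V` in a group and Moore pairs -/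

section UnitSystems

variable {G : Type*} [Group G] {k m : ℕ}

/-- Moore's words for `β⁻¹` are conjugate to those for `β`, so his relations do not distinguish `β`
from its inverse. -/
theorem IsMoorePair.conj_inv_eq (α β : G) :
    α * (β⁻¹ * α * β) = (α * β)⁻¹ * (α * (β * α * β⁻¹)) * ((α * β)⁻¹)⁻¹ := by
  group

/-- The left side is the base of the relator `far` after the substitutions `d_{i-1}^m = αβ` and
`β^{m-j-1} = β^{-(j+1)}`. -/
theorem conj_pow_inv_eq (α β : G) {j : ℕ} (hj : 1 ≤ j) :
    α * β * (β ^ (j + 1))⁻¹ * (α * β) * β ^ (j - 1) = α * ((β ^ j)⁻¹ * α * β ^ j) := by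
  obtain ⟨l, rfl⟩ : ∃ l, j = l + 1 := ⟨j - 1, by omega⟩
  rw [Nat.add_sub_cancel, mul_assoc _ (α * β), mul_assoc α β (β ^ l), ← pow_succ',
    pow_succ β (l + 1), mul_inv_rev]
  simp only [mul_assoc, mul_inv_cancel_left]

theorem IsMoorePair.inv {α β : G} (H : IsMoorePair m α β) : IsMoorePair m α β⁻¹ where
  sq := H.sq
  pow := by rw [inv_pow, H.pow, inv_one]
  mul_pow := by
    have e : α * β⁻¹ = (α⁻¹ * (α * β) * (α⁻¹)⁻¹)⁻¹ := by
      rw [inv_inv, inv_mul_cancel_left, mul_inv_rev, inv_eq_of_mul_eq_one_left H.sq]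
    rw [e, inv_pow, conj_pow, H.mul_pow]; group
  braid := by
    rw [inv_inv, conj_inv_eq, conj_pow, H.braid]; group
  far j h1 h2 := by
    rw [inv_pow, inv_inv, conj_inv_eq, conj_pow, H.far j h1 h2]; group

namespace IsUnitSystem

variable {δ : ℕ → G}

/-- The exponents satisfy `(m-1)² + (m-1) = m(m-1)`. -/
theorem pow_sq_mul_pow (hm : 2 ≤ m) {a : G} (h : a ^ (m * (m - 1)) = 1) :
    (a ^ (m - 1) ^ 2)⁻¹ = a ^ (m - 1) := by
  apply inv_eq_of_mul_eq_one_left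
  rw [← pow_add, ← h]
  obtain ⟨l, rfl⟩ : ∃ l, m = l + 1 := ⟨m - 1, by omega⟩
  rw [Nat.add_sub_cancel]
  congr 1
  ring

/-- This is the identity `ab = c`, with `d_{i-1}^m` in the role of `c`. -/
theorem transElt_mul (hm : 2 ≤ m) (H : IsUnitSystem k m δ) {i : ℕ} (h1 : 1 ≤ i) (h2 : i ≤ k) :
    transElt k m δ i * δ i ^ (m - 1) ^ 2 = δ (prevIdx k i) ^ m := by
  rw [transElt, ← pow_sq_mul_pow hm (H.pow i h1 h2), inv_mul_cancel_right]

/-- Substituting `αβ` for `d_{i-1}^m` and `β^{-j}` for `β^{m-j}` turns the relators of `V` into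
Moore's relators for `α` and `β⁻¹`, which are conjugate to those for `α` and `β`. -/
theorem isMoorePair (hm : 2 ≤ m) (H : IsUnitSystem k m δ) {i : ℕ} (h1 : 1 ≤ i) (h2 : i ≤ k) :
    IsMoorePair m (transElt k m δ i) (δ i ^ (m - 1) ^ 2) := by
  have hγ := H.transElt_mul hm h1 h2
  have hp := prevIdx_mem h1 h2
  set α := transElt k m δ i with hα
  set β := δ i ^ (m - 1) ^ 2 with hβ
  have hpow : β ^ m = 1 := by
    rw [hβ, ← pow_mul, show (m - 1) ^ 2 * m = m * (m - 1) * (m - 1) by ring, pow_mul,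
      H.pow i h1 h2, one_pow]
  have hneg : ∀ j, j ≤ m → β ^ (m - j) = (β ^ j)⁻¹ := fun j hj => by
    apply eq_inv_of_mul_eq_one_left
    rw [← pow_add, Nat.sub_add_cancel hj, hpow]
  refine ⟨?_, hpow, ?_, ?_, fun j hj1 hj2 => ?_⟩
  · rw [← pow_two]
    exact H.sq i h1 h2
  · rw [hγ, ← pow_mul, H.pow _ hp.1 hp.2]
  · have h := H.braid i h1 h2
    rw [← hγ, pow_mul, ← hβ, hneg 2 hm] at h
    have e : α * β * (β ^ 2)⁻¹ * (α * β) = α * (β⁻¹ * α * β) := by group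
    rw [e, IsMoorePair.conj_inv_eq, _root_.conj_pow] at h
    exact conj_eq_one_iff.1 h
  · have h := H.far i j h1 h2 hj1 hj2
    rw [← hγ, pow_mul, pow_mul, ← hβ, Nat.sub_sub, hneg (j + 1) (by omega)] at h
    rw [conj_pow_inv_eq α β (by omega), IsMoorePair.conj_inv_eq, _root_.conj_pow] at h
    exact conj_eq_one_iff.1 h

/-- Each `transElt` is a power `d_{i-1}^m` times the inverse of `d_i^q`, and `V` makes these powers
commute for different places. -/
theorem commute (hm : 2 ≤ m) (H : IsUnitSystem k m δ) {i j : ℕ} (h1 : 1 ≤ i) (h2 : i ≤ k)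
    (h3 : 1 ≤ j) (h4 : j ≤ k) (hij : i ≠ j) {a b : G}
    (ha : a = transElt k m δ i ∨ a = δ i ^ (m - 1) ^ 2)
    (hb : b = transElt k m δ j ∨ b = δ j ^ (m - 1) ^ 2) : Commute a b := by
  have hi := prevIdx_mem h1 h2
  have hj := prevIdx_mem h3 h4
  have e : ∀ l, 1 ≤ l → l ≤ k →
      transElt k m δ l = δ (prevIdx k l) ^ m * (δ l ^ (m - 1) ^ 2)⁻¹ := fun l h5 h6 => by
    rw [pow_sq_mul_pow hm (H.pow l h5 h6)]; rfl
  have cc := H.comm_cc _ _ hi.1 hi.2 hj.1 hj.2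
  have bb := H.comm_bb i j h1 h2 h3 h4
  have bc := H.comm_bc i j h1 h2 h3 h4 hij
  have cb := (H.comm_bc j i h3 h4 h1 h2 hij.symm).symm
  rcases ha with rfl | rfl <;> rcases hb with rfl | rfl
  · rw [e i h1 h2, e j h3 h4]
    exact (cc.mul_right cb.inv_right).mul_left (bc.inv_left.mul_right bb.inv_inv)
  · rw [e i h1 h2]
    exact cb.mul_left bb.inv_left
  · rw [e j h3 h4]
    exact bc.mul_right bb.inv_right
  · exact bb

/-- Pairwise commuting Moore pairs give rise to a solution of the relations `V`. -/
theorem of_isMoorePair (hm : 2 ≤ m) {α β : ℕ → G}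
    (hM : ∀ i, 1 ≤ i → i ≤ k → IsMoorePair m (α i) (β i))
    (hαα : ∀ i j, i ≠ j → Commute (α i) (α j)) (hαβ : ∀ i j, i ≠ j → Commute (α i) (β j))
    (hββ : ∀ i j, i ≠ j → Commute (β i) (β j))
    (hγ : ∀ i, 1 ≤ i → i ≤ k → δ (prevIdx k i) ^ m = α i * β i)
    (hβ : ∀ i, 1 ≤ i → i ≤ k → δ i ^ (m - 1) ^ 2 = β i)
    (hβ' : ∀ i, 1 ≤ i → i ≤ k → δ i ^ (m - 1) = (β i)⁻¹) : IsUnitSystem k m δ := by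
  have hneg : ∀ i, 1 ≤ i → i ≤ k → ∀ j, j ≤ m → β i ^ (m - j) = (β i ^ j)⁻¹ :=
    fun i h1 h2 j hj => by
      apply eq_inv_of_mul_eq_one_left
      rw [← pow_add, Nat.sub_add_cancel hj, (hM i h1 h2).pow]
  constructor
  · intro i h1 h2
    rw [hγ i h1 h2, hβ' i h1 h2, mul_inv_cancel_right, pow_two, (hM i h1 h2).sq]
  · intro i h1 h2
    obtain ⟨l, rfl⟩ : ∃ l, m = l + 1 := ⟨m - 1, by omega⟩
    have h3 := hβ i h1 h2
    have h4 := hβ' i h1 h2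
    rw [Nat.add_sub_cancel] at h3 h4 ⊢
    rw [show (l + 1) * l = l ^ 2 + l by ring, pow_add, h3, h4, mul_inv_cancel]
  · intro i h1 h2
    rw [hβ i h1 h2, hγ i h1 h2, hβ' i h1 h2, _root_.conj_pow, (hM i h1 h2).mul_pow]
    group
  · intro i h1 h2
    rw [hγ i h1 h2, pow_mul, hβ i h1 h2, hneg i h1 h2 2 hm]
    have e : α i * β i * (β i ^ 2)⁻¹ * (α i * β i) = α i * ((β i)⁻¹ * α i * β i) := by group
    rw [e, IsMoorePair.conj_inv_eq, _root_.conj_pow, (hM i h1 h2).braid]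
    group
  · intro i j h1 h2 hj1 hj2
    rw [hγ i h1 h2, pow_mul, pow_mul, hβ i h1 h2, Nat.sub_sub, hneg i h1 h2 (j + 1) (by omega)]
    rw [conj_pow_inv_eq (α i) (β i) (by omega), IsMoorePair.conj_inv_eq, _root_.conj_pow, (hM i h1 h2).far j hj1 hj2]
    group
  · intro i j h1 h2 h3 h4
    by_cases hij : i = j
    · rw [hij]
    obtain ⟨i', h5, h6, rfl⟩ := exists_prevIdx_eq h1 h2
    obtain ⟨j', h7, h8, rfl⟩ := exists_prevIdx_eq h3 h4
    have hne : i' ≠ j' := fun h => hij (by rw [h])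
    rw [hγ i' h5 h6, hγ j' h7 h8]
    exact ((hαα _ _ hne).mul_right (hαβ _ _ hne)).mul_left
      ((hαβ _ _ hne.symm).symm.mul_right (hββ _ _ hne))
  · intro i j h1 h2 h3 h4
    by_cases hij : i = j
    · rw [hij]
    rw [hβ i h1 h2, hβ j h3 h4]
    exact hββ _ _ hij
  · intro i j h1 h2 h3 h4 hij
    rw [hβ i h1 h2, hγ j h3 h4]
    exact (hαβ _ _ hij.symm).symm.mul_right (hββ _ _ hij)

theorem map {M N : Type*} [Monoid M] [Monoid N] (f : M →* N) {δ : ℕ → M}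
    (H : IsUnitSystem k m δ) : IsUnitSystem k m fun i => f (δ i) where
  sq i h1 h2 := by simpa using congrArg f (H.sq i h1 h2)
  pow i h1 h2 := by simpa using congrArg f (H.pow i h1 h2)
  conj_pow i h1 h2 := by simpa using congrArg f (H.conj_pow i h1 h2)
  braid i h1 h2 := by simpa using congrArg f (H.braid i h1 h2)
  far i j h1 h2 h3 h4 := by simpa using congrArg f (H.far i j h1 h2 h3 h4)
  comm_cc i j h1 h2 h3 h4 := by simpa using (H.comm_cc i j h1 h2 h3 h4).map f
  comm_bb i j h1 h2 h3 h4 := by simpa using (H.comm_bb i j h1 h2 h3 h4).map f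
  comm_bc i j h1 h2 h3 h4 h5 := by simpa using (H.comm_bc i j h1 h2 h3 h4 h5).map f

theorem of_map {M N : Type*} [Monoid M] [Monoid N] (f : M →* N) (hf : Function.Injective f)
    {δ : ℕ → M} (H : IsUnitSystem k m fun i => f (δ i)) : IsUnitSystem k m δ where
  sq i h1 h2 := hf (by simpa using H.sq i h1 h2)
  pow i h1 h2 := hf (by simpa using H.pow i h1 h2)
  conj_pow i h1 h2 := hf (by simpa using H.conj_pow i h1 h2)
  braid i h1 h2 := hf (by simpa using H.braid i h1 h2)
  far i j h1 h2 h3 h4 := hf (by simpa using H.far i j h1 h2 h3 h4)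
  comm_cc i j h1 h2 h3 h4 := hf (by simpa using (H.comm_cc i j h1 h2 h3 h4).eq)
  comm_bb i j h1 h2 h3 h4 := hf (by simpa using (H.comm_bb i j h1 h2 h3 h4).eq)
  comm_bc i j h1 h2 h3 h4 h5 := hf (by simpa using (H.comm_bc i j h1 h2 h3 h4 h5).eq)

end IsUnitSystem

end UnitSystems

/-! ### The relations `V` in the power of the symmetric group -/

section Tuples

variable {k m : ℕ}

/-- The element of `S_m^k` with `σ` in the place with number `i ∈ {1, …, k}`. -/
def tupleSingle (k : ℕ) (i : ℕ) (σ : Perm (Fin m)) : Fin k → Perm (Fin m) :=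
  fun j => if (j : ℕ) + 1 = i then σ else 1

theorem tupleSingle_succ (j : Fin k) (σ : Perm (Fin m)) :
    tupleSingle k (j + 1) σ = Pi.mulSingle j σ := by
  ext l : 1
  simp [tupleSingle, Pi.mulSingle_apply, Fin.ext_iff]

theorem tupleSingle_mul (i : ℕ) (σ τ : Perm (Fin m)) :
    tupleSingle k i (σ * τ) = tupleSingle k i σ * tupleSingle k i τ := by
  ext j : 1
  simp only [tupleSingle, Pi.mul_apply]
  split_ifs <;> simp

theorem tupleSingle_inv (i : ℕ) (σ : Perm (Fin m)) :
    tupleSingle k i σ⁻¹ = (tupleSingle k i σ)⁻¹ := by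
  ext j : 1
  simp only [tupleSingle, Pi.inv_apply]
  split_ifs <;> simp

theorem commute_tupleSingle {i j : ℕ} (h : i ≠ j) (σ τ : Perm (Fin m)) :
    Commute (tupleSingle k i σ) (tupleSingle k j τ) := by
  change _ * _ = _ * _
  ext l : 1
  simp only [tupleSingle, Pi.mul_apply]
  split_ifs <;> first | omega | simp

theorem isMoorePair_tupleSingle (hm : 2 ≤ m) (i : ℕ) :
    IsMoorePair m (tupleSingle k i (transA m)) (tupleSingle k i (cycB m)⁻¹) := by
  let f : Perm (Fin m) →* (Fin k → Perm (Fin m)) :=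
    MonoidHom.mk' (tupleSingle k i) (tupleSingle_mul i)
  have H := (isMoorePair_perm hm).inv
  have e : ∀ {σ : Perm (Fin m)}, σ = 1 → f σ = 1 := fun h => by rw [h, map_one]
  have hA : tupleSingle k i (transA m) = f (transA m) := rfl
  have hB : tupleSingle k i (cycB m)⁻¹ = f (cycB m)⁻¹ := rfl
  rw [hA, hB]
  refine ⟨?_, ?_, ?_, ?_, fun j h1 h2 => ?_⟩
  · simpa only [map_mul] using e H.sq
  · simpa only [map_pow] using e H.pow
  · simpa only [map_mul, map_pow] using e H.mul_pow
  · simpa only [map_mul, map_pow, map_inv] using e H.braid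
  · simpa only [map_mul, map_pow, map_inv] using e (H.far j h1 h2)

/-- The inverse of the tuple that belongs to the letter `d_i`, for `1 ≤ i ≤ k`. -/
def invTupleD (k m i : ℕ) : Fin k → Perm (Fin m) :=
  if h : 1 ≤ i ∧ i ≤ k then (tupleD k m ⟨i - 1, by omega⟩)⁻¹ else 1

theorem invTupleD_prevIdx (hk : 2 ≤ k) {i : ℕ} (h1 : 1 ≤ i) (h2 : i ≤ k) :
    invTupleD k m (prevIdx k i) =
      tupleSingle k (prevIdx k i) (cycB m)⁻¹ * tupleSingle k i (cycC m)⁻¹ := by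
  have hp := prevIdx_mem h1 h2
  have hne : prevIdx k i ≠ i := by rw [prevIdx]; split_ifs <;> omega
  rw [(commute_tupleSingle hne _ _).eq, invTupleD, dif_pos hp, tupleD, mul_inv_rev,
    tupleSingle_inv, tupleSingle_inv]
  have e1 : (finRotate k ⟨prevIdx k i - 1, by omega⟩ : Fin k) = ⟨i - 1, by omega⟩ := by
    rw [Fin.ext_iff, finRotate_val]
    simp only [prevIdx]
    split_ifs <;> omega
  rw [e1, ← tupleSingle_succ, ← tupleSingle_succ]
  simp only [Nat.sub_add_cancel h1, Nat.sub_add_cancel hp.1]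

/-- The two nontrivial components of the tuple commute and have orders dividing `m` and `m - 1`. So
the `m`-th power isolates the component of `c`, and the `(m-1)`-th power that of `b`. Inverse tuples
are used because `unitOf` reverses products. -/
theorem isUnitSystem_invTupleD (hk : 2 ≤ k) (hm : 2 ≤ m) :
    IsUnitSystem k m (invTupleD k m) ∧
      (∀ i, 1 ≤ i → i ≤ k →
        transElt k m (invTupleD k m) i = tupleSingle k i (transA m)) ∧
      ∀ i, 1 ≤ i → i ≤ k →
        invTupleD k m i ^ (m - 1) ^ 2 = tupleSingle k i (cycB m)⁻¹ := by
  let α := fun i => tupleSingle k i (transA m)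
  let β := fun i => tupleSingle k i (cycB m)⁻¹
  have hM : ∀ i, IsMoorePair m (α i) (β i) := fun i => isMoorePair_tupleSingle hm i
  have hc : ∀ i, tupleSingle k i (cycC m)⁻¹ = α i * β i := fun i => by
    have : (cycC m)⁻¹ = transA m * (cycB m)⁻¹ := by
      have : cycC m = cycB m * transA m := rfl
      rw [this, mul_inv_rev, inv_eq_of_mul_eq_one_left (isMoorePair_perm hm).sq]
    rw [this, tupleSingle_mul]
  have hδ : ∀ i, 1 ≤ i → i ≤ k → ∀ e, invTupleD k m (prevIdx k i) ^ e =
      β (prevIdx k i) ^ e * (α i * β i) ^ e := fun i h1 h2 e => by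
    rw [invTupleD_prevIdx hk h1 h2, (commute_tupleSingle _ _ _).mul_pow, hc]
    rw [prevIdx]; split_ifs <;> omega
  have hβm : ∀ i, β i ^ (m - 1) = (β i)⁻¹ := fun i => by
    apply eq_inv_of_mul_eq_one_left
    rw [← pow_succ, Nat.sub_add_cancel (by omega), (hM i).pow]
  have h1 : ∀ i, 1 ≤ i → i ≤ k → invTupleD k m (prevIdx k i) ^ m = α i * β i :=
    fun i h1 h2 => by
      rw [hδ i h1 h2, (hM _).pow, one_mul]
      have e : (α i * β i) ^ m = (α i * β i) ^ (m - 1 + 1) :=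
        congrArg ((α i * β i) ^ ·) (by omega)
      rw [e, pow_succ, (hM _).mul_pow, one_mul]
  have h3 : ∀ i, 1 ≤ i → i ≤ k → invTupleD k m i ^ (m - 1) = (β i)⁻¹ := fun i h1 h2 => by
    obtain ⟨i', h5, h6, rfl⟩ := exists_prevIdx_eq h1 h2
    rw [hδ i' h5 h6, (hM _).mul_pow, mul_one, hβm]
  have h2 : ∀ i, 1 ≤ i → i ≤ k → invTupleD k m i ^ (m - 1) ^ 2 = β i := fun i h1 h2 => by
    rw [pow_two, pow_mul, h3 i h1 h2, inv_pow, hβm, inv_inv]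
  refine ⟨IsUnitSystem.of_isMoorePair hm (fun i _ _ => hM i)
    (fun i j h => commute_tupleSingle h _ _) (fun i j h => commute_tupleSingle h _ _)
    (fun i j h => commute_tupleSingle h _ _) h1 h2 h3, fun i h4 h5 => ?_, h2⟩
  rw [transElt, h1 i h4 h5, h3 i h4 h5, mul_inv_cancel_right]

end Tuples

/-! ### Units and blow-ups as partial permutations of the long chain -/

section UnitsAndBlowUps

variable {k m : ℕ}

theorem finProd_ext {x y : Fin (k * m)} (h1 : x.divNat = y.divNat) (h2 : x.modNat = y.modNat) :
    x = y := finProdFinEquiv.symm.injective (Prod.ext h1 h2)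

theorem divNat_finProd (i : Fin k) (t : Fin m) : (finProdFinEquiv (i, t)).divNat = i :=
  congrArg Prod.fst (finProdFinEquiv.symm_apply_apply (i, t))

theorem modNat_finProd (i : Fin k) (t : Fin m) : (finProdFinEquiv (i, t)).modNat = t :=
  congrArg Prod.snd (finProdFinEquiv.symm_apply_apply (i, t))

theorem finProd_eq_iff {y : Fin (k * m)} {i : Fin k} {t : Fin m} :
    finProdFinEquiv (i, t) = y ↔ i = y.divNat ∧ t = y.modNat := by
  rw [← Equiv.eq_symm_apply]
  exact Prod.ext_iff

theorem maps_unitOf {z : Fin k → Perm (Fin m)} {x y : Fin (k * m)} :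
    Maps (unitOf z) x y ↔ x.divNat = y.divNat ∧ z x.divNat x.modNat = y.modNat := by
  rw [unitOf, maps_toPEquiv]
  exact finProd_eq_iff

theorem maps_blowUp {θ : PartialPerm (Fin k)} {x y : Fin (k * m)} :
    Maps (blowUp m θ) x y ↔ Maps θ x.divNat y.divNat ∧ x.modNat = y.modNat := by
  have h : Maps (blowUp m θ) x y ↔ ∃ j, Maps θ x.divNat j ∧ finProdFinEquiv (j, x.modNat) = y :=
    Option.map_eq_some_iff
  rw [h]
  constructor
  · rintro ⟨j, h1, h2⟩
    obtain ⟨rfl, h3⟩ := finProd_eq_iff.1 h2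
    exact ⟨h1, h3⟩
  · rintro ⟨h1, h2⟩
    exact ⟨_, h1, finProd_eq_iff.2 ⟨rfl, h2⟩⟩

theorem maps_unitOf_mul {z : Fin k → Perm (Fin m)} {α : PartialPerm (Fin (k * m))}
    {x y : Fin (k * m)} :
    Maps (unitOf z * α) x y ↔ Maps α (finProdFinEquiv (x.divNat, z x.divNat x.modNat)) y := by
  rw [maps_mul]
  constructor
  · rintro ⟨w, h1, h2⟩
    rwa [finProd_eq_iff.2 (maps_unitOf.1 h1)]
  · intro h
    exact ⟨_, maps_unitOf.2 ⟨(divNat_finProd _ _).symm, (modNat_finProd _ _).symm⟩, h⟩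

theorem maps_unitOf_mul_blowUp {z : Fin k → Perm (Fin m)} {θ : PartialPerm (Fin k)}
    {x y : Fin (k * m)} :
    Maps (unitOf z * blowUp m θ) x y ↔
      Maps θ x.divNat y.divNat ∧ z x.divNat x.modNat = y.modNat := by
  rw [maps_unitOf_mul, maps_blowUp, divNat_finProd, modNat_finProd]

theorem maps_blowUp_mul_unitOf {z : Fin k → Perm (Fin m)} {θ : PartialPerm (Fin k)}
    {x y : Fin (k * m)} :
    Maps (blowUp m θ * unitOf z) x y ↔
      Maps θ x.divNat y.divNat ∧ z y.divNat x.modNat = y.modNat := by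
  rw [maps_mul]
  simp only [maps_blowUp, maps_unitOf]
  constructor
  · rintro ⟨w, ⟨h1, h2⟩, h3, h4⟩
    rw [h3] at h1 h4
    exact ⟨h1, by rw [h2, h4]⟩
  · rintro ⟨h1, h2⟩
    exact ⟨finProdFinEquiv (y.divNat, x.modNat), by simpa only [divNat_finProd, modNat_finProd]
      using ⟨⟨h1, trivial⟩, trivial, h2⟩⟩

theorem unitOf_mul_blowUp {z w : Fin k → Perm (Fin m)} {θ : PartialPerm (Fin k)}
    (h : ∀ i j, Maps θ i j → z i = w j) :
    unitOf z * blowUp m θ = blowUp m θ * unitOf w := by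
  refine partialPerm_ext fun x y => ?_
  rw [maps_unitOf_mul_blowUp, maps_blowUp_mul_unitOf]
  refine and_congr_right fun hm => ?_
  rw [h _ _ hm]

theorem unitOf_one : unitOf (1 : Fin k → Perm (Fin m)) = 1 := by
  refine partialPerm_ext fun x y => ?_
  rw [maps_unitOf, maps_one]
  exact ⟨fun h => finProd_ext h.1 h.2, fun h => by rw [h]; exact ⟨rfl, rfl⟩⟩

theorem unitOf_mul (z w : Fin k → Perm (Fin m)) : unitOf z * unitOf w = unitOf (w * z) := by
  refine partialPerm_ext fun x y => ?_
  rw [maps_unitOf_mul, maps_unitOf, maps_unitOf, divNat_finProd, modNat_finProd]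
  rfl

/-- The tuples of permutations act on the chain as units; since maps act on the right, a tuple
is sent to the action of its inverse. -/
def unitHom (k m : ℕ) : (Fin k → Perm (Fin m)) →* PartialPerm (Fin (k * m)) where
  toFun z := unitOf z⁻¹
  map_one' := by rw [inv_one, unitOf_one]
  map_mul' z w := by rw [unitOf_mul, mul_inv_rev]

/-- The blow-up as a homomorphism. -/
def blowUpHom (k m : ℕ) : PartialPerm (Fin k) →* PartialPerm (Fin (k * m)) where
  toFun θ := blowUp m θ
  map_one' := by
    refine partialPerm_ext fun x y => ?_
    rw [maps_blowUp, maps_one, maps_one]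
    exact ⟨fun h => finProd_ext h.1 h.2, fun h => by rw [h]; exact ⟨rfl, rfl⟩⟩
  map_mul' θ χ := by
    refine partialPerm_ext fun x y => ?_
    rw [maps_mul, maps_blowUp, maps_mul]
    simp only [maps_blowUp]
    constructor
    · rintro ⟨⟨j, h1, h2⟩, h3⟩
      exact ⟨finProdFinEquiv (j, x.modNat), by simpa only [divNat_finProd, modNat_finProd]
        using ⟨⟨h1, trivial⟩, h2, h3⟩⟩
    · rintro ⟨w, ⟨h1, h2⟩, h3, h4⟩
      exact ⟨⟨_, h1, h3⟩, h2.trans h4⟩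

theorem intertwines_blowUp (σ : Perm (Fin m)) (θ : PartialPerm (Fin k)) :
    Intertwines (fun p : Fin k => unitHom k m (tupleSingle k (p + 1) σ)) (blowUpHom k m θ) θ where
  maps p q h := by
    refine unitOf_mul_blowUp fun i j hij => ?_
    have : p = i ↔ q = j := by
      constructor
      · rintro rfl; exact h.right_unique hij
      · rintro rfl; exact h.left_unique hij
    rw [tupleSingle_succ, tupleSingle_succ, Pi.inv_apply, Pi.inv_apply, Pi.mulSingle_apply,
      Pi.mulSingle_apply]
    simp only [eq_comm (b := p), eq_comm (b := q), this]
  not_dom p h := by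
    have : unitHom k m (tupleSingle k (p + 1) σ) * blowUpHom k m θ =
        blowUpHom k m θ * unitHom k m 1 := by
      refine unitOf_mul_blowUp fun i j hij => ?_
      have hne : i ≠ p := by rintro rfl; exact h j hij
      rw [tupleSingle_succ, Pi.inv_apply, Pi.mulSingle_eq_of_ne hne]
      rfl
    rw [this, map_one, mul_one]
  not_im q h := by
    have : unitHom k m 1 * blowUpHom k m θ =
        blowUpHom k m θ * unitHom k m (tupleSingle k (q + 1) σ) := by
      refine unitOf_mul_blowUp fun i j hij => ?_
      have hne : j ≠ q := by rintro rfl; exact h i hij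
      rw [tupleSingle_succ, Pi.inv_apply _ j, Pi.mulSingle_eq_of_ne hne]
      rfl
    rw [← this, map_one, one_mul]

end UnitsAndBlowUps

/-! ### The relations `W` hold on the chain of indices -/

section ChainSoundness

variable {n : ℕ}

/-- A partial permutation of the chain as a total function on `{0, 1, …, n + 1}`: the points of the
chain are numbered from `1`, and `0` is the value at the points outside the domain. -/
def evalNat (α : PartialPerm (Fin (n + 1))) (a : ℕ) : ℕ :=
  if h : 1 ≤ a ∧ a ≤ n + 1 then (PEquiv.toFun α ⟨a - 1, by omega⟩).elim 0 (fun b => b + 1) else 0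

theorem evalNat_zero (α : PartialPerm (Fin (n + 1))) : evalNat α 0 = 0 := dif_neg (by omega)

theorem evalNat_eq_succ {α : PartialPerm (Fin (n + 1))} {a b : ℕ} (ha : a < n + 1)
    (hb : b < n + 1) (h : Maps α ⟨a, ha⟩ ⟨b, hb⟩) : evalNat α (a + 1) = b + 1 := by
  rw [evalNat, dif_pos (by omega)]
  simp only [Nat.add_sub_cancel]
  rw [show PEquiv.toFun α ⟨a, ha⟩ = some ⟨b, hb⟩ from h]
  rfl

theorem evalNat_eq_zero {α : PartialPerm (Fin (n + 1))} {a : ℕ} (ha : a < n + 1)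
    (h : ∀ b : Fin (n + 1), ¬ Maps α ⟨a, ha⟩ b) : evalNat α (a + 1) = 0 := by
  rw [evalNat, dif_pos (by omega)]
  simp only [Nat.add_sub_cancel]
  rw [show PEquiv.toFun α ⟨a, ha⟩ = none from Option.eq_none_iff_forall_not_mem.2 h]
  rfl

theorem maps_of_evalNat {α : PartialPerm (Fin (n + 1))} {p q : Fin (n + 1)}
    (h : evalNat α (p + 1) = q + 1) : Maps α p q := by
  by_cases hp : ∃ r, Maps α p r
  · obtain ⟨r, hr⟩ := hp
    rw [evalNat_eq_succ p.2 r.2 hr] at h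
    rwa [show q = r from Fin.ext (by omega)]
  · rw [evalNat_eq_zero p.2 (not_exists.1 hp)] at h
    omega

theorem ext_evalNat {α β : PartialPerm (Fin (n + 1))}
    (h : ∀ a, a ≤ n + 1 → evalNat α a = evalNat β a) : α = β := by
  refine partialPerm_ext fun p q => ⟨fun hm => ?_, fun hm => ?_⟩
  · exact maps_of_evalNat (by rw [← h _ (by omega), evalNat_eq_succ p.2 q.2 hm])
  · exact maps_of_evalNat (by rw [h _ (by omega), evalNat_eq_succ p.2 q.2 hm])

theorem evalNat_mul (α β : PartialPerm (Fin (n + 1))) (a : ℕ) :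
    evalNat (α * β) a = evalNat β (evalNat α a) := by
  by_cases h : 1 ≤ a ∧ a ≤ n + 1
  · obtain ⟨a, rfl⟩ : ∃ c, a = c + 1 := ⟨a - 1, by omega⟩
    have ha : a < n + 1 := by omega
    by_cases hp : ∃ r, Maps α ⟨a, ha⟩ r
    · obtain ⟨r, hr⟩ := hp
      rw [evalNat_eq_succ ha r.2 hr]
      by_cases hq : ∃ t, Maps β r t
      · obtain ⟨t, ht⟩ := hq
        rw [evalNat_eq_succ r.2 t.2 ht, evalNat_eq_succ ha t.2 (maps_mul.2 ⟨r, hr, ht⟩)]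
      · rw [evalNat_eq_zero r.2 (not_exists.1 hq), evalNat_eq_zero ha]
        intro b hb
        obtain ⟨r', h1, h2⟩ := maps_mul.1 hb
        exact hq ⟨b, by rwa [hr.right_unique h1]⟩
    · rw [evalNat_eq_zero ha (not_exists.1 hp), evalNat_zero, evalNat_eq_zero ha]
      intro b hb
      obtain ⟨r', h1, h2⟩ := maps_mul.1 hb
      exact hp ⟨r', h1⟩
  · have e : ∀ γ : PartialPerm (Fin (n + 1)), evalNat γ a = 0 := fun γ => dif_neg h
    rw [e, e, evalNat_zero]

/-- The generators of the monoid of order preserving partial permutations of a chain. -/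
def chainGen (n i : ℕ) : PartialPerm (Fin (n + 1)) :=
  if h : i < n + 1 then xSmall (n + 1) ⟨i, h⟩ else 1

theorem chainGen_val (i : Fin (n + 1)) : chainGen n i = xSmall (n + 1) i := dif_pos i.2

theorem evalNat_chainGen_zero {a : ℕ} (ha : a ≤ n + 1) : evalNat (chainGen n 0) a = a - 1 := by
  rw [chainGen, dif_pos (Nat.succ_pos n)]
  rcases Nat.eq_zero_or_pos a with rfl | h
  · exact evalNat_zero _
  · obtain ⟨c, rfl⟩ : ∃ c, a = c + 1 := ⟨a - 1, by omega⟩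
    rcases Nat.eq_zero_or_pos c with rfl | h'
    · refine evalNat_eq_zero (by omega) fun b hb => ?_
      rw [maps_xSmall_zero rfl] at hb
      simp only at hb
      omega
    · obtain ⟨b, rfl⟩ : ∃ b, c = b + 1 := ⟨c - 1, by omega⟩
      exact evalNat_eq_succ (by omega) (by omega) ((maps_xSmall_zero rfl).2 rfl)

/-- The values are given as a disjunction of linear conditions, so that compositions can be decided
by `omega`. -/
theorem evalNat_chainGen_pos {p a : ℕ} (hp : p < n) (ha : a ≤ n + 1) :
    (a = p + 1 ∧ evalNat (chainGen n (n - p)) a = p + 2) ∨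
      (a = p + 2 ∧ evalNat (chainGen n (n - p)) a = 0) ∨
      (a ≠ p + 1 ∧ a ≠ p + 2 ∧ evalNat (chainGen n (n - p)) a = a) := by
  rw [chainGen, dif_pos (by omega)]
  rcases Nat.eq_zero_or_pos a with rfl | h
  · exact Or.inr (Or.inr ⟨by omega, by omega, evalNat_zero _⟩)
  obtain ⟨c, rfl⟩ : ∃ c, a = c + 1 := ⟨a - 1, by omega⟩
  have H := fun a b => maps_xSmall_pos (i := (⟨n - p, by omega⟩ : Fin (n + 1))) (j := p) (p := a)
    (q := b) (by simp only; omega) (by simp only; omega)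
  by_cases h1 : c = p
  · exact Or.inl ⟨by omega,
      evalNat_eq_succ (by omega) (show p + 1 < n + 1 by omega) ((H _ _).2 (Or.inl ⟨h1, rfl⟩))⟩
  by_cases h2 : c = p + 1
  · refine Or.inr (Or.inl ⟨by omega, evalNat_eq_zero (by omega) fun b hb => ?_⟩)
    rw [H, Fin.ext_iff] at hb
    simp only at hb
    omega
  · exact Or.inr (Or.inr ⟨by omega, by omega,
      evalNat_eq_succ (by omega) (by omega) ((H _ _).2 (Or.inr ⟨h1, h2, rfl⟩))⟩)

theorem evalNat_descRun {i j : ℕ} (hij : i ≤ j) (hj : j ≤ n) {a : ℕ} (ha : a ≤ n + 1) :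
    (i < a ∧ a ≤ j ∧ evalNat (descRun (fun p => chainGen n (n - p)) i j) a = a + 1) ∨
      (a = j + 1 ∧ i < j ∧ evalNat (descRun (fun p => chainGen n (n - p)) i j) a = 0) ∨
      ((a ≤ i ∨ j + 1 < a ∨ i = j) ∧
        evalNat (descRun (fun p => chainGen n (n - p)) i j) a = a) := by
  induction j, hij using Nat.le_induction generalizing a with
  | base =>
    rw [descRun_self]
    refine Or.inr (Or.inr ⟨Or.inr (Or.inr rfl), ?_⟩)
    rcases Nat.eq_zero_or_pos a with rfl | h
    · exact evalNat_zero _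
    · obtain ⟨c, rfl⟩ : ∃ c, a = c + 1 := ⟨a - 1, by omega⟩
      exact evalNat_eq_succ (by omega) (by omega) (maps_one.2 rfl)
  | succ j hij ih =>
    rw [descRun_succ _ hij, evalNat_mul]
    have h1 := evalNat_chainGen_pos (p := j) (by omega) ha
    generalize evalNat (chainGen n (n - j)) a = b at h1 ⊢
    have h2 := ih (by omega) (show b ≤ n + 1 by omega)
    omega

/-- Each relation is checked by following one point through both sides. Every intermediate value has
a name and a linear description, and the undefined value `0` is fixed by all generators. -/
theorem isShiftMoveSystem_chainGen (hn : 1 ≤ n) :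
    IsShiftMoveSystem n (chainGen n 0) fun p => chainGen n (n - p) := by
  have shift : ∀ a, a ≤ n + 1 → ∃ b, evalNat (chainGen n 0) a = b ∧ b = a - 1 :=
    fun a ha => ⟨_, rfl, evalNat_chainGen_zero ha⟩
  have move : ∀ p, p < n → ∀ a, a ≤ n + 1 → ∃ b, evalNat (chainGen n (n - p)) a = b ∧
      ((a = p + 1 ∧ b = p + 2) ∨ (a = p + 2 ∧ b = 0) ∨ (a ≠ p + 1 ∧ a ≠ p + 2 ∧ b = a)) :=
    fun p hp a ha => ⟨_, rfl, evalNat_chainGen_pos hp ha⟩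
  have run : ∀ i j, i ≤ j → j ≤ n → ∀ a, a ≤ n + 1 →
      ∃ b, evalNat (descRun (fun p => chainGen n (n - p)) i j) a = b ∧
        ((i < a ∧ a ≤ j ∧ b = a + 1) ∨ (a = j + 1 ∧ i < j ∧ b = 0) ∨
          ((a ≤ i ∨ j + 1 < a ∨ i = j) ∧ b = a)) :=
    fun i j hij hj a ha => ⟨_, rfl, evalNat_descRun hij hj ha⟩
  constructor
  · intro p q h1 h2
    refine ext_evalNat fun a ha => ?_
    obtain ⟨b, e1, hb⟩ := move p (by omega) a ha
    obtain ⟨c, e2, hc⟩ := move q h2 b (by omega)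
    obtain ⟨b', e3, hb'⟩ := move q h2 a ha
    obtain ⟨c', e4, hc'⟩ := move p (by omega) b' (by omega)
    rw [evalNat_mul, evalNat_mul, e1, e2, e3, e4]
    omega
  · intro p hp
    refine ext_evalNat fun a ha => ?_
    obtain ⟨b, e1, hb⟩ := move p (by omega) a ha
    obtain ⟨c, e2, hc⟩ := move (p + 1) hp b (by omega)
    obtain ⟨e, e3, he⟩ := move p (by omega) c (by omega)
    rw [evalNat_mul, evalNat_mul, e1, e2, e3]
    omega
  · intro p hp
    refine ext_evalNat fun a ha => ?_
    obtain ⟨b, e1, hb⟩ := move p (by omega) a ha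
    obtain ⟨c, e2, hc⟩ := move (p + 1) hp b (by omega)
    obtain ⟨b', e3, hb'⟩ := move (p + 1) hp a ha
    obtain ⟨c', e4, hc'⟩ := move p (by omega) b' (by omega)
    obtain ⟨e', e5, he'⟩ := move (p + 1) hp c' (by omega)
    rw [evalNat_mul, evalNat_mul, evalNat_mul, e3, e4, e5, e1, e2]
    omega
  · intro p hp
    refine ext_evalNat fun a ha => ?_
    obtain ⟨b, e1, hb⟩ := move (p + 1) hp a ha
    obtain ⟨c, e2, hc⟩ := shift b (by omega)
    obtain ⟨b', e3, hb'⟩ := shift a ha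
    obtain ⟨c', e4, hc'⟩ := move p (by omega) b' (by omega)
    rw [evalNat_mul, evalNat_mul, e1, e2, e3, e4]
    omega
  · refine ext_evalNat fun a ha => ?_
    obtain ⟨b, e1, hb⟩ := shift a ha
    obtain ⟨c, e2, hc⟩ := shift b (by omega)
    obtain ⟨e, e3, he⟩ := move (n - 1) (by omega) c (by omega)
    rw [evalNat_mul, evalNat_mul, e1, e2, e3]
    omega
  · refine ext_evalNat fun a ha => ?_
    obtain ⟨b, e1, hb⟩ := move 0 (by omega) a ha
    obtain ⟨c, e2, hc⟩ := shift b (by omega)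
    obtain ⟨e, e3, he⟩ := shift c (by omega)
    obtain ⟨b', e4, hb'⟩ := shift a ha
    obtain ⟨c', e5, hc'⟩ := shift b' (by omega)
    simp only [evalNat_mul, e1, e2, e3, e4, e5]
    omega
  · refine ext_evalNat fun a ha => ?_
    obtain ⟨b, e1, hb⟩ := shift a ha
    obtain ⟨c, e2, hc⟩ := run 0 n (by omega) le_rfl b (by omega)
    obtain ⟨e, e3, he⟩ := shift c (by omega)
    rw [evalNat_mul, evalNat_mul, e1, e2, e3]
    omega
  · intro p hp
    refine ext_evalNat fun a ha => ?_
    obtain ⟨b, e1, hb⟩ := run 0 (p + 1) (by omega) hp a ha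
    obtain ⟨c, e2, hc⟩ := shift b (by omega)
    obtain ⟨e, e3, he⟩ := run (p + 1) n hp le_rfl c (by omega)
    obtain ⟨f, e4, hf⟩ := move p hp e (by omega)
    obtain ⟨f', e5, hf'⟩ := move p hp a ha
    rw [evalNat_mul, evalNat_mul, evalNat_mul, e1, e2, e3, e4, e5]
    omega
  · intro p hp
    refine ext_evalNat fun a ha => ?_
    obtain ⟨b, e1, hb⟩ := run 0 p (by omega) hp.le a ha
    obtain ⟨c, e2, hc⟩ := shift b (by omega)
    obtain ⟨e, e3, he⟩ := run (p + 1) n hp le_rfl c (by omega)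
    obtain ⟨f, e4, hf⟩ := move p hp e (by omega)
    obtain ⟨g, e5, hg⟩ := move p hp f (by omega)
    obtain ⟨f', e6, hf'⟩ := move p hp a ha
    obtain ⟨g', e7, hg'⟩ := move p hp f' (by omega)
    simp only [evalNat_mul, e1, e2, e3, e4, e5, e6, e7]
    omega

theorem IsShiftMoveSystem.map {M N : Type*} [Monoid M] [Monoid N] (f : M →* N) {s : M}
    {y : ℕ → M} (H : IsShiftMoveSystem n s y) :
    IsShiftMoveSystem n (f s) fun p => f (y p) where
  far p q h1 h2 := (H.far p q h1 h2).map f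
  absorb p hp := by simpa using congrArg f (H.absorb p hp)
  absorb' p hp := by simpa using congrArg f (H.absorb' p hp)
  move_shift p hp := by simpa using congrArg f (H.move_shift p hp)
  sq_mul := by simpa using congrArg f H.sq_mul
  mul_sq := by simpa using congrArg f H.mul_sq
  shift_regular := by simpa [map_descRun] using congrArg f H.shift_regular
  regular p hp := by simpa [map_descRun] using congrArg f (H.regular p hp)
  sq_regular p hp := by simpa [map_descRun] using congrArg f (H.sq_regular p hp)

end ChainSoundness

/-! ### The generators satisfy all the relations -/

section Soundness

variable {k m : ℕ}

/-- The interpretation of the letters. -/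
def genMap (k m : ℕ) : Letter k → PartialPerm (Fin (k * m))
  | Letter.d i => dBar k m i
  | Letter.x i => xBar k m i

theorem lift_genMap_d (i : ℕ) :
    FreeMonoid.lift (genMap k m) (d k i) = unitHom k m (invTupleD k m i) := by
  rw [d, invTupleD]
  split_ifs with h
  · rw [FreeMonoid.lift_eval_of]
    change unitOf _ = unitOf _
    rw [inv_inv]
  · rw [map_one, map_one]

theorem lift_genMap_x {n : ℕ} (i : ℕ) :
    FreeMonoid.lift (genMap (n + 1) m) (x (n + 1) i) = blowUpHom (n + 1) m (chainGen n i) := by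
  rw [x, chainGen]
  split_ifs with h
  · rw [FreeMonoid.lift_eval_of]
    rfl
  · rw [map_one, map_one]

theorem transElt_map {M N : Type*} [Monoid M] [Monoid N] (f : M →* N) (δ : ℕ → M) (i : ℕ) :
    transElt k m (fun j => f (δ j)) i = f (transElt k m δ i) := by
  simp [transElt]

/-- The generators satisfy the relations. -/
theorem lift_genMap_eq_of_rels (hk : 2 ≤ k) (hm : 2 ≤ m) {u v : FreeMonoid (Letter k)}
    (h : Rels k m u v) :
    FreeMonoid.lift (genMap k m) u = FreeMonoid.lift (genMap k m) v := by
  obtain ⟨n, rfl⟩ : ∃ n, k = n + 1 := ⟨k - 1, by omega⟩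
  obtain ⟨hU, hA, hB⟩ := isUnitSystem_invTupleD hk hm
  rcases h with h | h | h
  · refine V_of_isUnitSystem _ hk ?_ h
    simp only [lift_genMap_d]
    exact hU.map (unitHom (n + 1) m)
  · refine (W_iff_isShiftMoveSystem (by omega) _).2 ?_ u v h
    simp only [lift_genMap_x]
    exact (isShiftMoveSystem_chainGen (by omega)).map _
  · refine V'_of_intertwines _ hk (fun i => ?_) (fun i => ?_) h
    · simp only [lift_genMap_d, lift_genMap_x, transElt_map, chainGen_val]
      have : ∀ p : Fin (n + 1), transElt (n + 1) m (invTupleD (n + 1) m) (p + 1) =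
          tupleSingle (n + 1) (p + 1) (transA m) := fun p => hA _ (by omega) (by omega)
      simp only [this]
      exact intertwines_blowUp _ _
    · simp only [lift_genMap_d, lift_genMap_x, chainGen_val, ← map_pow]
      have : ∀ p : Fin (n + 1), invTupleD (n + 1) m (p + 1) ^ (m - 1) ^ 2 =
          tupleSingle (n + 1) (p + 1) (cycB m)⁻¹ := fun p => hB _ (by omega) (by omega)
      simp only [this]
      exact intertwines_blowUp _ _

end Soundness

/-! ### The `x_i` generate the order preserving partial permutations of the chain -/

section ChainGeneration

variable {n : ℕ}

/-- Preservation of the order of the chain by a partial permutation. -/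
def IsOrderPreserving {k : ℕ} (θ : PartialPerm (Fin k)) : Prop :=
  ∀ p p' q q', Maps θ p q → Maps θ p' q' → p ≤ p' → q ≤ q'

theorem maps_iff_evalNat {θ : PartialPerm (Fin (n + 1))} {p q : Fin (n + 1)} :
    Maps θ p q ↔ evalNat θ (p + 1) = q + 1 :=
  ⟨fun h => evalNat_eq_succ p.2 q.2 h, maps_of_evalNat⟩

theorem evalNat_le (θ : PartialPerm (Fin (n + 1))) (a : ℕ) : evalNat θ a ≤ n + 1 := by
  by_cases h : 1 ≤ a ∧ a ≤ n + 1
  · obtain ⟨c, rfl⟩ : ∃ c, a = c + 1 := ⟨a - 1, by omega⟩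
    by_cases hp : ∃ r, Maps θ ⟨c, by omega⟩ r
    · obtain ⟨r, hr⟩ := hp
      rw [evalNat_eq_succ (by omega) r.2 hr]
      omega
    · rw [evalNat_eq_zero (by omega) (not_exists.1 hp)]
      omega
  · rw [evalNat, dif_neg h]
    omega

theorem le_of_evalNat_ne_zero {θ : PartialPerm (Fin (n + 1))} {a : ℕ} (h : evalNat θ a ≠ 0) :
    1 ≤ a ∧ a ≤ n + 1 := by
  by_contra hc
  exact h (dif_neg hc)

theorem maps_of_evalNat_ne_zero {θ : PartialPerm (Fin (n + 1))} {a : ℕ} (h : evalNat θ a ≠ 0) :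
    ∃ p q : Fin (n + 1), a = p + 1 ∧ evalNat θ a = q + 1 ∧ Maps θ p q := by
  have h1 := le_of_evalNat_ne_zero h
  have h2 := evalNat_le θ a
  refine ⟨⟨a - 1, by omega⟩, ⟨evalNat θ a - 1, by omega⟩, by simp only; omega, by simp only; omega,
    maps_iff_evalNat.2 ?_⟩
  simp only
  rw [Nat.sub_add_cancel h1.1]
  omega

theorem IsOrderPreserving.evalNat_le_evalNat {θ : PartialPerm (Fin (n + 1))}
    (hθ : IsOrderPreserving θ) {a a' : ℕ} (h : evalNat θ a ≠ 0) (h' : evalNat θ a' ≠ 0)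
    (haa : a ≤ a') : evalNat θ a ≤ evalNat θ a' := by
  obtain ⟨p, q, h1, h2, h3⟩ := maps_of_evalNat_ne_zero h
  obtain ⟨p', q', h1', h2', h3'⟩ := maps_of_evalNat_ne_zero h'
  have := Fin.le_def.1 (hθ p p' q q' h3 h3' (Fin.le_def.2 (by omega)))
  omega

theorem evalNat_inj {θ : PartialPerm (Fin (n + 1))} {a a' : ℕ} (h : evalNat θ a ≠ 0)
    (e : evalNat θ a = evalNat θ a') : a = a' := by
  obtain ⟨p, q, h1, h2, h3⟩ := maps_of_evalNat_ne_zero h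
  obtain ⟨p', q', h1', h2', h3'⟩ := maps_of_evalNat_ne_zero (e ▸ h)
  have : q = q' := Fin.ext (by omega)
  subst this
  rw [h1, h1', h3.left_unique h3']

theorem isOrderPreserving_of_evalNat {θ : PartialPerm (Fin (n + 1))}
    (h : ∀ a a', evalNat θ a ≠ 0 → evalNat θ a' ≠ 0 → a < a' → evalNat θ a ≤ evalNat θ a') :
    IsOrderPreserving θ := by
  intro p p' q q' h1 h2 hp
  rw [maps_iff_evalNat] at h1 h2
  rcases hp.eq_or_lt with rfl | hlt
  · exact Fin.le_def.2 (by omega)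
  · have := h (p + 1) (p' + 1) (by omega) (by omega) (by have := Fin.lt_def.1 hlt; omega)
    exact Fin.le_def.2 (by omega)

/-- The submonoid generated by the `x_i` on the chain. -/
def chainClosure (k : ℕ) : Submonoid (PartialPerm (Fin k)) :=
  Submonoid.closure (Set.range (xSmall k))

theorem chainGen_mem (i : ℕ) : chainGen n i ∈ chainClosure (n + 1) := by
  rw [chainGen]
  split_ifs with h
  · exact Submonoid.subset_closure ⟨_, rfl⟩
  · exact one_mem _

theorem descRun_mem {M : Type*} [Monoid M] {S : Submonoid M} {y : ℕ → M} (h : ∀ p, y p ∈ S)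
    (i j : ℕ) : descRun y i j ∈ S := by
  induction j with
  | zero => exact one_mem _
  | succ j ih =>
    rw [descRun]
    split_ifs
    · exact mul_mem (h j) ih
    · exact one_mem _

theorem exists_mem_evalNat_moveInv {p : ℕ} (hp : p < n) :
    ∃ w ∈ chainClosure (n + 1), ∀ a, a ≤ n + 1 →
      (a = p + 2 ∧ evalNat w a = p + 1) ∨ (a = p + 1 ∧ evalNat w a = 0) ∨
        (a ≠ p + 1 ∧ a ≠ p + 2 ∧ evalNat w a = a) := by
  refine ⟨moveInv n (chainGen n 0) (fun p => chainGen n (n - p)) p,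
    mul_mem (mul_mem (descRun_mem (fun _ => chainGen_mem _) _ _) (chainGen_mem _))
      (descRun_mem (fun _ => chainGen_mem _) _ _), fun a ha => ?_⟩
  rw [moveInv, evalNat_mul, evalNat_mul]
  have h1 := evalNat_descRun (n := n) (Nat.zero_le p) hp.le ha
  generalize evalNat (descRun _ 0 p) a = b at h1 ⊢
  rw [evalNat_chainGen_zero (by omega)]
  have h2 := evalNat_descRun (n := n) (i := p + 1) hp le_rfl (show b - 1 ≤ n + 1 by omega)
  omega

theorem exists_mem_evalNat_omitPoint {q : ℕ} (hq : q ≤ n) :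
    ∃ w ∈ chainClosure (n + 1), ∀ a, a ≤ n + 1 →
      (a = q + 1 ∧ evalNat w a = 0) ∨ (a ≠ q + 1 ∧ evalNat w a = a) := by
  refine ⟨omitPoint n (chainGen n 0) (fun p => chainGen n (n - p)) q,
    mul_mem (mul_mem (descRun_mem (fun _ => chainGen_mem _) _ _) (chainGen_mem _))
      (descRun_mem (fun _ => chainGen_mem _) _ _), fun a ha => ?_⟩
  rw [omitPoint, evalNat_mul, evalNat_mul]
  have h1 := evalNat_descRun (n := n) (Nat.zero_le q) hq ha
  generalize evalNat (descRun _ 0 q) a = b at h1 ⊢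
  rw [evalNat_chainGen_zero (by omega)]
  have h2 := evalNat_descRun (n := n) hq le_rfl (show b - 1 ≤ n + 1 by omega)
  omega

/-- The undefined points are omitted one after the other; `j` counts the points already treated. -/
theorem mem_chainClosure_of_partialId {θ : PartialPerm (Fin (n + 1))}
    (h : ∀ a, evalNat θ a = 0 ∨ evalNat θ a = a) : θ ∈ chainClosure (n + 1) := by
  have key : ∀ j, j ≤ n + 1 → ∃ w ∈ chainClosure (n + 1), ∀ a, a ≤ n + 1 →
      evalNat w a = if a ≤ j then evalNat θ a else a := by
    intro j
    induction j with
    | zero =>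
      refine fun _ => ⟨1, one_mem _, fun a ha => ?_⟩
      rcases Nat.eq_zero_or_pos a with rfl | h0
      · rw [if_pos le_rfl, evalNat_zero, evalNat_zero]
      · obtain ⟨c, rfl⟩ : ∃ c, a = c + 1 := ⟨a - 1, by omega⟩
        rw [if_neg (by omega)]
        exact evalNat_eq_succ (by omega) (by omega) (maps_one.2 rfl)
    | succ j ih =>
      intro hj
      obtain ⟨w, hw, hwa⟩ := ih (by omega)
      rcases h (j + 1) with h0 | h1
      · obtain ⟨e, he, hea⟩ := exists_mem_evalNat_omitPoint (n := n) (q := j) (by omega)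
        refine ⟨w * e, mul_mem hw he, fun a ha => ?_⟩
        have h3 := hea (evalNat w a) (evalNat_le _ _)
        have h4 := h a
        rw [evalNat_mul]
        rw [hwa a ha] at h3 ⊢
        by_cases haj : a = j + 1
        · subst haj
          rw [if_neg (by omega)] at h3 ⊢
          rw [if_pos le_rfl]
          omega
        · split_ifs at h3 ⊢ <;> omega
      · refine ⟨w, hw, fun a ha => ?_⟩
        rw [hwa a ha]
        by_cases haj : a = j + 1
        · subst haj
          rw [if_neg (by omega), if_pos le_rfl, h1]
        · split_ifs <;> omega
  obtain ⟨w, hw, hwa⟩ := key (n + 1) le_rfl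
  have : θ = w := ext_evalNat fun a ha => by rw [hwa a ha, if_pos ha]
  rwa [this]

/-- The total distance by which a partial permutation of the chain moves the points. -/
def displacement (θ : PartialPerm (Fin (n + 1))) : ℕ :=
  ∑ a ∈ Finset.range (n + 2), if evalNat θ a = 0 then 0 else
    (evalNat θ a - a) + (a - evalNat θ a)

theorem displacement_lt {θ θ' : PartialPerm (Fin (n + 1))} {a : ℕ} (ha : a ≤ n + 1)
    (h0 : evalNat θ a ≠ 0)
    (h : (evalNat θ a > a ∧ evalNat θ' a + 1 = evalNat θ a) ∨
      (evalNat θ a < a ∧ evalNat θ' a = evalNat θ a + 1))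
    (hne : ∀ b, b ≤ n + 1 → b ≠ a → evalNat θ' b = evalNat θ b) :
    displacement θ' < displacement θ := by
  apply Finset.sum_lt_sum
  · intro b hb
    have := Finset.mem_range.1 hb
    by_cases hba : b = a
    · subst hba
      split_ifs <;> omega
    · rw [hne b (by omega) hba]
  · refine ⟨a, Finset.mem_range.2 (by omega), ?_⟩
    rw [if_neg h0]
    split_ifs <;> omega

/-- The order preserving partial permutations of the chain are products of the `x_i`. -/
theorem IsOrderPreserving.mem_chainClosure {θ : PartialPerm (Fin (n + 1))}
    (hθ : IsOrderPreserving θ) : θ ∈ chainClosure (n + 1) := by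
  classical
  induction hN : displacement θ using Nat.strong_induction_on generalizing θ with
  | _ N ih =>
    -- Let `a` be the least point that moves up, with value `p + 2`. The value `p + 1` is free: a
    -- point `b` taking it would precede `a` and so satisfy `p + 1 ≤ b < a < p + 2`. Lowering the
    -- value of `a` to `p + 1` reduces the displacement, and the generator that moves `p + 1` to `p
    -- + 2` restores `θ`.
    by_cases hup : ∃ a, evalNat θ a > a
    · let a := Nat.find hup
      have ha : evalNat θ a > a := Nat.find_spec hup
      have hmin : ∀ b, b < a → evalNat θ b ≤ b := fun b hb => not_lt.1 (Nat.find_min hup hb)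
      have h0 : evalNat θ a ≠ 0 := by omega
      have hb := le_of_evalNat_ne_zero h0
      have hle := evalNat_le θ a
      obtain ⟨p, hp⟩ : ∃ p, evalNat θ a = p + 2 := ⟨evalNat θ a - 2, by omega⟩
      have hnot : ∀ b, evalNat θ b ≠ p + 1 := by
        intro b hb'
        have h1 : b < a := by
          by_contra hc
          have := hθ.evalNat_le_evalNat h0 (show evalNat θ b ≠ 0 by omega) (not_lt.1 hc)
          omega
        have := hmin b h1
        omega
      obtain ⟨w, hw, hwa⟩ := exists_mem_evalNat_moveInv (n := n) (p := p) (by omega)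
      have hev : ∀ b, b ≤ n + 1 → b ≠ a → evalNat (θ * w) b = evalNat θ b := by
        intro b _ hba
        rw [evalNat_mul]
        have h1 := hwa (evalNat θ b) (evalNat_le _ _)
        have h2 := hnot b
        have h3 : evalNat θ b ≠ p + 2 := fun h => hba (evalNat_inj h0 (by omega)).symm
        omega
      have hea : evalNat (θ * w) a = p + 1 := by
        rw [evalNat_mul]
        have h1 := hwa (evalNat θ a) (evalNat_le _ _)
        omega
      have hop : IsOrderPreserving (θ * w) := by
        refine isOrderPreserving_of_evalNat fun b c hb0 hc0 hbc => ?_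
        have hb1 := le_of_evalNat_ne_zero hb0
        have hc1 := le_of_evalNat_ne_zero hc0
        by_cases hba : b = a
        · have hca : c ≠ a := by omega
          rw [hev c hc1.2 hca] at hc0 ⊢
          have := hθ.evalNat_le_evalNat h0 hc0 (by omega)
          rw [hba]
          omega
        · rw [hev b hb1.2 hba] at hb0 ⊢
          by_cases hca : c = a
          · have h1 := hθ.evalNat_le_evalNat hb0 h0 (by omega)
            have h3 : evalNat θ b ≠ p + 2 := fun h => hba (evalNat_inj h0 (by omega)).symm
            rw [hca]
            omega
          · rw [hev c hc1.2 hca] at hc0 ⊢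
            exact hθ.evalNat_le_evalNat hb0 hc0 hbc.le
      have hback : θ = θ * w * chainGen n (n - p) := by
        refine ext_evalNat fun b hb' => ?_
        rw [evalNat_mul _ (chainGen n (n - p))]
        have h1 := evalNat_chainGen_pos (n := n) (p := p) (by omega) (evalNat_le (θ * w) b)
        by_cases hba : b = a
        · rw [hba] at h1 ⊢
          omega
        · have h2 := hnot b
          have h3 : evalNat θ b ≠ p + 2 := fun h => hba (evalNat_inj h0 (by omega)).symm
          rw [hev b hb' hba] at h1 ⊢
          omega
      rw [hback]
      exact mul_mem (ih _ (hN ▸ displacement_lt hb.2 h0 (Or.inl ⟨ha, by omega⟩) hev) hop rfl)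
        (chainGen_mem _)
    · push Not at hup
      -- The mirror image: the greatest point that moves down has its value raised by a generator,
      -- and the inverse move restores `θ`. If no point moves either way, `θ` is a partial identity.
      by_cases hdown : ∃ a, evalNat θ a ≠ 0 ∧ evalNat θ a < a
      · obtain ⟨a, ⟨h0, ha⟩, hmax⟩ : ∃ a, (evalNat θ a ≠ 0 ∧ evalNat θ a < a) ∧
            ∀ b, evalNat θ b ≠ 0 ∧ evalNat θ b < b → b ≤ a := by
          have hs : ((Finset.range (n + 2)).filter fun a =>
              evalNat θ a ≠ 0 ∧ evalNat θ a < a).Nonempty := by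
            obtain ⟨a, ha⟩ := hdown
            have := le_of_evalNat_ne_zero ha.1
            exact ⟨a, Finset.mem_filter.2 ⟨Finset.mem_range.2 (by omega), ha⟩⟩
          refine ⟨_, (Finset.mem_filter.1 (Finset.max'_mem _ hs)).2, fun b hb => ?_⟩
          have := le_of_evalNat_ne_zero hb.1
          exact Finset.le_max' _ _ (Finset.mem_filter.2 ⟨Finset.mem_range.2 (by omega), hb⟩)
        have hb := le_of_evalNat_ne_zero h0
        obtain ⟨p, hp⟩ : ∃ p, evalNat θ a = p + 1 := ⟨evalNat θ a - 1, by omega⟩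
        have hnot : ∀ b, evalNat θ b ≠ p + 2 := by
          intro b hb'
          have h1 : a < b := by
            by_contra hc
            have := hθ.evalNat_le_evalNat (show evalNat θ b ≠ 0 by omega) h0 (not_lt.1 hc)
            omega
          have h2 : ¬ evalNat θ b < b := fun h => by
            have := hmax b ⟨by omega, h⟩
            omega
          omega
        obtain ⟨w, hw, hwa⟩ := exists_mem_evalNat_moveInv (n := n) (p := p) (by omega)
        have hga := fun b => evalNat_chainGen_pos (n := n) (p := p) (by omega) (evalNat_le θ b)
        have hev : ∀ b, b ≤ n + 1 → b ≠ a →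
            evalNat (θ * chainGen n (n - p)) b = evalNat θ b := by
          intro b _ hba
          rw [evalNat_mul]
          have h1 := hga b
          have h2 := hnot b
          have h3 : evalNat θ b ≠ p + 1 := fun h => hba (evalNat_inj h0 (by omega)).symm
          omega
        have hea : evalNat (θ * chainGen n (n - p)) a = p + 2 := by
          rw [evalNat_mul]
          have h1 := hga a
          omega
        have hop : IsOrderPreserving (θ * chainGen n (n - p)) := by
          refine isOrderPreserving_of_evalNat fun b c hb0 hc0 hbc => ?_
          have hb1 := le_of_evalNat_ne_zero hb0
          have hc1 := le_of_evalNat_ne_zero hc0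
          by_cases hca : c = a
          · have hba : b ≠ a := by omega
            rw [hev b hb1.2 hba] at hb0 ⊢
            have := hθ.evalNat_le_evalNat hb0 h0 (by omega)
            rw [hca]
            omega
          · rw [hev c hc1.2 hca] at hc0 ⊢
            by_cases hba : b = a
            · have h1 := hθ.evalNat_le_evalNat h0 hc0 (by omega)
              have h3 : evalNat θ c ≠ p + 1 := fun h => hca (evalNat_inj h0 (by omega)).symm
              rw [hba]
              omega
            · rw [hev b hb1.2 hba] at hb0 ⊢
              exact hθ.evalNat_le_evalNat hb0 hc0 hbc.le
        have hback : θ = θ * chainGen n (n - p) * w := by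
          refine ext_evalNat fun b hb' => ?_
          rw [evalNat_mul _ w]
          have h1 := hwa _ (evalNat_le (θ * chainGen n (n - p)) b)
          by_cases hba : b = a
          · rw [hba] at h1 ⊢
            omega
          · have h2 := hnot b
            have h3 : evalNat θ b ≠ p + 1 := fun h => hba (evalNat_inj h0 (by omega)).symm
            rw [hev b hb' hba] at h1 ⊢
            omega
        rw [hback]
        exact mul_mem (ih _ (hN ▸ displacement_lt hb.2 h0 (Or.inr ⟨ha, by omega⟩) hev) hop rfl) hw
      · push Not at hdown
        refine mem_chainClosure_of_partialId fun a => ?_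
        by_cases h : evalNat θ a = 0
        · exact Or.inl h
        · exact Or.inr (le_antisymm (hup a) (hdown a h))

theorem isOrderPreserving_xSmall {k : ℕ} (i : Fin k) : IsOrderPreserving (xSmall k i) := by
  intro p p' q q' h1 h2 hp
  have hp := Fin.le_def.1 hp
  apply Fin.le_def.2
  by_cases hi : (i : ℕ) = 0
  · rw [maps_xSmall_zero hi] at h1 h2
    omega
  · obtain ⟨j, hj⟩ : ∃ j, (i : ℕ) + j + 1 = k := ⟨k - 1 - i, by omega⟩
    rw [maps_xSmall_pos hj hi, Fin.ext_iff] at h1 h2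
    omega

end ChainGeneration

/-! ### Elements of the monoid as units times blow-ups -/

section POIElements

variable {k m : ℕ}

theorem unitOf_mem_POI (z : Fin k → Perm (Fin m)) : unitOf z ∈ POI k m := by
  refine ⟨fun x y h => ⟨fun x' _ => ?_, ?_⟩, fun x x' y y' h h' hb => ?_⟩
  · exact ⟨finProdFinEquiv (x'.divNat, z x'.divNat x'.modNat),
      maps_unitOf.2 ⟨(divNat_finProd _ _).symm, (modNat_finProd _ _).symm⟩⟩
  · have h1 := (maps_unitOf.1 h).1
    ext y'
    constructor
    · rintro ⟨x', hx', hm⟩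
      exact ((maps_unitOf.1 hm).1.symm.trans hx').trans h1
    · intro hy
      have hy : y'.divNat = y.divNat := hy
      refine ⟨finProdFinEquiv (x.divNat, (z x.divNat).symm y'.modNat), divNat_finProd _ _,
        maps_unitOf.2 ⟨?_, ?_⟩⟩
      · rw [divNat_finProd, hy, h1]
      · rw [divNat_finProd, modNat_finProd, Equiv.apply_symm_apply]
  · change y.divNat ≤ y'.divNat
    rw [← (maps_unitOf.1 h).1, ← (maps_unitOf.1 h').1]
    exact hb

theorem blowUp_mem_POI {θ : PartialPerm (Fin k)} (hθ : IsOrderPreserving θ) :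
    blowUp m θ ∈ POI k m := by
  refine ⟨fun x y h => ⟨fun x' hx' => ?_, ?_⟩, fun x x' y y' h h' hb => ?_⟩
  · have hx' : x'.divNat = x.divNat := hx'
    refine ⟨finProdFinEquiv (y.divNat, x'.modNat), maps_blowUp.2 ⟨?_, (modNat_finProd _ _).symm⟩⟩
    rw [divNat_finProd, hx']
    exact (maps_blowUp.1 h).1
  · have h1 := (maps_blowUp.1 h).1
    ext y'
    constructor
    · rintro ⟨x', hx', hm⟩
      have hx' : x'.divNat = x.divNat := hx'
      have h2 := (maps_blowUp.1 hm).1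
      rw [hx'] at h2
      exact h2.right_unique h1
    · intro hy
      have hy : y'.divNat = y.divNat := hy
      refine ⟨finProdFinEquiv (x.divNat, y'.modNat), divNat_finProd _ _,
        maps_blowUp.2 ⟨?_, modNat_finProd _ _⟩⟩
      rw [divNat_finProd, hy]
      exact h1
  · exact hθ _ _ _ _ (maps_blowUp.1 h).1 (maps_blowUp.1 h').1 hb

/-- The partial permutation with a given graph. -/
theorem exists_partialPerm {Ω : Type*} (R : Ω → Ω → Prop)
    (h1 : ∀ x y y', R x y → R x y' → y = y') (h2 : ∀ x x' y, R x y → R x' y → x = x') :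
    ∃ θ : PartialPerm Ω, ∀ x y, Maps θ x y ↔ R x y := by
  classical
  have key : ∀ (S : Ω → Ω → Prop), (∀ x y y', S x y → S x y' → y = y') → ∀ x y,
      (y ∈ if h : ∃ z, S x z then some h.choose else none) ↔ S x y := by
    intro S hS x y
    split_ifs with h
    · rw [Option.mem_some]
      exact ⟨fun e => e ▸ h.choose_spec, fun e => hS x _ _ h.choose_spec e⟩
    · exact ⟨fun e => by simp at e, fun e => absurd ⟨y, e⟩ h⟩
  exact ⟨⟨fun x => if h : ∃ y, R x y then some h.choose else none,
    fun y => if h : ∃ x, R x y then some h.choose else none, fun x y =>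
      (key (fun y x => R x y) (fun y x x' => h2 x x' y) y x).trans (key R h1 x y).symm⟩, key R h1⟩

/-- Every element of the monoid is the product of a unit and a blow-up. -/
theorem exists_eq_unitOf_mul_blowUp {α : PartialPerm (Fin (k * m))} (hα : α ∈ POI k m) :
    ∃ (z : Fin k → Perm (Fin m)) (θ : PartialPerm (Fin k)), IsOrderPreserving θ ∧
      α = unitOf z * blowUp m θ := by
  classical
  obtain ⟨hs, ho⟩ := hα
  have func : ∀ x x' y y', Maps α x y → Maps α x' y' → x.divNat = x'.divNat →
      y.divNat = y'.divNat := by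
    intro x x' y y' h h' hd
    have : y ∈ {y'' | ∃ x'', x''.divNat = x'.divNat ∧ Maps α x'' y''} := ⟨x, hd, h⟩
    rw [(hs x' y' h').2] at this
    exact this
  have inj : ∀ x x' y y', Maps α x y → Maps α x' y' → y.divNat = y'.divNat →
      x.divNat = x'.divNat := by
    intro x x' y y' h h' hd
    have : y ∈ {y'' | y''.divNat = y'.divNat} := hd
    rw [← (hs x' y' h').2] at this
    obtain ⟨x'', h1, h2⟩ := this
    rw [h.left_unique h2]
    exact h1
  -- The map induced on blocks; stability makes it well defined and injective.
  obtain ⟨θ, hθ⟩ := exists_partialPerm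
    (fun i j : Fin k => ∃ x y, Maps α x y ∧ x.divNat = i ∧ y.divNat = j)
    (by
      rintro i j j' ⟨x, y, h, rfl, rfl⟩ ⟨x', y', h', hx, rfl⟩
      exact func _ _ _ _ h h' hx.symm)
    (by
      rintro i i' j ⟨x, y, h, rfl, rfl⟩ ⟨x', y', h', rfl, hy⟩
      exact inj _ _ _ _ h h' hy.symm)
  -- A block in the domain is mapped injectively into one block of the same finite size, hence by a
  -- permutation. Outside the domain any choice will do, and the identity is taken.
  have perm : ∀ i : Fin k, ∃ σ : Perm (Fin m), ∀ x y, Maps α x y → x.divNat = i →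
      σ x.modNat = y.modNat := by
    intro i
    by_cases hi : ∃ x y, Maps α x y ∧ x.divNat = i
    · obtain ⟨x, y, h, rfl⟩ := hi
      have def' : ∀ t : Fin m, ∃ y', Maps α (finProdFinEquiv (x.divNat, t)) y' := fun t =>
        (hs x y h).1 _ (divNat_finProd _ _)
      choose g hg using def'
      have hinj : Function.Injective fun t => (g t).modNat := by
        intro t t' e
        have h1 : (g t).divNat = (g t').divNat :=
          func _ _ _ _ (hg t) (hg t') (by rw [divNat_finProd, divNat_finProd])
        have h2 := hg t
        rw [finProd_ext h1 e] at h2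
        have h3 := congrArg Fin.modNat (h2.left_unique (hg t'))
        rwa [modNat_finProd, modNat_finProd] at h3
      refine ⟨Equiv.ofBijective _ (Finite.injective_iff_bijective.1 hinj), fun x' y' h' hx' => ?_⟩
      have h1 := hg x'.modNat
      rw [finProd_eq_iff.2 ⟨hx'.symm, rfl⟩] at h1
      rw [Equiv.ofBijective_apply, h1.right_unique h']
    · push Not at hi
      exact ⟨1, fun x y h hx => absurd hx (hi x y h)⟩
  choose z hz using perm
  refine ⟨z, θ, ?_, partialPerm_ext fun x y => ?_⟩
  · intro p p' q q' h h' hp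
    obtain ⟨x, y, h1, rfl, rfl⟩ := (hθ _ _).1 h
    obtain ⟨x', y', h1', rfl, rfl⟩ := (hθ _ _).1 h'
    exact ho x x' y y' h1 h1' hp
  · rw [maps_unitOf_mul_blowUp]
    constructor
    · intro h
      exact ⟨(hθ _ _).2 ⟨x, y, h, rfl, rfl⟩, hz _ x y h rfl⟩
    · rintro ⟨h1, h2⟩
      obtain ⟨x', y', h3, h4, h5⟩ := (hθ _ _).1 h1
      obtain ⟨y'', h6⟩ := (hs x' y' h3).1 x h4.symm
      have h7 := func _ _ _ _ h6 h3 h4.symm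
      have : y'' = y := finProd_ext (h7.trans h5) (by rw [← hz _ x y'' h6 rfl, h2])
      rwa [← this]

end POIElements

/-! ### From solutions of `V` to homomorphisms from the power of the symmetric group -/

section UnitHom

variable {k m : ℕ}

/-- A property of permutations that is stable under products and inverses and holds for `a` and
`b⁻¹` holds for all permutations. -/
theorem mem_subgroup_perm (hm : 2 ≤ m) {S : Subgroup (Perm (Fin m))} (ha : transA m ∈ S)
    (hb : (cycB m)⁻¹ ∈ S) (σ : Perm (Fin m)) : σ ∈ S := by
  have h : Subgroup.closure {transA m, cycB m} ≤ S := by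
    rw [Subgroup.closure_le]
    rintro τ (rfl | rfl)
    · exact ha
    · exact inv_mem_iff.1 hb
  rw [closure_transA_cycB hm] at h
  exact h trivial

/-- The exponents satisfy `(m-1)² + m = m(m-1) + 1`. This recovers the letter `d_i` from the
stand-ins `d_i^q` and `d_i^m` for `b_i` and `c_{i+1}`. -/
theorem pow_eq_mul_pow_sq {M : Type*} [Monoid M] (hm : 2 ≤ m) {a : M}
    (h : a ^ (m * (m - 1)) = 1) : a = a ^ (m - 1) ^ 2 * a ^ m := by
  have e : (m - 1) ^ 2 + m = m * (m - 1) + 1 := by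
    obtain ⟨l, rfl⟩ : ∃ l, m = l + 1 := ⟨m - 1, by omega⟩
    rw [Nat.add_sub_cancel]
    ring
  rw [← pow_add, e, pow_succ, h, one_mul]

/-- Moore's presentation gives one homomorphism for each place, with `b⁻¹` going to `d_i^q`.
Different places commute: this holds on generators and extends through centralizers, one argument at
a time. So the homomorphisms combine to one on the product. Its image contains `d_i = d_i^q d_i^m`,
the second factor coming from the cyclically next place. -/
theorem IsUnitSystem.exists_hom {G : Type*} [Group G] (hm : 2 ≤ m) {δ : ℕ → G}
    (H : IsUnitSystem k m δ) :
    ∃ F : (Fin k → Perm (Fin m)) →* G,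
      (∀ p : Fin k, F (tupleSingle k (p + 1) (transA m)) = transElt k m δ (p + 1)) ∧
      (∀ p : Fin k, F (tupleSingle k (p + 1) (cycB m)⁻¹) = δ (p + 1) ^ (m - 1) ^ 2) ∧
      ∀ i, 1 ≤ i → i ≤ k → ∃ w, F w = δ i := by
  have hex : ∀ p : Fin k, ∃ f : Perm (Fin m) →* G,
      f (transA m) = transElt k m δ (p + 1) ∧ f (cycB m) = (δ (p + 1) ^ (m - 1) ^ 2)⁻¹ :=
    fun p => (H.isMoorePair hm (by omega) (by omega)).inv.exists_hom hm
  choose f hfa hfb using hex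
  have hfb' : ∀ p : Fin k, f p (cycB m)⁻¹ = δ (p + 1) ^ (m - 1) ^ 2 := fun p => by
    rw [map_inv, hfb, inv_inv]
  have hcomm : Pairwise fun p q => ∀ σ τ, Commute (f p σ) (f q τ) := by
    intro p q hpq
    have hne : (p : ℕ) + 1 ≠ q + 1 := fun h => hpq (Fin.ext (by omega))
    have key : ∀ g : G, (g = transElt k m δ (p + 1) ∨ g = δ (p + 1) ^ (m - 1) ^ 2) →
        ∀ τ, Commute g (f q τ) := by
      intro g hg τ
      have hmem : τ ∈ (Subgroup.centralizer {g}).comap (f q) := by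
        refine mem_subgroup_perm hm ?_ ?_ τ
        · rw [Subgroup.mem_comap, hfa, Subgroup.mem_centralizer_singleton_iff]
          exact (H.commute hm (by omega) (by omega) (by omega) (by omega) hne hg
            (Or.inl rfl)).eq.symm
        · rw [Subgroup.mem_comap, hfb', Subgroup.mem_centralizer_singleton_iff]
          exact (H.commute hm (by omega) (by omega) (by omega) (by omega) hne hg
            (Or.inr rfl)).eq.symm
      rw [Subgroup.mem_comap, Subgroup.mem_centralizer_singleton_iff] at hmem
      exact hmem.symm
    intro σ τ
    have hmem : σ ∈ (Subgroup.centralizer {f q τ}).comap (f p) := by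
      refine mem_subgroup_perm hm ?_ ?_ σ
      · rw [Subgroup.mem_comap, hfa, Subgroup.mem_centralizer_singleton_iff]
        exact key _ (Or.inl rfl) τ
      · rw [Subgroup.mem_comap, hfb', Subgroup.mem_centralizer_singleton_iff]
        exact key _ (Or.inr rfl) τ
    rw [Subgroup.mem_comap, Subgroup.mem_centralizer_singleton_iff] at hmem
    exact hmem
  let F := MonoidHom.noncommPiCoprod f hcomm
  have hF : ∀ (p : Fin k) σ, F (tupleSingle k (p + 1) σ) = f p σ := fun p σ => by
    rw [tupleSingle_succ]
    exact MonoidHom.noncommPiCoprod_mulSingle _ _ _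
  have hA : ∀ p : Fin k, F (tupleSingle k (p + 1) (transA m)) = transElt k m δ (p + 1) :=
    fun p => by rw [hF, hfa]
  have hB : ∀ p : Fin k, F (tupleSingle k (p + 1) (cycB m)⁻¹) = δ (p + 1) ^ (m - 1) ^ 2 :=
    fun p => by rw [hF, hfb']
  refine ⟨F, hA, hB, fun i h1 h2 => ?_⟩
  obtain ⟨i', h1', h2', h⟩ := exists_prevIdx_eq h1 h2
  have hA' := hA ⟨i' - 1, by omega⟩
  have hB' := hB ⟨i' - 1, by omega⟩
  have hB'' := hB ⟨i - 1, by omega⟩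
  simp only [Nat.sub_add_cancel h1', Nat.sub_add_cancel h1] at hA' hB' hB''
  refine ⟨tupleSingle k i (cycB m)⁻¹ * (tupleSingle k i' (transA m) *
    tupleSingle k i' (cycB m)⁻¹), ?_⟩
  rw [map_mul, map_mul, hA', hB', hB'', H.transElt_mul hm h1' h2', h]
  exact (pow_eq_mul_pow_sq hm (H.pow i h1 h2)).symm

/-- A unit system in a monoid gives a homomorphism from the power of the symmetric group. -/
theorem IsUnitSystem.exists_monoidHom {M : Type*} [Monoid M] (hm : 2 ≤ m) {δ : ℕ → M}
    (H : IsUnitSystem k m δ) (h1 : ∀ i, ¬ (1 ≤ i ∧ i ≤ k) → δ i = 1) :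
    ∃ F : (Fin k → Perm (Fin m)) →* M,
      (∀ p : Fin k, F (tupleSingle k (p + 1) (transA m)) = transElt k m δ (p + 1)) ∧
      (∀ p : Fin k, F (tupleSingle k (p + 1) (cycB m)⁻¹) = δ (p + 1) ^ (m - 1) ^ 2) ∧
      ∀ i, 1 ≤ i → i ≤ k → ∃ w, F w = δ i := by
  have hpos : m * (m - 1) ≠ 0 := Nat.mul_ne_zero (by omega) (by omega)
  have hpow : ∀ i, δ i ^ (m * (m - 1)) = 1 := fun i => by
    by_cases h : 1 ≤ i ∧ i ≤ k
    · exact H.pow i h.1 h.2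
    · rw [h1 i h, one_pow]
  -- Each `δ i` has a positive power equal to `1`, so it is a unit and the group version applies
  -- inside `Mˣ`.
  obtain ⟨ε, rfl⟩ : ∃ ε : ℕ → Mˣ, δ = fun i => Units.coeHom M (ε i) :=
    ⟨fun i => Units.ofPowEqOne (δ i) _ (hpow i) hpos, funext fun i => rfl⟩
  obtain ⟨F, hA, hB, hd⟩ := (H.of_map (Units.coeHom M) Units.val_injective).exists_hom hm
  refine ⟨(Units.coeHom M).comp F, fun p => ?_, fun p => ?_, fun i h1 h2 => ?_⟩
  · rw [MonoidHom.comp_apply, hA, transElt_map]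
  · rw [MonoidHom.comp_apply, hB, map_pow]
  · obtain ⟨w, hw⟩ := hd i h1 h2
    exact ⟨w, by rw [MonoidHom.comp_apply, hw]⟩

/-- Two homomorphisms on a power of the symmetric group agree if they agree on the generators. -/
theorem hom_tuple_ext {M : Type*} [Monoid M] (hm : 2 ≤ m)
    {f g : (Fin k → Perm (Fin m)) →* M}
    (ha : ∀ p : Fin k, f (tupleSingle k (p + 1) (transA m)) = g (tupleSingle k (p + 1) (transA m)))
    (hb : ∀ p : Fin k,
      f (tupleSingle k (p + 1) (cycB m)⁻¹) = g (tupleSingle k (p + 1) (cycB m)⁻¹)) : f = g := by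
  refine MonoidHom.pi_ext fun p σ => ?_
  simp only [tupleSingle_succ] at ha hb
  exact mem_subgroup_perm (S := (f.comp (MonoidHom.mulSingle (fun _ => Perm (Fin m)) p)).eqLocus
    (g.comp (MonoidHom.mulSingle (fun _ => Perm (Fin m)) p))) hm (ha p) (hb p) σ

/-- The permutations for which the conclusion holds form a subgroup, and `a` and `b⁻¹` generate the
symmetric group. -/
theorem intertwines_tuple {M : Type*} [Monoid M] (hm : 2 ≤ m)
    {F : (Fin k → Perm (Fin m)) →* M} {u : M} {θ : PartialPerm (Fin k)}
    (ha : Intertwines (fun p : Fin k => F (tupleSingle k (p + 1) (transA m))) u θ)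
    (hb : Intertwines (fun p : Fin k => F (tupleSingle k (p + 1) (cycB m)⁻¹)) u θ)
    (σ : Perm (Fin m)) :
    Intertwines (fun p : Fin k => F (Pi.mulSingle p σ)) u θ := by
  simp only [tupleSingle_succ] at ha hb
  let S : Subgroup (Perm (Fin m)) :=
    { carrier := {σ | Intertwines (fun p : Fin k => F (Pi.mulSingle p σ)) u θ}
      one_mem' := by
        constructor <;> intros <;> simp
      mul_mem' := by
        intro σ τ hσ hτ
        refine ⟨fun p q h => ?_, fun p h => ?_, fun p h => ?_⟩
        · simp only [Pi.mulSingle_mul, map_mul]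
          rw [mul_assoc, hτ.maps p q h, ← mul_assoc, hσ.maps p q h, mul_assoc]
        · simp only [Pi.mulSingle_mul, map_mul]
          rw [mul_assoc, hτ.not_dom p h, hσ.not_dom p h]
        · simp only [Pi.mulSingle_mul, map_mul]
          rw [← mul_assoc, hσ.not_im p h, hτ.not_im p h]
      inv_mem' := by
        intro σ hσ
        have hl : ∀ p, F (Pi.mulSingle p σ⁻¹) * F (Pi.mulSingle p σ) = 1 := fun p => by
          rw [← map_mul, ← Pi.mulSingle_mul, inv_mul_cancel, Pi.mulSingle_one, map_one]
        have hr : ∀ p, F (Pi.mulSingle p σ) * F (Pi.mulSingle p σ⁻¹) = 1 := fun p => by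
          rw [← map_mul, ← Pi.mulSingle_mul, mul_inv_cancel, Pi.mulSingle_one, map_one]
        refine ⟨fun p q h => ?_, fun p h => ?_, fun p h => ?_⟩
        · have e := hσ.maps p q h
          beta_reduce at e ⊢
          calc F (Pi.mulSingle p σ⁻¹) * u
              = F (Pi.mulSingle p σ⁻¹) * (u * F (Pi.mulSingle q σ)) * F (Pi.mulSingle q σ⁻¹) := by
                rw [mul_assoc, mul_assoc, hr, mul_one]
            _ = u * F (Pi.mulSingle q σ⁻¹) := by rw [← e, ← mul_assoc, hl, one_mul]
        · have e := hσ.not_dom p h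
          beta_reduce at e ⊢
          conv_lhs => rw [← e]
          rw [← mul_assoc, hl, one_mul]
        · have e := hσ.not_im p h
          beta_reduce at e ⊢
          conv_lhs => rw [← e]
          rw [mul_assoc, hr, mul_one] }
  exact mem_subgroup_perm (S := S) hm ha hb σ

/-- Moving a tuple past an element that intertwines the components along `θ`. -/
theorem Intertwines.exists_mul_eq {M : Type*} [Monoid M] {F : (Fin k → Perm (Fin m)) →* M} {u : M}
    {θ : PartialPerm (Fin k)} (h : ∀ σ, Intertwines (fun p : Fin k => F (Pi.mulSingle p σ)) u θ)
    (w : Fin k → Perm (Fin m)) : ∃ w', u * F w = F w' * u := by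
  let S : Submonoid (Fin k → Perm (Fin m)) :=
    { carrier := {w | ∃ w', u * F w = F w' * u}
      one_mem' := ⟨1, by simp⟩
      mul_mem' := by
        rintro v w ⟨v', hv⟩ ⟨w', hw⟩
        exact ⟨v' * w', by rw [map_mul, ← mul_assoc, hv, mul_assoc, hw, ← mul_assoc, map_mul]⟩ }
  refine Submonoid.pi_mem_of_mulSingle_mem (H := S) w fun q => ?_
  by_cases hq : ∃ p, Maps θ p q
  · obtain ⟨p, hp⟩ := hq
    exact ⟨_, ((h (w q)).maps p q hp).symm⟩
  · exact ⟨1, by rw [(h (w q)).not_im q fun p hp => hq ⟨p, hp⟩, map_one, one_mul]⟩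

/-- The tuple is a product of its components: those at points of the domain are trivial, and `u`
absorbs each of the others. -/
theorem Intertwines.mul_eq_self {M : Type*} [Monoid M] {F : (Fin k → Perm (Fin m)) →* M} {u : M}
    {θ : PartialPerm (Fin k)} (h : ∀ σ, Intertwines (fun p : Fin k => F (Pi.mulSingle p σ)) u θ)
    {w : Fin k → Perm (Fin m)} (hw : ∀ p q, Maps θ p q → w p = 1) : F w * u = u := by
  let S : Submonoid (Fin k → Perm (Fin m)) :=
    { carrier := {w | F w * u = u}
      one_mem' := by simp
      mul_mem' := by
        intro v w (hv : _ = _) (hw : _ = _)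
        change _ = _
        rw [map_mul, mul_assoc, hw, hv] }
  refine Submonoid.pi_mem_of_mulSingle_mem (H := S) w fun p => ?_
  by_cases hp : ∃ q, Maps θ p q
  · obtain ⟨q, hq⟩ := hp
    rw [hw p q hq, Pi.mulSingle_one]
    exact one_mem S
  · exact (h (w p)).not_dom p fun q hq => hp ⟨q, hq⟩

end UnitHom

/-! ### The normal form in the presented monoid and the isomorphism -/

section Isomorphism

variable {n m : ℕ}

theorem pairClosure_map {M N : Type*} [Monoid M] [Monoid N] {k : ℕ} {x : ℕ → M} (Φ : M →* N)
    (Ψ : PartialPerm (Fin k) →* N) (h : ∀ i : Fin k, Φ (x i) = Ψ (xSmall k i))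
    {w : M × PartialPerm (Fin k)} (hw : w ∈ pairClosure k x) : Φ w.1 = Ψ w.2 := by
  have hle : pairClosure k x ≤
      (Φ.comp (MonoidHom.fst M (PartialPerm (Fin k)))).eqLocusM
        (Ψ.comp (MonoidHom.snd M (PartialPerm (Fin k)))) := by
    rw [pairClosure, Submonoid.closure_le]
    rintro _ ⟨i, rfl⟩
    exact h i
  exact hle hw

theorem exists_mem_pairClosure {M : Type*} [Monoid M] {k : ℕ} (x : ℕ → M)
    {θ : PartialPerm (Fin k)} (hθ : θ ∈ chainClosure k) : ∃ u, (u, θ) ∈ pairClosure k x := by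
  have hle : chainClosure k ≤ (pairClosure k x).map (MonoidHom.snd M (PartialPerm (Fin k))) := by
    rw [chainClosure, Submonoid.closure_le]
    rintro _ ⟨i, rfl⟩
    exact ⟨_, Submonoid.subset_closure ⟨i, rfl⟩, rfl⟩
  obtain ⟨⟨u, _⟩, hu, rfl⟩ := hle hθ
  exact ⟨u, hu⟩

/-- A product cannot see the components of its tuple outside the domain of `θ`, so equality is only
recovered there. Reading off `θ` takes one point of each block, hence `0 < m`. -/
theorem unitOf_mul_blowUp_inj (hm : 0 < m) {k : ℕ} {z w : Fin k → Perm (Fin m)}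
    {θ χ : PartialPerm (Fin k)} (h : unitOf z * blowUp m θ = unitOf w * blowUp m χ) :
    θ = χ ∧ ∀ p q, Maps θ p q → z p = w p := by
  have key : ∀ p q t s, Maps θ p q ∧ z p t = s ↔ Maps χ p q ∧ w p t = s := fun p q t s => by
    have e : Maps (unitOf z * blowUp m θ) (finProdFinEquiv (p, t)) (finProdFinEquiv (q, s)) ↔
        Maps (unitOf w * blowUp m χ) (finProdFinEquiv (p, t)) (finProdFinEquiv (q, s)) := by
      rw [h]
    rwa [maps_unitOf_mul_blowUp, maps_unitOf_mul_blowUp, divNat_finProd, divNat_finProd,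
      modNat_finProd, modNat_finProd] at e
  refine ⟨partialPerm_ext fun p q => ⟨fun hp => ?_, fun hp => ?_⟩, fun p q hp => ?_⟩
  · exact ((key p q ⟨0, hm⟩ _).1 ⟨hp, rfl⟩).1
  · exact ((key p q ⟨0, hm⟩ _).2 ⟨hp, rfl⟩).1
  · ext t : 1
    exact ((key p q t _).1 ⟨hp, rfl⟩).2.symm

variable (n m) in
/-- The homomorphism from the presented monoid to the monoid of partial permutations. -/
def presentedHom (hk : 2 ≤ n + 1) (hm : 2 ≤ m) :
    PresentedMonoid (Rels (n + 1) m) →* PartialPerm (Fin ((n + 1) * m)) :=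
  PresentedMonoid.lift (genMap (n + 1) m) fun _ _ h => lift_genMap_eq_of_rels hk hm h

theorem presentedHom_mk (hk : 2 ≤ n + 1) (hm : 2 ≤ m) (w : FreeMonoid (Letter (n + 1))) :
    presentedHom n m hk hm (PresentedMonoid.mk _ w) = FreeMonoid.lift (genMap (n + 1) m) w := rfl

theorem of_d_eq {k : ℕ} (i : Fin k) : FreeMonoid.of (Letter.d i) = d k (i + 1) := by
  rw [d, dif_pos (by omega)]
  rfl

theorem of_x_eq {k : ℕ} (i : Fin k) : FreeMonoid.of (Letter.x i) = x k i := by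
  rw [x, dif_pos i.2]

/-- The presented monoid factors as a product of units and of the submonoid generated by the
letters `x_i`. -/
theorem exists_presented_factorization (hk : 2 ≤ n + 1) (hm : 2 ≤ m) :
    ∃ F : (Fin (n + 1) → Perm (Fin m)) →* PresentedMonoid (Rels (n + 1) m),
      (∀ z, presentedHom n m hk hm (F z) = unitHom (n + 1) m z) ∧
      (∀ u θ, (u, θ) ∈ pairClosure (n + 1) (fun i => PresentedMonoid.mk (Rels (n + 1) m)
        (x (n + 1) i)) → ∀ σ, Intertwines (fun p => F (Pi.mulSingle p σ)) u θ) ∧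
      ∀ w, ∃ z u θ, (u, θ) ∈ pairClosure (n + 1) (fun i => PresentedMonoid.mk (Rels (n + 1) m)
        (x (n + 1) i)) ∧ w = F z * u := by
  set ψ := PresentedMonoid.mk (Rels (n + 1) m) with hψ
  have hrel : ∀ u v, Rels (n + 1) m u v → ψ u = ψ v := fun u v h =>
    PresentedMonoid.mk_eq_mk_of_rel h
  obtain ⟨F, hFA, hFB, hFd⟩ := (isUnitSystem_of_V ψ fun u v h =>
    hrel u v (Or.inl h)).exists_monoidHom hm fun i hi => by rw [d, dif_neg hi, map_one]
  have hgen : ∀ (i : Fin (n + 1)) σ,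
      Intertwines (fun p => F (Pi.mulSingle p σ)) (ψ (x (n + 1) i)) (xSmall (n + 1) i) := by
    intro i
    obtain ⟨h1, h2⟩ := intertwines_of_V' ψ hk (fun u v h => hrel u v (Or.inr (Or.inr h))) i
    refine intertwines_tuple hm ?_ ?_
    · simpa only [hFA] using h1
    · simpa only [hFB, map_pow] using h2
  have hpair : ∀ u θ, (u, θ) ∈ pairClosure (n + 1) (fun i => ψ (x (n + 1) i)) → ∀ σ,
      Intertwines (fun p => F (Pi.mulSingle p σ)) u θ := fun u θ h σ =>
    intertwines_of_mem_pairClosure (fun i => hgen i σ) h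
  obtain ⟨-, hA, hB⟩ := isUnitSystem_invTupleD hk hm
  refine ⟨F, fun z => ?_, hpair, fun w => ?_⟩
  · refine DFunLike.congr_fun (f := (presentedHom n m hk hm).comp F) ?_ z
    refine hom_tuple_ext hm (fun p => ?_) fun p => ?_
    · rw [MonoidHom.comp_apply, hFA, ← transElt_map]
      simp only [hψ, presentedHom_mk, lift_genMap_d]
      rw [transElt_map, hA _ (by omega) (by omega)]
    · rw [MonoidHom.comp_apply, hFB, map_pow]
      simp only [hψ, presentedHom_mk, lift_genMap_d]
      rw [← map_pow, hB _ (by omega) (by omega)]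
  · have hw : w ∈ (⊤ : Submonoid (PresentedMonoid (Rels (n + 1) m))) := trivial
    rw [← PresentedMonoid.closure_range_of] at hw
    -- The form `F z * u` survives right multiplication by a letter: a letter `d_i` is a value of
    -- `F` and passes to the left of `u`, whereas a letter `x_i` extends `u`.
    induction hw using Submonoid.closure_induction_right with
    | one => exact ⟨1, 1, 1, one_mem _, by rw [map_one, one_mul]⟩
    | mul_right w _ y hy ih =>
      obtain ⟨z, u, θ, hu, rfl⟩ := ih
      obtain ⟨l, rfl⟩ := hy
      cases l with
      | d i =>
        obtain ⟨v, hv⟩ := hFd (i + 1) (by omega) (by omega)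
        obtain ⟨v', hv'⟩ := Intertwines.exists_mul_eq (hpair u θ hu) v
        refine ⟨z * v', u, θ, hu, ?_⟩
        rw [PresentedMonoid.of, of_d_eq, ← hψ, ← hv, mul_assoc, hv', map_mul, mul_assoc]
      | x i =>
        refine ⟨z, u * ψ (x (n + 1) i), θ * xSmall (n + 1) i,
          mul_mem hu (Submonoid.subset_closure ⟨i, rfl⟩), ?_⟩
        rw [PresentedMonoid.of, of_x_eq, mul_assoc]

theorem presentedHom_pair (hk : 2 ≤ n + 1) (hm : 2 ≤ m) {u : PresentedMonoid (Rels (n + 1) m)}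
    {θ : PartialPerm (Fin (n + 1))}
    (hu : (u, θ) ∈ pairClosure (n + 1) (fun i => PresentedMonoid.mk (Rels (n + 1) m)
      (x (n + 1) i))) : presentedHom n m hk hm u = blowUpHom (n + 1) m θ := by
  refine pairClosure_map _ _ (fun i => ?_) hu
  rw [presentedHom_mk, lift_genMap_x, chainGen_val]

/-- Equal images give the same `θ` and tuples `z`, `z'` that agree on its domain. The relations `W`
then identify `u` with `u'`, and `u` absorbs `F (z'⁻¹ * z)`. -/
theorem presentedHom_injective (hk : 2 ≤ n + 1) (hm : 2 ≤ m) :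
    Function.Injective (presentedHom n m hk hm) := by
  obtain ⟨F, hF, hI, hfac⟩ := exists_presented_factorization hk hm
  have hW := (W_iff_isShiftMoveSystem (by omega) (PresentedMonoid.mk (Rels (n + 1) m))).1
    fun u v h => PresentedMonoid.mk_eq_mk_of_rel (Or.inr (Or.inl h))
  intro w w' h
  obtain ⟨z, u, θ, hu, rfl⟩ := hfac w
  obtain ⟨z', u', θ', hu', rfl⟩ := hfac w'
  rw [map_mul, map_mul, hF, hF, presentedHom_pair hk hm hu, presentedHom_pair hk hm hu'] at h
  obtain ⟨rfl, hz⟩ := unitOf_mul_blowUp_inj (by omega) h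
  obtain rfl := pairClosure_fst_eq hW hu hu'
  have e : F (z'⁻¹ * z) * u = u := by
    refine Intertwines.mul_eq_self (hI u θ hu) fun p q hp => ?_
    have := hz p q hp
    simp only [Pi.inv_apply, inv_inj] at this
    rw [Pi.mul_apply, Pi.inv_apply, this, inv_mul_cancel]
  calc F z * u = F z' * (F (z'⁻¹ * z) * u) := by
        rw [← mul_assoc, ← map_mul, mul_inv_cancel_left]
    _ = F z' * u := by rw [e]

theorem presentedHom_mem (hk : 2 ≤ n + 1) (hm : 2 ≤ m)
    (w : PresentedMonoid (Rels (n + 1) m)) : presentedHom n m hk hm w ∈ POI (n + 1) m := by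
  have hw : w ∈ (⊤ : Submonoid (PresentedMonoid (Rels (n + 1) m))) := trivial
  have hle : Submonoid.closure (Set.range (PresentedMonoid.of (Rels (n + 1) m))) ≤
      (POI (n + 1) m).comap (presentedHom n m hk hm) := by
    rw [Submonoid.closure_le]
    rintro _ ⟨l, rfl⟩
    cases l with
    | d i => exact unitOf_mem_POI _
    | x i => exact blowUp_mem_POI (isOrderPreserving_xSmall i)
  rw [← PresentedMonoid.closure_range_of] at hw
  exact hle hw

theorem presentedHom_surjOn (hk : 2 ≤ n + 1) (hm : 2 ≤ m)
    {α : PartialPerm (Fin ((n + 1) * m))} (hα : α ∈ POI (n + 1) m) :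
    ∃ w, presentedHom n m hk hm w = α := by
  obtain ⟨F, hF, -, -⟩ := exists_presented_factorization hk hm
  obtain ⟨z, θ, hθ, rfl⟩ := exists_eq_unitOf_mul_blowUp hα
  obtain ⟨u, hu⟩ := exists_mem_pairClosure
    (fun i => PresentedMonoid.mk (Rels (n + 1) m) (x (n + 1) i)) hθ.mem_chainClosure
  -- The inverse compensates for `unitHom`, under which a tuple acts through its inverse.
  refine ⟨F z⁻¹ * u, ?_⟩
  rw [map_mul, hF, presentedHom_pair hk hm hu]
  change unitOf z⁻¹⁻¹ * _ = _
  rw [inv_inv]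
  rfl

/-- The presentation defines the monoid, through the given generators. -/
theorem exists_mulEquiv_POI {k : ℕ} (hk : 2 ≤ k) (hm : 2 ≤ m) :
    ∃ e : PresentedMonoid (Rels k m) ≃* POI k m,
      (∀ i : Fin k, (e (PresentedMonoid.of _ (Letter.d i)) : PartialPerm (Fin (k * m))) =
        dBar k m i) ∧
      ∀ i : Fin k, (e (PresentedMonoid.of _ (Letter.x i)) : PartialPerm (Fin (k * m))) =
        xBar k m i := by
  obtain ⟨n, rfl⟩ : ∃ n, k = n + 1 := ⟨k - 1, by omega⟩
  let f := (presentedHom n m hk hm).codRestrict (POI (n + 1) m) (presentedHom_mem hk hm)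
  have hf : Function.Bijective f := by
    refine ⟨fun w w' h => presentedHom_injective hk hm (congrArg Subtype.val h), fun α => ?_⟩
    obtain ⟨w, hw⟩ := presentedHom_surjOn hk hm α.2
    exact ⟨w, Subtype.ext hw⟩
  exact ⟨MulEquiv.ofBijective f hf, fun i => rfl, fun i => rfl⟩

theorem card_letter (k : ℕ) : Nat.card (Letter k) = 2 * k := by
  let e : Letter k ≃ Fin k ⊕ Fin k :=
    { toFun := fun
        | .d i => .inl i
        | .x i => .inr i
      invFun := Sum.elim .d .x
      left_inv := by rintro (i | i) <;> rfl
      right_inv := by rintro (i | i) <;> rfl }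
  rw [Nat.card_congr e, Nat.card_sum, Nat.card_fin, two_mul]

end Isomorphism

/-! ### Letter counts and first letters, used to tell words apart -/

section WordStatistics

variable {k m : ℕ}

/-- The sum of the weights of the letters of a word. -/
def weight (f : Letter k → ℕ) (w : FreeMonoid (Letter k)) : ℕ := (w.toList.map f).sum

theorem weight_one (f : Letter k → ℕ) : weight f 1 = 0 := rfl

theorem weight_mul (f : Letter k → ℕ) (u v : FreeMonoid (Letter k)) :
    weight f (u * v) = weight f u + weight f v := by
  rw [weight, FreeMonoid.toList_mul, List.map_append, List.sum_append]
  rfl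

theorem weight_pow (f : Letter k → ℕ) (u : FreeMonoid (Letter k)) (n : ℕ) :
    weight f (u ^ n) = n * weight f u := by
  induction n with
  | zero => rw [pow_zero, weight_one, zero_mul]
  | succ n ih => rw [pow_succ, weight_mul, ih, Nat.succ_mul]

theorem weight_of (f : Letter k → ℕ) (l : Letter k) : weight f (FreeMonoid.of l) = f l := by
  simp [weight]

/-- The number of letters `d_i` in a word. -/
def dCount (w : FreeMonoid (Letter k)) : ℕ :=
  weight (fun | .d _ => 1 | .x _ => 0) w

/-- The number of letters `x_i` in a word. -/
def xCount (w : FreeMonoid (Letter k)) : ℕ :=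
  weight (fun | .d _ => 0 | .x _ => 1) w

/-- The sum of the indices of the letters `x_i` in a word. -/
def xSum (w : FreeMonoid (Letter k)) : ℕ :=
  weight (fun | .d _ => 0 | .x i => i) w

/-- A code of the first letter of a word: `i` for the letter `d_i`, `k + 1 + i` for the letter
`x_i`, and `0` for the empty word. -/
def lead (w : FreeMonoid (Letter k)) : ℕ :=
  w.toList.head?.elim 0 fun | .d i => i + 1 | .x i => k + 1 + i

theorem xCount_one : xCount (1 : FreeMonoid (Letter k)) = 0 := rfl
theorem lead_one : lead (1 : FreeMonoid (Letter k)) = 0 := rfl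

theorem dCount_mul (u v : FreeMonoid (Letter k)) : dCount (u * v) = dCount u + dCount v :=
  weight_mul _ u v
theorem xCount_mul (u v : FreeMonoid (Letter k)) : xCount (u * v) = xCount u + xCount v :=
  weight_mul _ u v
theorem xSum_mul (u v : FreeMonoid (Letter k)) : xSum (u * v) = xSum u + xSum v :=
  weight_mul _ u v

theorem dCount_pow (u : FreeMonoid (Letter k)) (n : ℕ) : dCount (u ^ n) = n * dCount u :=
  weight_pow _ u n
theorem xCount_pow (u : FreeMonoid (Letter k)) (n : ℕ) : xCount (u ^ n) = n * xCount u :=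
  weight_pow _ u n
theorem dCount_d {i : ℕ} (h1 : 1 ≤ i) (h2 : i ≤ k) : dCount (d k i) = 1 := by
  rw [d, dif_pos ⟨h1, h2⟩]
  exact weight_of _ _

theorem xCount_d (i : ℕ) : xCount (d k i) = 0 := by
  rw [d]
  split_ifs
  · exact weight_of _ _
  · rfl

theorem dCount_x (i : ℕ) : dCount (x k i) = 0 := by
  rw [x]
  split_ifs
  · exact weight_of _ _
  · rfl

theorem xCount_x {i : ℕ} (h : i < k) : xCount (x k i) = 1 := by
  rw [x, dif_pos h]
  exact weight_of _ _

theorem xSum_x {i : ℕ} (h : i < k) : xSum (x k i) = i := by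
  rw [x, dif_pos h]
  exact weight_of _ _

theorem dCount_xRun (i j : ℕ) : dCount (xRun k i j) = 0 := by
  rw [xRun]
  induction List.range' i (j - i) with
  | nil => rfl
  | cons a l ih => rw [List.map_cons, List.prod_cons, dCount_mul, ih, dCount_x]

theorem lead_mul {u : FreeMonoid (Letter k)} (h : lead u ≠ 0) (v : FreeMonoid (Letter k)) :
    lead (u * v) = lead u := by
  rw [lead] at h
  rw [lead, lead, FreeMonoid.toList_mul, List.head?_append]
  cases hu : u.toList.head? with
  | none => rw [hu] at h; exact absurd rfl h
  | some a => rfl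

theorem lead_pow {u : FreeMonoid (Letter k)} {n : ℕ} (hn : n ≠ 0) (h : lead u ≠ 0) :
    lead (u ^ n) = lead u := by
  obtain ⟨l, rfl⟩ := Nat.exists_eq_succ_of_ne_zero hn
  rw [pow_succ', lead_mul h]

theorem lead_d {i : ℕ} (h1 : 1 ≤ i) (h2 : i ≤ k) : lead (d k i) = i := by
  rw [d, dif_pos ⟨h1, h2⟩]
  exact Nat.sub_add_cancel h1

theorem lead_x {i : ℕ} (h : i < k) : lead (x k i) = k + 1 + i := by
  rw [x, dif_pos h]
  rfl

theorem lead_x_mul {i : ℕ} (h : i < k) (w : FreeMonoid (Letter k)) :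
    lead (x k i * w) = k + 1 + i := by
  rw [lead_mul (by rw [lead_x h]; omega), lead_x h]

theorem lead_d_pow {i n : ℕ} (h1 : 1 ≤ i) (h2 : i ≤ k) (hn : n ≠ 0) : lead (d k i ^ n) = i := by
  rw [lead_pow hn (by rw [lead_d h1 h2]; omega), lead_d h1 h2]

theorem lead_d_pow_mul {i n : ℕ} (h1 : 1 ≤ i) (h2 : i ≤ k) (hn : n ≠ 0)
    (w : FreeMonoid (Letter k)) : lead (d k i ^ n * w) = i := by
  rw [lead_mul (by rw [lead_d_pow h1 h2 hn]; omega), lead_d_pow h1 h2 hn]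

end WordStatistics

/-! ### Tools for counting unions of parametrised families -/

section Counting

variable {k m : ℕ}

/-- Each count below peels off one family at a time, starting with the last one and the empty set.
-/
theorem ncard_image_union {ι α : Type*} {I : Finset ι} {f : ι → α}
    (hf : ∀ a ∈ I, ∀ b ∈ I, f a = f b → a = b) {S : Set α} (hS : S.Finite)
    (hd : ∀ a ∈ I, f a ∉ S) :
    (f '' I ∪ S).Finite ∧ (f '' I ∪ S).ncard = I.card + S.ncard := by
  refine ⟨(I.finite_toSet.image f).union hS, ?_⟩
  rw [Set.ncard_union_eq _ (I.finite_toSet.image f) hS,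
    Set.InjOn.ncard_image fun a ha b hb h => hf a ha b hb h, Set.ncard_coe_finset]
  rw [Set.disjoint_left]
  rintro _ ⟨a, ha, rfl⟩
  exact hd a ha

/-- Swapping coordinates exchanges the two halves of the off-diagonal pairs; the factor `2` avoids
division. -/
theorem card_lt_pairs (n : ℕ) :
    2 * ((Finset.Icc 1 n ×ˢ Finset.Icc 1 n).filter fun p => p.1 < p.2).card = n * (n - 1) := by
  have h : ((Finset.Icc 1 n ×ˢ Finset.Icc 1 n).filter fun p => p.1 < p.2).card =
      ((Finset.Icc 1 n ×ˢ Finset.Icc 1 n).filter fun p => p.2 < p.1).card := by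
    refine Finset.card_bij (fun p _ => (p.2, p.1)) ?_ ?_ ?_
    · intro p hp
      simp only [Finset.mem_filter, Finset.mem_product] at hp ⊢
      exact ⟨⟨hp.1.2, hp.1.1⟩, hp.2⟩
    · intro p _ q _ e
      exact Prod.ext (congrArg Prod.snd e) (congrArg Prod.fst e)
    · intro p hp
      simp only [Finset.mem_filter, Finset.mem_product] at hp
      exact ⟨(p.2, p.1), by simp only [Finset.mem_filter, Finset.mem_product]; tauto, rfl⟩
  have e : (Finset.Icc 1 n).offDiag =
      ((Finset.Icc 1 n ×ˢ Finset.Icc 1 n).filter fun p => p.1 < p.2) ∪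
        (Finset.Icc 1 n ×ˢ Finset.Icc 1 n).filter fun p => p.2 < p.1 := by
    ext p
    simp only [Finset.mem_offDiag, Finset.mem_union, Finset.mem_filter, Finset.mem_product]
    have : p.1 ≠ p.2 ↔ p.1 < p.2 ∨ p.2 < p.1 := lt_or_lt_iff_ne.symm
    tauto
  have hc := congrArg Finset.card e
  rw [Finset.offDiag_card, Nat.card_Icc, Nat.add_sub_cancel, Finset.card_union_of_disjoint,
    ← h] at hc
  · rw [two_mul, ← hc, Nat.mul_sub, mul_one]
  · rw [Finset.disjoint_left]
    intro p hp hp'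
    simp only [Finset.mem_filter] at hp hp'
    omega

end Counting

/-! ### The number of relations in `V` -/

section CountV

variable {k m : ℕ}

theorem prevIdx_inj {i j : ℕ} (h1 : 1 ≤ i) (h2 : i ≤ k) (h3 : 1 ≤ j) (h4 : j ≤ k)
    (h : prevIdx k i = prevIdx k j) : i = j := by
  rw [prevIdx, prevIdx] at h
  split_ifs at h <;> omega

theorem prevIdx_ne (hk : 2 ≤ k) {i : ℕ} (h1 : 1 ≤ i) : prevIdx k i ≠ i := by
  rw [prevIdx]
  split_ifs <;> omega

variable (k m) in
/-- The relation `(d_{i-1}^m d_i^{m-1})^2 = 1`. -/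
def sqRel (i : ℕ) : FreeMonoid (Letter k) × FreeMonoid (Letter k) :=
  ((d k (prevIdx k i) ^ m * d k i ^ (m - 1)) ^ 2, 1)

variable (k m) in
/-- The relation `d_i^{m(m-1)} = 1`. -/
def powRel (i : ℕ) : FreeMonoid (Letter k) × FreeMonoid (Letter k) :=
  (d k i ^ (m * (m - 1)), 1)

variable (k m) in
/-- The relation `(d_i^q d_{i-1}^m d_i^{m-1})^{m-1} = 1`. -/
def conjPowRel (i : ℕ) : FreeMonoid (Letter k) × FreeMonoid (Letter k) :=
  ((d k i ^ (m - 1) ^ 2 * d k (prevIdx k i) ^ m * d k i ^ (m - 1)) ^ (m - 1), 1)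

variable (k m) in
/-- The relation `(d_{i-1}^m d_i^{q(m-2)} d_{i-1}^m)^3 = 1`. -/
def braidRel (i : ℕ) : FreeMonoid (Letter k) × FreeMonoid (Letter k) :=
  ((d k (prevIdx k i) ^ m * d k i ^ ((m - 1) ^ 2 * (m - 2)) * d k (prevIdx k i) ^ m) ^ 3, 1)

variable (k m) in
/-- The relation `(d_{i-1}^m d_i^{q(m-j-1)} d_{i-1}^m d_i^{q(j-1)})^2 = 1`. -/
def farRel (p : ℕ × ℕ) : FreeMonoid (Letter k) × FreeMonoid (Letter k) :=
  ((d k (prevIdx k p.1) ^ m * d k p.1 ^ ((m - 1) ^ 2 * (m - p.2 - 1)) *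
    d k (prevIdx k p.1) ^ m * d k p.1 ^ ((m - 1) ^ 2 * (p.2 - 1))) ^ 2, 1)

variable (k) in
/-- The relation `d_i^r d_j^s = d_j^s d_i^r`. -/
def commRel (r s : ℕ) (i j : ℕ) : FreeMonoid (Letter k) × FreeMonoid (Letter k) :=
  (d k i ^ r * d k j ^ s, d k j ^ s * d k i ^ r)

variable (k) in
/-- The pairs `i < j` of indices between `1` and `k`. -/
def ltPairs : Finset (ℕ × ℕ) :=
  (Finset.Icc 1 k ×ˢ Finset.Icc 1 k).filter fun p => p.1 < p.2

theorem mem_ltPairs {p : ℕ × ℕ} : p ∈ ltPairs k ↔ 1 ≤ p.1 ∧ p.1 < p.2 ∧ p.2 ≤ k := by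
  simp only [ltPairs, Finset.mem_filter, Finset.mem_product, Finset.mem_Icc]
  omega

variable (k) in
/-- The pairs `(j, i)` of indices with `i` different from `j` and from the index before `j`. -/
def farPairs : Finset (Σ _ : ℕ, ℕ) :=
  (Finset.Icc 1 k).sigma fun j => ((Finset.Icc 1 k).erase j).erase (prevIdx k j)

theorem card_farPairs (hk : 2 ≤ k) : (farPairs k).card = k * (k - 2) := by
  rw [farPairs, Finset.card_sigma, Finset.sum_const_nat (m := k - 2), Nat.card_Icc,
    Nat.add_sub_cancel]
  intro j hj
  rw [Finset.mem_Icc] at hj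
  have hp := prevIdx_mem hj.1 hj.2
  rw [Finset.card_erase_of_mem, Finset.card_erase_of_mem, Nat.card_Icc]
  · omega
  · exact Finset.mem_Icc.2 hj
  · exact Finset.mem_erase.2 ⟨prevIdx_ne hk hj.1, Finset.mem_Icc.2 hp⟩

theorem mem_farPairs {p : Σ _ : ℕ, ℕ} : p ∈ farPairs k ↔
    1 ≤ p.1 ∧ p.1 ≤ k ∧ 1 ≤ p.2 ∧ p.2 ≤ k ∧ p.2 ≠ p.1 ∧ p.2 ≠ prevIdx k p.1 := by
  simp only [farPairs, Finset.mem_sigma, Finset.mem_erase, Finset.mem_Icc]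
  tauto

/-- The relations listed separately are the cyclic index `1`, so with `prevIdx` each family is a
single image. The final empty set is the start of the iterated count. -/
theorem setOf_V_eq (hk : 2 ≤ k) :
    {r : FreeMonoid (Letter k) × FreeMonoid (Letter k) | V k m r.1 r.2} =
      sqRel k m '' (Finset.Icc 1 k : Finset ℕ) ∪ (powRel k m '' (Finset.Icc 1 k : Finset ℕ) ∪
      (conjPowRel k m '' (Finset.Icc 1 k : Finset ℕ) ∪
      (braidRel k m '' (Finset.Icc 1 k : Finset ℕ) ∪
      (farRel k m '' (Finset.Icc 1 k ×ˢ Finset.Icc 2 (m - 2) : Finset (ℕ × ℕ)) ∪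
      ((fun p : ℕ × ℕ => commRel k m m p.1 p.2) '' (ltPairs k) ∪
      ((fun p : ℕ × ℕ => commRel k ((m - 1) ^ 2) ((m - 1) ^ 2) p.1 p.2) '' (ltPairs k) ∪
      ((fun p : Σ _ : ℕ, ℕ => commRel k ((m - 1) ^ 2) m p.2 (prevIdx k p.1)) '' (farPairs k) ∪
      ∅))))))) := by
  have hI : ∀ i, i ∈ ((Finset.Icc 1 k : Finset ℕ) : Set ℕ) ↔ 1 ≤ i ∧ i ≤ k := fun i => by
    rw [Finset.mem_coe, Finset.mem_Icc]
  have hcase : ∀ i, 1 ≤ i → i ≤ k → i = 1 ∨ ∃ j, i = j + 1 ∧ 1 ≤ j ∧ j ≤ k - 1 := fun i h1 h2 => by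
    rcases Nat.eq_or_lt_of_le h1 with h | h
    · exact .inl h.symm
    · exact .inr ⟨i - 1, by omega, by omega, by omega⟩
  have hs : ∀ {i}, 1 ≤ i → prevIdx k (i + 1) = i := fun h => prevIdx_succ k h
  ext ⟨u, v⟩
  constructor
  · intro h
    change V k m u v at h
    cases h with
    | v1_first => exact .inl ⟨1, (hI 1).2 (by omega), rfl⟩
    | v1 i h1 h2 => exact .inl ⟨i + 1, (hI _).2 (by omega), by rw [sqRel, hs h1]⟩
    | v2 i h1 h2 => exact .inr (.inl ⟨i, (hI _).2 (by omega), rfl⟩)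
    | v3_first => exact .inr (.inr (.inl ⟨1, (hI 1).2 (by omega), rfl⟩))
    | v3 i h1 h2 =>
      exact .inr (.inr (.inl ⟨i + 1, (hI _).2 (by omega), by rw [conjPowRel, hs h1]⟩))
    | v4_first => exact .inr (.inr (.inr (.inl ⟨1, (hI 1).2 (by omega), rfl⟩)))
    | v4 i h1 h2 =>
      exact .inr (.inr (.inr (.inl ⟨i + 1, (hI _).2 (by omega), by rw [braidRel, hs h1]⟩)))
    | v5_first j hj1 hj2 =>
      refine .inr (.inr (.inr (.inr (.inl ⟨(1, j), ?_, rfl⟩))))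
      rw [Finset.mem_coe, Finset.mem_product, Finset.mem_Icc, Finset.mem_Icc]
      omega
    | v5 i j hj1 hj2 h1 h2 =>
      refine .inr (.inr (.inr (.inr (.inl ⟨(i + 1, j), ?_, by simp only [farRel, hs h1]⟩))))
      rw [Finset.mem_coe, Finset.mem_product, Finset.mem_Icc, Finset.mem_Icc]
      omega
    | v6_cc i j h1 h2 h3 =>
      exact .inr (.inr (.inr (.inr (.inr (.inl ⟨(i, j), mem_ltPairs.2 ⟨h1, h2, h3⟩, rfl⟩)))))
    | v6_bb i j h1 h2 h3 =>
      exact .inr (.inr (.inr (.inr (.inr (.inr (.inl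
        ⟨(i, j), mem_ltPairs.2 ⟨h1, h2, h3⟩, rfl⟩))))))
    | v6_bc_first i h1 h2 =>
      refine .inr (.inr (.inr (.inr (.inr (.inr (.inr (.inl
        ⟨⟨1, i⟩, mem_farPairs.2 ?_, rfl⟩)))))))
      simp only [prevIdx_one]
      omega
    | v6_bc i j h1 h2 h3 h4 h5 h6 =>
      refine .inr (.inr (.inr (.inr (.inr (.inr (.inr (.inl
        ⟨⟨j + 1, i⟩, mem_farPairs.2 ?_, by simp only [hs h3, commRel]⟩)))))))
      simp only [hs h3]
      omega
  · rintro (⟨i, hi, e⟩ | ⟨i, hi, e⟩ | ⟨i, hi, e⟩ | ⟨i, hi, e⟩ | ⟨⟨i, j⟩, hi, e⟩ | ⟨⟨i, j⟩, hi, e⟩ |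
      ⟨⟨i, j⟩, hi, e⟩ | ⟨⟨j, i⟩, hi, e⟩ | h)
    · obtain ⟨rfl, rfl⟩ := Prod.ext_iff.1 e
      rw [hI] at hi
      rcases hcase i hi.1 hi.2 with rfl | ⟨j, rfl, h1, h2⟩
      · exact V.v1_first
      · simpa only [sqRel, hs h1] using! V.v1 j h1 h2
    · obtain ⟨rfl, rfl⟩ := Prod.ext_iff.1 e
      rw [hI] at hi
      exact V.v2 i hi.1 hi.2
    · obtain ⟨rfl, rfl⟩ := Prod.ext_iff.1 e
      rw [hI] at hi
      rcases hcase i hi.1 hi.2 with rfl | ⟨j, rfl, h1, h2⟩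
      · exact V.v3_first
      · simpa only [conjPowRel, hs h1] using! V.v3 j h1 h2
    · obtain ⟨rfl, rfl⟩ := Prod.ext_iff.1 e
      rw [hI] at hi
      rcases hcase i hi.1 hi.2 with rfl | ⟨j, rfl, h1, h2⟩
      · exact V.v4_first
      · simpa only [braidRel, hs h1] using! V.v4 j h1 h2
    · obtain ⟨rfl, rfl⟩ := Prod.ext_iff.1 e
      rw [Finset.mem_coe, Finset.mem_product, Finset.mem_Icc, Finset.mem_Icc] at hi
      rcases hcase i hi.1.1 hi.1.2 with rfl | ⟨l, rfl, h1, h2⟩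
      · exact V.v5_first j hi.2.1 hi.2.2
      · simpa only [farRel, hs h1] using! V.v5 l j hi.2.1 hi.2.2 h1 h2
    · obtain ⟨rfl, rfl⟩ := Prod.ext_iff.1 e
      have hi := mem_ltPairs.1 hi
      exact V.v6_cc i j hi.1 hi.2.1 hi.2.2
    · obtain ⟨rfl, rfl⟩ := Prod.ext_iff.1 e
      have hi := mem_ltPairs.1 hi
      exact V.v6_bb i j hi.1 hi.2.1 hi.2.2
    · obtain ⟨rfl, rfl⟩ := Prod.ext_iff.1 e
      obtain ⟨h1, h2, h3, h4, h5, h6⟩ := mem_farPairs.1 hi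
      simp only at h1 h2 h3 h4 h5 h6
      rcases hcase j h1 h2 with rfl | ⟨l, rfl, h7, h8⟩
      · rw [prevIdx_one] at h6
        exact V.v6_bc_first i (by omega) (by omega)
      · simp only [hs h7] at h6 ⊢
        exact V.v6_bc i l h3 h4 h7 h8 h6 h5
    · exact h.elim

theorem dCount_powers {i j : ℕ} (hi : 1 ≤ i ∧ i ≤ k) (hj : 1 ≤ j ∧ j ≤ k) (r s : ℕ) :
    dCount (d k i ^ r * d k j ^ s) = r + s := by
  rw [dCount_mul, dCount_pow, dCount_pow, dCount_d hi.1 hi.2, dCount_d hj.1 hj.2]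
  omega

theorem dCount_sqRel {i : ℕ} (h : 1 ≤ i ∧ i ≤ k) :
    dCount (sqRel k m i).1 = 2 * (m + (m - 1)) := by
  rw [sqRel, dCount_pow, dCount_powers (prevIdx_mem h.1 h.2) h]

theorem dCount_powRel {i : ℕ} (h : 1 ≤ i ∧ i ≤ k) : dCount (powRel k m i).1 = m * (m - 1) := by
  rw [powRel, dCount_pow, dCount_d h.1 h.2, mul_one]

theorem dCount_conjPowRel {i : ℕ} (h : 1 ≤ i ∧ i ≤ k) :
    dCount (conjPowRel k m i).1 = (m - 1) * ((m - 1) ^ 2 + m + (m - 1)) := by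
  rw [conjPowRel, dCount_pow, dCount_mul, dCount_powers h (prevIdx_mem h.1 h.2), dCount_pow,
    dCount_d h.1 h.2, mul_one]

theorem dCount_braidRel {i : ℕ} (h : 1 ≤ i ∧ i ≤ k) :
    dCount (braidRel k m i).1 = 3 * (m + (m - 1) ^ 2 * (m - 2) + m) := by
  have hp := prevIdx_mem h.1 h.2
  rw [braidRel, dCount_pow, dCount_mul, dCount_powers hp h, dCount_pow,
    dCount_d hp.1 hp.2, mul_one]

/-- The exponents add up by `(m - j - 1) + (j - 1) = m - 2`, so the length does not depend on `j`.
-/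
theorem dCount_farRel {p : ℕ × ℕ} (h : 1 ≤ p.1 ∧ p.1 ≤ k) (h2 : 2 ≤ p.2 ∧ p.2 ≤ m - 2) :
    dCount (farRel k m p).1 = 2 * (m + m + (m - 1) ^ 2 * (m - 2)) := by
  rw [farRel, mul_assoc, dCount_pow, dCount_mul, dCount_powers (prevIdx_mem h.1 h.2) h,
    dCount_powers (prevIdx_mem h.1 h.2) h]
  have e : m - 2 = (m - p.2 - 1) + (p.2 - 1) := by omega
  rw [e, Nat.mul_add ((m - 1) ^ 2)]
  omega

theorem lead_sqRel (hm : 2 ≤ m) {i : ℕ} (h : 1 ≤ i ∧ i ≤ k) :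
    lead (sqRel k m i).1 = prevIdx k i := by
  have hp := prevIdx_mem h.1 h.2
  have e := lead_d_pow_mul hp.1 hp.2 (show m ≠ 0 by omega) (d k i ^ (m - 1))
  rw [sqRel, lead_pow two_ne_zero (by rw [e]; omega), e]

theorem lead_powRel (hm : 2 ≤ m) {i : ℕ} (h : 1 ≤ i ∧ i ≤ k) : lead (powRel k m i).1 = i :=
  lead_d_pow h.1 h.2 (Nat.mul_ne_zero (by omega) (by omega))

theorem lead_conjPowRel (hm : 2 ≤ m) {i : ℕ} (h : 1 ≤ i ∧ i ≤ k) :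
    lead (conjPowRel k m i).1 = i := by
  have e := lead_d_pow_mul h.1 h.2 (pow_ne_zero 2 (show m - 1 ≠ 0 by omega))
    (d k (prevIdx k i) ^ m * d k i ^ (m - 1))
  rw [← mul_assoc] at e
  rw [conjPowRel, lead_pow (by omega) (by rw [e]; omega), e]

theorem lead_braidRel (hm : 2 ≤ m) {i : ℕ} (h : 1 ≤ i ∧ i ≤ k) :
    lead (braidRel k m i).1 = prevIdx k i := by
  have hp := prevIdx_mem h.1 h.2
  have e := lead_d_pow_mul hp.1 hp.2 (show m ≠ 0 by omega)
    (d k i ^ ((m - 1) ^ 2 * (m - 2)) * d k (prevIdx k i) ^ m)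
  rw [← mul_assoc] at e
  rw [braidRel, lead_pow three_ne_zero (by rw [e]; omega), e]

theorem lead_farRel (hm : 2 ≤ m) {p : ℕ × ℕ} (h : 1 ≤ p.1 ∧ p.1 ≤ k) :
    lead (farRel k m p).1 = prevIdx k p.1 := by
  have hp := prevIdx_mem h.1 h.2
  rw [farRel, pow_two]
  simp only [mul_assoc]
  exact lead_d_pow_mul hp.1 hp.2 (by omega) _

/-- The word on the left of `farRel` determines the second parameter. -/
theorem farRel_snd_le (hk : 2 ≤ k) (hm : 2 ≤ m) {i j j' : ℕ} (h : 1 ≤ i ∧ i ≤ k)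
    (hj : 2 ≤ j ∧ j ≤ m - 2) (hj' : 2 ≤ j' ∧ j' ≤ m - 2)
    (e : (farRel k m (i, j)).1 = (farRel k m (i, j')).1) : j' ≤ j := by
  by_contra hlt
  have hp := prevIdx_mem h.1 h.2
  -- If `j < j'`, the first block of letters `d_i` is longer for `j`. After cancelling the common
  -- prefix, one word continues with `d_i` and the other with `d_{i-1}`.
  have hs : (m - 1) ^ 2 * (m - j - 1) =
      (m - 1) ^ 2 * (m - j' - 1) + (m - 1) ^ 2 * (j' - j) := by
    rw [← Nat.mul_add]
    congr 1
    omega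
  simp only [farRel, pow_two (_ * _ * _ * _)] at e
  rw [hs, pow_add] at e
  simp only [mul_assoc] at e
  have e1 := congrArg lead (mul_left_cancel (mul_left_cancel e))
  rw [lead_d_pow_mul h.1 h.2 (Nat.mul_ne_zero (pow_ne_zero 2 (by omega)) (by omega)),
    lead_d_pow_mul hp.1 hp.2 (by omega)] at e1
  exact prevIdx_ne hk h.1 e1.symm

theorem lead_commRel {r s i j : ℕ} (hr : r ≠ 0) (hs : s ≠ 0) (hi : 1 ≤ i ∧ i ≤ k)
    (hj : 1 ≤ j ∧ j ≤ k) :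
    lead (commRel k r s i j).1 = i ∧ lead (commRel k r s i j).2 = j :=
  ⟨lead_d_pow_mul hi.1 hi.2 hr _, lead_d_pow_mul hj.1 hj.2 hs _⟩

theorem commRel_inj {r s i j i' j' : ℕ} (hr : r ≠ 0) (hs : s ≠ 0) (hi : 1 ≤ i ∧ i ≤ k)
    (hj : 1 ≤ j ∧ j ≤ k) (hi' : 1 ≤ i' ∧ i' ≤ k) (hj' : 1 ≤ j' ∧ j' ≤ k)
    (h : commRel k r s i j = commRel k r s i' j') : i = i' ∧ j = j' := by
  have h1 := lead_commRel hr hs hi hj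
  have h2 := lead_commRel hr hs hi' hj'
  rw [h] at h1
  exact ⟨h1.1.symm.trans h2.1, h1.2.symm.trans h2.2⟩

/-- The relators of the different families have different lengths. -/
theorem relator_lengths_ne (hm : 2 ≤ m) :
    2 * (m + (m - 1)) ≠ m * (m - 1) ∧
    2 * (m + (m - 1)) ≠ (m - 1) * ((m - 1) ^ 2 + m + (m - 1)) ∧
    2 * (m + (m - 1)) ≠ 3 * (m + (m - 1) ^ 2 * (m - 2) + m) ∧
    m * (m - 1) ≠ (m - 1) * ((m - 1) ^ 2 + m + (m - 1)) ∧
    m * (m - 1) ≠ 3 * (m + (m - 1) ^ 2 * (m - 2) + m) ∧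
    (m - 1) * ((m - 1) ^ 2 + m + (m - 1)) ≠ 3 * (m + (m - 1) ^ 2 * (m - 2) + m) ∧
    (4 ≤ m → 2 * (m + (m - 1)) ≠ 2 * (m + m + (m - 1) ^ 2 * (m - 2)) ∧
      m * (m - 1) ≠ 2 * (m + m + (m - 1) ^ 2 * (m - 2)) ∧
      (m - 1) * ((m - 1) ^ 2 + m + (m - 1)) ≠ 2 * (m + m + (m - 1) ^ 2 * (m - 2))) := by
  obtain ⟨l, rfl⟩ : ∃ l, m = l + 2 := ⟨m - 2, by omega⟩
  rw [show l + 2 - 1 = l + 1 by omega, show l + 2 - 2 = l by omega]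
  have e2 : (l + 2) * (l + 1) = l ^ 2 + 3 * l + 2 := by ring
  have e3 : (l + 1) * ((l + 1) ^ 2 + (l + 2) + (l + 1)) = l ^ 3 + 5 * l ^ 2 + 8 * l + 4 := by ring
  have eq : (l + 1) ^ 2 * l = l ^ 3 + 2 * l ^ 2 + l := by ring
  rw [e2, e3, eq]
  have h2 : l ^ 2 = l * l := pow_two l
  have h3 : l ^ 3 = l * (l * l) := by ring
  -- For `l ≥ 3` the powers of `l` become independent atoms with linear lower bounds, which suffice
  -- for linear arithmetic; three small values remain.
  have hsmall : l = 0 ∨ l = 1 ∨ l = 2 ∨ (3 ≤ l ∧ 3 * l ≤ l * l ∧ 3 * (l * l) ≤ l * (l * l)) := by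
    rcases Nat.lt_or_ge l 3 with h | h
    · omega
    · exact .inr (.inr (.inr ⟨h, Nat.mul_le_mul_right _ h, Nat.mul_le_mul_right _ h⟩))
  rw [h2, h3]
  rcases hsmall with rfl | rfl | rfl | ⟨h4, h5, h6⟩
  · omega
  · omega
  · omega
  · generalize l * (l * l) = c at h6 ⊢
    generalize l * l = b at h5 h6 ⊢
    omega

/-- Families with right side `1` differ from one another in length, and from the commutation
families because the latter have nonempty right sides. The commutation families have lengths `2m`,
`2q` and `m + q`. Inside a family the first letters determine the indices, except for `j` in
`farRel`. The interval from `2` to `m - 2` contributes `m - 3` in truncated subtraction, which is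
`0` for `m = 2`. -/
theorem ncard_V (hk : 2 ≤ k) (hm : 2 ≤ m) :
    {r : FreeMonoid (Letter k) × FreeMonoid (Letter k) | V k m r.1 r.2}.Finite ∧
    {r : FreeMonoid (Letter k) × FreeMonoid (Letter k) | V k m r.1 r.2}.ncard =
      4 * k + k * (m - 3) + k * (k - 1) + k * (k - 2) := by
  have hq : (m - 1) ^ 2 ≠ 0 := pow_ne_zero 2 (by omega)
  have hI : ∀ {i}, i ∈ Finset.Icc 1 k → 1 ≤ i ∧ i ≤ k := fun h => Finset.mem_Icc.1 h
  have hI2 : ∀ {p : ℕ × ℕ}, p ∈ Finset.Icc 1 k ×ˢ Finset.Icc 2 (m - 2) →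
      (1 ≤ p.1 ∧ p.1 ≤ k) ∧ 2 ≤ p.2 ∧ p.2 ≤ m - 2 := fun h => by
    rwa [Finset.mem_product, Finset.mem_Icc, Finset.mem_Icc] at h
  have hl : ∀ {p : ℕ × ℕ}, p ∈ ltPairs k → (1 ≤ p.1 ∧ p.1 ≤ k) ∧ 1 ≤ p.2 ∧ p.2 ≤ k := fun h => by
    have := mem_ltPairs.1 h
    omega
  have hfar : ∀ {p : Σ _ : ℕ, ℕ}, p ∈ farPairs k →
      (1 ≤ p.2 ∧ p.2 ≤ k) ∧ (1 ≤ prevIdx k p.1 ∧ prevIdx k p.1 ≤ k) ∧ 1 ≤ p.1 ∧ p.1 ≤ k :=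
    fun h => by
      obtain ⟨h1, h2, h3, h4, -, -⟩ := mem_farPairs.1 h
      exact ⟨⟨h3, h4⟩, prevIdx_mem h1 h2, h1, h2⟩
  have hne : ∀ {w : FreeMonoid (Letter k)} {r s i j : ℕ}, r ≠ 0 → s ≠ 0 → 1 ≤ i ∧ i ≤ k →
      1 ≤ j ∧ j ≤ k → commRel k r s i j ≠ (w, 1) := fun hr hs hi hj e => by
    have h := (lead_commRel hr hs hi hj).2
    rw [e, lead_one] at h
    omega
  have hm0 : m ≠ 0 := by omega
  -- The equation `m² - 3m + 1 = 0` has no integer solution.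
  have hqm : (m - 1) ^ 2 ≠ m := by
    obtain ⟨l, rfl⟩ : ∃ l, m = l + 2 := ⟨m - 2, by omega⟩
    rw [show l + 2 - 1 = l + 1 by omega]
    intro h
    rcases Nat.lt_or_ge l 1 with h1 | h1
    · interval_cases l; omega
    · nlinarith
  have key8 := ncard_image_union (I := farPairs k)
    (f := fun p : Σ _ : ℕ, ℕ => commRel k ((m - 1) ^ 2) m p.2 (prevIdx k p.1)) (S := ∅)
    (fun ⟨j, i⟩ hp ⟨j', i'⟩ hp' e => by
      have h := hfar hp
      have h' := hfar hp'
      obtain ⟨rfl, h2⟩ := commRel_inj hq hm0 h.1 h.2.1 h'.1 h'.2.1 e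
      obtain rfl := prevIdx_inj h.2.2.1 h.2.2.2 h'.2.2.1 h'.2.2.2 h2
      rfl) Set.finite_empty (fun _ _ h => h)
  have key7 := ncard_image_union (I := ltPairs k)
    (f := fun p : ℕ × ℕ => commRel k ((m - 1) ^ 2) ((m - 1) ^ 2) p.1 p.2)
    (fun p hp p' hp' e =>
      have h := commRel_inj hq hq (hl hp).1 (hl hp).2 (hl hp').1 (hl hp').2 e
      Prod.ext h.1 h.2) key8.1 (by
      rintro p hp (⟨p', hp', e⟩ | h)
      · have e := congrArg (fun r => dCount r.1) e
        simp only [commRel] at e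
        rw [dCount_powers (hl hp).1 (hl hp).2, dCount_powers (hfar hp').1 (hfar hp').2.1] at e
        omega
      · exact h)
  have key6 := ncard_image_union (I := ltPairs k)
    (f := fun p : ℕ × ℕ => commRel k m m p.1 p.2)
    (fun p hp p' hp' e =>
      have h := commRel_inj hm0 hm0 (hl hp).1 (hl hp).2 (hl hp').1 (hl hp').2 e
      Prod.ext h.1 h.2) key7.1 (by
      rintro p hp (⟨p', hp', e⟩ | ⟨p', hp', e⟩ | h)
      · have e := congrArg (fun r => dCount r.1) e
        simp only [commRel] at e
        rw [dCount_powers (hl hp).1 (hl hp).2, dCount_powers (hl hp').1 (hl hp').2] at e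
        omega
      · have e := congrArg (fun r => dCount r.1) e
        simp only [commRel] at e
        rw [dCount_powers (hl hp).1 (hl hp).2, dCount_powers (hfar hp').1 (hfar hp').2.1] at e
        omega
      · exact h)
  have key5 := ncard_image_union (I := Finset.Icc 1 k ×ˢ Finset.Icc 2 (m - 2))
    (f := farRel k m)
    (fun ⟨i, j⟩ hp ⟨i', j'⟩ hp' e => by
      have h := hI2 hp
      have h' := hI2 hp'
      have h1 := congrArg (fun r => lead r.1) e
      simp only [lead_farRel hm h.1, lead_farRel hm h'.1] at h1
      obtain rfl := prevIdx_inj h.1.1 h.1.2 h'.1.1 h'.1.2 h1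
      have h2 := farRel_snd_le hk hm h.1 h.2 h'.2 (congrArg Prod.fst e)
      have h3 := farRel_snd_le hk hm h.1 h'.2 h.2 (congrArg Prod.fst e).symm
      exact Prod.ext rfl (le_antisymm h3 h2)) key6.1 (by
      rintro p hp (⟨p', hp', e⟩ | ⟨p', hp', e⟩ | ⟨p', hp', e⟩ | h)
      · exact hne hm0 hm0 (hl hp').1 (hl hp').2 e
      · exact hne hq hq (hl hp').1 (hl hp').2 e
      · exact hne hq hm0 (hfar hp').1 (hfar hp').2.1 e
      · exact h)
  have key4 := ncard_image_union (I := Finset.Icc 1 k) (f := braidRel k m)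
    (fun i hi i' hi' e => by
      have h1 := congrArg (fun r => lead r.1) e
      simp only [lead_braidRel hm (hI hi), lead_braidRel hm (hI hi')] at h1
      exact prevIdx_inj (hI hi).1 (hI hi).2 (hI hi').1 (hI hi').2 h1) key5.1 (by
      rintro i hi (⟨p', hp', e⟩ | ⟨p', hp', e⟩ | ⟨p', hp', e⟩ | ⟨p', hp', e⟩ | h)
      · have e := congrArg (fun r => dCount r.1) e
        simp only [dCount_farRel (hI2 hp').1 (hI2 hp').2, dCount_braidRel (hI hi)] at e
        omega
      · exact hne hm0 hm0 (hl hp').1 (hl hp').2 e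
      · exact hne hq hq (hl hp').1 (hl hp').2 e
      · exact hne hq hm0 (hfar hp').1 (hfar hp').2.1 e
      · exact h)
  obtain ⟨n12, n13, n14, n23, n24, n34, n5⟩ := relator_lengths_ne hm
  have key3 := ncard_image_union (I := Finset.Icc 1 k) (f := conjPowRel k m)
    (fun i hi i' hi' e => by
      have h1 := congrArg (fun r => lead r.1) e
      simpa only [lead_conjPowRel hm (hI hi), lead_conjPowRel hm (hI hi')] using h1) key4.1 (by
      rintro i hi (⟨p', hp', e⟩ | ⟨p', hp', e⟩ | ⟨p', hp', e⟩ | ⟨p', hp', e⟩ | ⟨p', hp', e⟩ | h)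
      · have e := congrArg (fun r => dCount r.1) e
        simp only [dCount_braidRel (hI hp'), dCount_conjPowRel (hI hi)] at e
        exact n34 e.symm
      · have e := congrArg (fun r => dCount r.1) e
        simp only [dCount_farRel (hI2 hp').1 (hI2 hp').2, dCount_conjPowRel (hI hi)] at e
        exact (n5 (by have := (hI2 hp').2; omega)).2.2 e.symm
      · exact hne hm0 hm0 (hl hp').1 (hl hp').2 e
      · exact hne hq hq (hl hp').1 (hl hp').2 e
      · exact hne hq hm0 (hfar hp').1 (hfar hp').2.1 e
      · exact h)
  have key2 := ncard_image_union (I := Finset.Icc 1 k) (f := powRel k m)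
    (fun i hi i' hi' e => by
      have h1 := congrArg (fun r => lead r.1) e
      simpa only [lead_powRel hm (hI hi), lead_powRel hm (hI hi')] using h1) key3.1 (by
      rintro i hi (⟨p', hp', e⟩ | ⟨p', hp', e⟩ | ⟨p', hp', e⟩ | ⟨p', hp', e⟩ | ⟨p', hp', e⟩ |
        ⟨p', hp', e⟩ | h)
      · have e := congrArg (fun r => dCount r.1) e
        simp only [dCount_conjPowRel (hI hp'), dCount_powRel (hI hi)] at e
        exact n23 e.symm
      · have e := congrArg (fun r => dCount r.1) e
        simp only [dCount_braidRel (hI hp'), dCount_powRel (hI hi)] at e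
        exact n24 e.symm
      · have e := congrArg (fun r => dCount r.1) e
        simp only [dCount_farRel (hI2 hp').1 (hI2 hp').2, dCount_powRel (hI hi)] at e
        exact (n5 (by have := (hI2 hp').2; omega)).2.1 e.symm
      · exact hne hm0 hm0 (hl hp').1 (hl hp').2 e
      · exact hne hq hq (hl hp').1 (hl hp').2 e
      · exact hne hq hm0 (hfar hp').1 (hfar hp').2.1 e
      · exact h)
  have key1 := ncard_image_union (I := Finset.Icc 1 k) (f := sqRel k m)
    (fun i hi i' hi' e => by
      have h1 := congrArg (fun r => lead r.1) e
      simp only [lead_sqRel hm (hI hi), lead_sqRel hm (hI hi')] at h1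
      exact prevIdx_inj (hI hi).1 (hI hi).2 (hI hi').1 (hI hi').2 h1) key2.1 (by
      rintro i hi (⟨p', hp', e⟩ | ⟨p', hp', e⟩ | ⟨p', hp', e⟩ | ⟨p', hp', e⟩ | ⟨p', hp', e⟩ |
        ⟨p', hp', e⟩ | ⟨p', hp', e⟩ | h)
      · have e := congrArg (fun r => dCount r.1) e
        simp only [dCount_powRel (hI hp'), dCount_sqRel (hI hi)] at e
        exact n12 e.symm
      · have e := congrArg (fun r => dCount r.1) e
        simp only [dCount_conjPowRel (hI hp'), dCount_sqRel (hI hi)] at e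
        exact n13 e.symm
      · have e := congrArg (fun r => dCount r.1) e
        simp only [dCount_braidRel (hI hp'), dCount_sqRel (hI hi)] at e
        exact n14 e.symm
      · have e := congrArg (fun r => dCount r.1) e
        simp only [dCount_farRel (hI2 hp').1 (hI2 hp').2, dCount_sqRel (hI hi)] at e
        exact (n5 (by have := (hI2 hp').2; omega)).1 e.symm
      · exact hne hm0 hm0 (hl hp').1 (hl hp').2 e
      · exact hne hq hq (hl hp').1 (hl hp').2 e
      · exact hne hq hm0 (hfar hp').1 (hfar hp').2.1 e
      · exact h)
  rw [setOf_V_eq hk]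
  refine ⟨key1.1, ?_⟩
  rw [key1.2, key2.2, key3.2, key4.2, key5.2, key6.2, key7.2, key8.2, Set.ncard_empty,
    card_farPairs hk, Finset.card_product, Nat.card_Icc, Nat.card_Icc]
  have hc : 2 * (ltPairs k).card = k * (k - 1) := card_lt_pairs k
  rw [show k + 1 - 1 = k by omega, show m - 2 + 1 - 2 = m - 3 by omega]
  omega

end CountV

/-! ### The number of relations in `W` -/

section CountW

variable {k : ℕ}

/-- The number of letters `x_i`, the first letter, and the sum of the indices of the letters `x_i`
of the word on the right of a relation. -/
def rightStat (r : FreeMonoid (Letter k) × FreeMonoid (Letter k)) : ℕ × ℕ × ℕ :=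
  (xCount r.2, lead r.2, xSum r.2)

theorem rightStat_one {u : FreeMonoid (Letter k)} {a : ℕ} (ha : a < k) :
    rightStat (u, x k a) = (1, k + 1 + a, a) := by
  rw [rightStat, xCount_x ha, lead_x ha, xSum_x ha]

theorem rightStat_two {u : FreeMonoid (Letter k)} {a b : ℕ} (ha : a < k) (hb : b < k) :
    rightStat (u, x k a * x k b) = (2, k + 1 + a, a + b) := by
  rw [rightStat, xCount_mul, xSum_mul, lead_x_mul ha, xCount_x ha, xCount_x hb, xSum_x ha,
    xSum_x hb]

theorem rightStat_three {u : FreeMonoid (Letter k)} {a b c : ℕ} (ha : a < k) (hb : b < k)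
    (hc : c < k) : rightStat (u, x k a * x k b * x k c) = (3, k + 1 + a, a + b + c) := by
  rw [rightStat, xCount_mul, xSum_mul, xCount_mul, xSum_mul, mul_assoc, lead_x_mul ha, xCount_x ha,
    xCount_x hb, xCount_x hc, xSum_x ha, xSum_x hb, xSum_x hc]

/-- Squares on the right are spelled out as products to match the statements on `rightStat`. The
condition `i + 1 < j` of `w2` becomes `i < j - 1`, so pairs up to `k - 2` parametrise that family.
-/
theorem setOf_W_eq (hk : 2 ≤ k) :
    {r : FreeMonoid (Letter k) × FreeMonoid (Letter k) | W k r.1 r.2} =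
      (fun i => (x k i * x k 0, x k 0 * x k (i + 1))) '' (Finset.Icc 1 (k - 2) : Finset ℕ) ∪
      ((fun p : ℕ × ℕ => (x k (p.2 + 1) * x k p.1, x k p.1 * x k (p.2 + 1))) '' (ltPairs (k - 2)) ∪
      ((fun _ : ℕ => (x k 0 ^ 2 * x k 1, x k 0 * x k 0)) '' (({0} : Finset ℕ) : Set ℕ) ∪
      ((fun _ : ℕ => (x k 0 ^ 2, x k (k - 1) * x k 0 * x k 0)) '' (({0} : Finset ℕ) : Set ℕ) ∪
      ((fun i => (x k (i + 1) * x k i * x k (i + 1), x k (i + 1) * x k i)) ''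
        (Finset.Icc 1 (k - 2) : Finset ℕ) ∪
      ((fun i => (x k (i + 1) * x k i, x k i * x k (i + 1) * x k i)) ''
        (Finset.Icc 1 (k - 2) : Finset ℕ) ∪
      ((fun i => (xRun k i k * xRun k 0 i * x k i, x k i)) '' (Finset.range k : Finset ℕ) ∪
      ((fun i => (xRun k (i + 1) k * xRun k 0 i * x k i ^ 2, x k i * x k i)) ''
        (Finset.Icc 1 (k - 1) : Finset ℕ) ∪ ∅))))))) := by
  have hI : ∀ i n, i ∈ ((Finset.Icc 1 n : Finset ℕ) : Set ℕ) ↔ 1 ≤ i ∧ i ≤ n := fun i n => by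
    rw [Finset.mem_coe, Finset.mem_Icc]
  have h0 : (0 : ℕ) ∈ (({0} : Finset ℕ) : Set ℕ) := Finset.mem_singleton_self 0
  ext ⟨u, v⟩
  constructor
  · intro h
    change W k u v at h
    cases h with
    | w1 i h1 h2 => exact .inl ⟨i, (hI _ _).2 ⟨h1, h2⟩, rfl⟩
    | w2 i j h1 h2 h3 =>
      refine .inr (.inl ⟨(i, j - 1), mem_ltPairs.2 ?_, ?_⟩)
      · simp only
        omega
      · simp only [Nat.sub_add_cancel (show 1 ≤ j by omega)]
    | w3_left => exact .inr (.inr (.inl ⟨0, h0, by simp only [pow_two]⟩))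
    | w3_right => exact .inr (.inr (.inr (.inl ⟨0, h0, by simp only [pow_two, mul_assoc]⟩)))
    | w4_left i h1 h2 => exact .inr (.inr (.inr (.inr (.inl ⟨i, (hI _ _).2 ⟨h1, h2⟩, rfl⟩))))
    | w4_right i h1 h2 =>
      exact .inr (.inr (.inr (.inr (.inr (.inl ⟨i, (hI _ _).2 ⟨h1, h2⟩, rfl⟩)))))
    | w5 i h =>
      exact .inr (.inr (.inr (.inr (.inr (.inr (.inl
        ⟨i, Finset.mem_coe.2 (Finset.mem_range.2 (by omega)), rfl⟩))))))
    | w6 i h1 h2 =>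
      exact .inr (.inr (.inr (.inr (.inr (.inr (.inr (.inl
        ⟨i, (hI _ _).2 ⟨h1, h2⟩, by simp only [pow_two]⟩)))))))
  · rintro (⟨i, hi, e⟩ | ⟨⟨i, j⟩, hi, e⟩ | ⟨_, _, e⟩ | ⟨_, _, e⟩ | ⟨i, hi, e⟩ | ⟨i, hi, e⟩ |
      ⟨i, hi, e⟩ | ⟨i, hi, e⟩ | h)
    · obtain ⟨rfl, rfl⟩ := Prod.ext_iff.1 e
      rw [hI] at hi
      exact W.w1 i hi.1 hi.2
    · obtain ⟨rfl, rfl⟩ := Prod.ext_iff.1 e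
      have hi := mem_ltPairs.1 hi
      simp only at hi
      exact W.w2 i (j + 1) (by omega) (by omega) (by omega)
    · obtain ⟨rfl, rfl⟩ := Prod.ext_iff.1 e
      simpa only [← pow_two] using! W.w3_left
    · obtain ⟨rfl, rfl⟩ := Prod.ext_iff.1 e
      simpa only [pow_two, mul_assoc] using! W.w3_right (k := k)
    · obtain ⟨rfl, rfl⟩ := Prod.ext_iff.1 e
      rw [hI] at hi
      exact W.w4_left i hi.1 hi.2
    · obtain ⟨rfl, rfl⟩ := Prod.ext_iff.1 e
      rw [hI] at hi
      exact W.w4_right i hi.1 hi.2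
    · obtain ⟨rfl, rfl⟩ := Prod.ext_iff.1 e
      exact W.w5 i (by have := Finset.mem_range.1 (Finset.mem_coe.1 hi); omega)
    · obtain ⟨rfl, rfl⟩ := Prod.ext_iff.1 e
      rw [hI] at hi
      simpa only [← pow_two] using! W.w6 i hi.1 hi.2
    · exact h.elim

/-- The right-hand words alone distinguish all the relations: they have one to three letters, and
their length, first letter and sum of indices determine the family and the parameters. Apart from
the pairs there are `3(k-2) + 2 + k + (k-1) = 5(k-1)` relations. -/
theorem ncard_W (hk : 2 ≤ k) :
    {r : FreeMonoid (Letter k) × FreeMonoid (Letter k) | W k r.1 r.2}.Finite ∧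
    2 * {r : FreeMonoid (Letter k) × FreeMonoid (Letter k) | W k r.1 r.2}.ncard =
      (k - 2) * (k - 2 - 1) + 10 * (k - 1) := by
  have hI : ∀ {i n}, i ∈ Finset.Icc 1 n ↔ 1 ≤ i ∧ i ≤ n := Finset.mem_Icc
  have hI' : ∀ {i n}, i ∈ ((Finset.Icc 1 n : Finset ℕ) : Set ℕ) ↔ 1 ≤ i ∧ i ≤ n := hI
  have hr' : ∀ {i}, i ∈ ((Finset.range k : Finset ℕ) : Set ℕ) ↔ i < k := Finset.mem_range
  have hl : ∀ {p : ℕ × ℕ}, p ∈ ltPairs (k - 2) ↔ 1 ≤ p.1 ∧ p.1 < p.2 ∧ p.2 ≤ k - 2 := mem_ltPairs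
  have hl' : ∀ {p : ℕ × ℕ}, p ∈ (ltPairs (k - 2) : Set (ℕ × ℕ)) ↔
    1 ≤ p.1 ∧ p.1 < p.2 ∧ p.2 ≤ k - 2 := mem_ltPairs
  have key8 := ncard_image_union (I := Finset.Icc 1 (k - 1))
    (f := fun i => (xRun k (i + 1) k * xRun k 0 i * x k i ^ 2, x k i * x k i)) (S := ∅)
    (fun i hi i' hi' e => by
      rw [hI] at hi hi'
      have e := congrArg rightStat e
      rw [rightStat_two (by omega) (by omega), rightStat_two (by omega) (by omega)] at e
      simp only [Prod.mk.injEq] at e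
      omega) Set.finite_empty (fun _ _ h => h)
  have key7 := ncard_image_union (I := Finset.range k)
    (f := fun i => (xRun k i k * xRun k 0 i * x k i, x k i))
    (fun i hi i' hi' e => by
      rw [Finset.mem_range] at hi hi'
      have e := congrArg rightStat e
      rw [rightStat_one (by omega), rightStat_one (by omega)] at e
      simp only [Prod.mk.injEq] at e
      omega) key8.1 (by
      rintro i hi (⟨j, hj, e⟩ | h)
      · rw [hI'] at hj
        rw [Finset.mem_range] at hi
        have e := congrArg rightStat e
        rw [rightStat_two (by omega) (by omega), rightStat_one (by omega)] at e
        simp only [Prod.mk.injEq] at e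
        omega
      · exact h)
  have key6 := ncard_image_union (I := Finset.Icc 1 (k - 2))
    (f := fun i => (x k (i + 1) * x k i, x k i * x k (i + 1) * x k i))
    (fun i hi i' hi' e => by
      rw [hI] at hi hi'
      have e := congrArg rightStat e
      rw [rightStat_three (by omega) (by omega) (by omega),
        rightStat_three (by omega) (by omega) (by omega)] at e
      simp only [Prod.mk.injEq] at e
      omega) key7.1 (by
      rintro i hi h
      rw [hI] at hi
      have hs := rightStat_three (u := x k (i + 1) * x k i) (show i < k by omega)
        (show i + 1 < k by omega) (show i < k by omega)
      rcases h with ⟨j, hj, e⟩ | ⟨j, hj, e⟩ | h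
      · rw [hr'] at hj
        rw [← e, rightStat_one (by omega)] at hs
        simp only [Prod.mk.injEq] at hs
        omega
      · rw [hI'] at hj
        rw [← e, rightStat_two (by omega) (by omega)] at hs
        simp only [Prod.mk.injEq] at hs
        omega
      · exact h)
  have key5 := ncard_image_union (I := Finset.Icc 1 (k - 2))
    (f := fun i => (x k (i + 1) * x k i * x k (i + 1), x k (i + 1) * x k i))
    (fun i hi i' hi' e => by
      rw [hI] at hi hi'
      have e := congrArg rightStat e
      rw [rightStat_two (by omega) (by omega), rightStat_two (by omega) (by omega)] at e
      simp only [Prod.mk.injEq] at e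
      omega) key6.1 (by
      rintro i hi h
      rw [hI] at hi
      have hs := rightStat_two (u := x k (i + 1) * x k i * x k (i + 1)) (show i + 1 < k by omega)
        (show i < k by omega)
      rcases h with ⟨j, hj, e⟩ | ⟨j, hj, e⟩ | ⟨j, hj, e⟩ | h
      · rw [hI'] at hj
        rw [← e, rightStat_three (by omega) (by omega) (by omega)] at hs
        simp only [Prod.mk.injEq] at hs
        omega
      · rw [hr'] at hj
        rw [← e, rightStat_one (by omega)] at hs
        simp only [Prod.mk.injEq] at hs
        omega
      · rw [hI'] at hj
        rw [← e, rightStat_two (by omega) (by omega)] at hs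
        simp only [Prod.mk.injEq] at hs
        omega
      · exact h)
  have key4 := ncard_image_union (I := ({0} : Finset ℕ))
    (f := fun _ => (x k 0 ^ 2, x k (k - 1) * x k 0 * x k 0))
    (fun i hi i' hi' _ => by
      rw [Finset.mem_singleton] at hi hi'
      omega) key5.1 (by
      rintro _ _ h
      have hs := rightStat_three (u := x k 0 ^ 2) (show k - 1 < k by omega)
        (show 0 < k by omega) (show 0 < k by omega)
      rcases h with ⟨j, hj, e⟩ | ⟨j, hj, e⟩ | ⟨j, hj, e⟩ | ⟨j, hj, e⟩ | h
      · rw [hI'] at hj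
        rw [← e, rightStat_two (by omega) (by omega)] at hs
        simp only [Prod.mk.injEq] at hs
        omega
      · rw [hI'] at hj
        rw [← e, rightStat_three (by omega) (by omega) (by omega)] at hs
        simp only [Prod.mk.injEq] at hs
        omega
      · rw [hr'] at hj
        rw [← e, rightStat_one (by omega)] at hs
        simp only [Prod.mk.injEq] at hs
        omega
      · rw [hI'] at hj
        rw [← e, rightStat_two (by omega) (by omega)] at hs
        simp only [Prod.mk.injEq] at hs
        omega
      · exact h)
  have key3 := ncard_image_union (I := ({0} : Finset ℕ))
    (f := fun _ => (x k 0 ^ 2 * x k 1, x k 0 * x k 0))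
    (fun i hi i' hi' _ => by
      rw [Finset.mem_singleton] at hi hi'
      omega) key4.1 (by
      rintro _ _ h
      have hs := rightStat_two (u := x k 0 ^ 2 * x k 1) (show 0 < k by omega) (show 0 < k by omega)
      rcases h with ⟨_, _, e⟩ | ⟨j, hj, e⟩ | ⟨j, hj, e⟩ | ⟨j, hj, e⟩ | ⟨j, hj, e⟩ | h
      · rw [← e, rightStat_three (by omega) (by omega) (by omega)] at hs
        simp only [Prod.mk.injEq] at hs
        omega
      · rw [hI'] at hj
        rw [← e, rightStat_two (by omega) (by omega)] at hs
        simp only [Prod.mk.injEq] at hs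
        omega
      · rw [hI'] at hj
        rw [← e, rightStat_three (by omega) (by omega) (by omega)] at hs
        simp only [Prod.mk.injEq] at hs
        omega
      · rw [hr'] at hj
        rw [← e, rightStat_one (by omega)] at hs
        simp only [Prod.mk.injEq] at hs
        omega
      · rw [hI'] at hj
        rw [← e, rightStat_two (by omega) (by omega)] at hs
        simp only [Prod.mk.injEq] at hs
        omega
      · exact h)
  have key2 := ncard_image_union (I := ltPairs (k - 2))
    (f := fun p : ℕ × ℕ => (x k (p.2 + 1) * x k p.1, x k p.1 * x k (p.2 + 1)))
    (fun p hp p' hp' e => by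
      rw [hl] at hp hp'
      have e := congrArg rightStat e
      rw [rightStat_two (by omega) (by omega), rightStat_two (by omega) (by omega)] at e
      simp only [Prod.mk.injEq] at e
      exact Prod.ext (by omega) (by omega)) key3.1 (by
      rintro p hp h
      rw [hl] at hp
      have hs := rightStat_two (u := x k (p.2 + 1) * x k p.1) (show p.1 < k by omega)
        (show p.2 + 1 < k by omega)
      rcases h with ⟨_, _, e⟩ | ⟨_, _, e⟩ | ⟨j, hj, e⟩ | ⟨j, hj, e⟩ | ⟨j, hj, e⟩ | ⟨j, hj, e⟩ | h
      · rw [← e, rightStat_two (by omega) (by omega)] at hs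
        simp only [Prod.mk.injEq] at hs
        omega
      · rw [← e, rightStat_three (by omega) (by omega) (by omega)] at hs
        simp only [Prod.mk.injEq] at hs
        omega
      · rw [hI'] at hj
        rw [← e, rightStat_two (by omega) (by omega)] at hs
        simp only [Prod.mk.injEq] at hs
        omega
      · rw [hI'] at hj
        rw [← e, rightStat_three (by omega) (by omega) (by omega)] at hs
        simp only [Prod.mk.injEq] at hs
        omega
      · rw [hr'] at hj
        rw [← e, rightStat_one (by omega)] at hs
        simp only [Prod.mk.injEq] at hs
        omega
      · rw [hI'] at hj
        rw [← e, rightStat_two (by omega) (by omega)] at hs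
        simp only [Prod.mk.injEq] at hs
        omega
      · exact h)
  have key1 := ncard_image_union (I := Finset.Icc 1 (k - 2))
    (f := fun i => (x k i * x k 0, x k 0 * x k (i + 1)))
    (fun i hi i' hi' e => by
      rw [hI] at hi hi'
      have e := congrArg rightStat e
      rw [rightStat_two (by omega) (by omega), rightStat_two (by omega) (by omega)] at e
      simp only [Prod.mk.injEq] at e
      omega) key2.1 (by
      rintro i hi h
      rw [hI] at hi
      have hs := rightStat_two (u := x k i * x k 0) (show 0 < k by omega)
        (show i + 1 < k by omega)
      rcases h with ⟨p, hp, e⟩ | ⟨_, _, e⟩ | ⟨_, _, e⟩ | ⟨j, hj, e⟩ | ⟨j, hj, e⟩ | ⟨j, hj, e⟩ |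
        ⟨j, hj, e⟩ | h
      · rw [hl'] at hp
        rw [← e, rightStat_two (by omega) (by omega)] at hs
        simp only [Prod.mk.injEq] at hs
        omega
      · rw [← e, rightStat_two (by omega) (by omega)] at hs
        simp only [Prod.mk.injEq] at hs
        omega
      · rw [← e, rightStat_three (by omega) (by omega) (by omega)] at hs
        simp only [Prod.mk.injEq] at hs
        omega
      · rw [hI'] at hj
        rw [← e, rightStat_two (by omega) (by omega)] at hs
        simp only [Prod.mk.injEq] at hs
        omega
      · rw [hI'] at hj
        rw [← e, rightStat_three (by omega) (by omega) (by omega)] at hs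
        simp only [Prod.mk.injEq] at hs
        omega
      · rw [hr'] at hj
        rw [← e, rightStat_one (by omega)] at hs
        simp only [Prod.mk.injEq] at hs
        omega
      · rw [hI'] at hj
        rw [← e, rightStat_two (by omega) (by omega)] at hs
        simp only [Prod.mk.injEq] at hs
        omega
      · exact h)
  rw [setOf_W_eq hk]
  refine ⟨key1.1, ?_⟩
  rw [key1.2, key2.2, key3.2, key4.2, key5.2, key6.2, key7.2, key8.2, Set.ncard_empty,
    Nat.card_Icc, Nat.card_Icc, Finset.card_range, Finset.card_singleton]
  have hc : 2 * (ltPairs (k - 2)).card = (k - 2) * (k - 2 - 1) := card_lt_pairs (k - 2)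
  omega

end CountW

/-! ### The number of relations in `V'` -/

section CountV'

variable {k m : ℕ}

/-- A family of words in the letters `d_i`, of the same length `c`, that is determined by the first
letters. -/
structure IsUnitWordFamily (k c : ℕ) (g : ℕ → FreeMonoid (Letter k)) : Prop where
  lead_mem : ∀ i, 1 ≤ i → i ≤ k → 1 ≤ lead (g i) ∧ lead (g i) ≤ k
  lead_inj : ∀ i j, 1 ≤ i → i ≤ k → 1 ≤ j → j ≤ k → lead (g i) = lead (g j) → i = j
  dCount_eq : ∀ i, 1 ≤ i → i ≤ k → dCount (g i) = c

theorem isUnitWordFamily_transElt (hm : 2 ≤ m) :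
    IsUnitWordFamily k (m + (m - 1)) fun i => transElt k m (d k) i := by
  have h : ∀ i, 1 ≤ i → i ≤ k → lead (transElt k m (d k) i) = prevIdx k i := fun i h1 h2 =>
    have hp := prevIdx_mem h1 h2
    lead_d_pow_mul hp.1 hp.2 (by omega) _
  refine ⟨fun i h1 h2 => ?_, fun i j h1 h2 h3 h4 e => ?_, fun i h1 h2 => ?_⟩
  · rw [h i h1 h2]
    exact prevIdx_mem h1 h2
  · rw [h i h1 h2, h j h3 h4] at e
    exact prevIdx_inj h1 h2 h3 h4 e
  · exact dCount_powers (prevIdx_mem h1 h2) ⟨h1, h2⟩ _ _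

theorem isUnitWordFamily_pow (hm : 2 ≤ m) :
    IsUnitWordFamily k ((m - 1) ^ 2) fun i => d k i ^ (m - 1) ^ 2 := by
  have h : ∀ i, 1 ≤ i → i ≤ k → lead (d k i ^ (m - 1) ^ 2) = i := fun i h1 h2 =>
    lead_d_pow h1 h2 (pow_ne_zero 2 (by omega))
  refine ⟨fun i h1 h2 => ?_, fun i j h1 h2 h3 h4 e => ?_, fun i h1 h2 => ?_⟩
  · rw [h i h1 h2]
    exact ⟨h1, h2⟩
  · rwa [h i h1 h2, h j h3 h4] at e
  · rw [dCount_pow, dCount_d h1 h2, mul_one]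

/-- The point outside the domain of `x_i`. -/
def undefIdx (k i : ℕ) : ℕ := if i = 0 then 1 else k - i + 1

/-- The image of the point `j` under `x_i`. -/
def imageIdx (k i j : ℕ) : ℕ := if i = 0 then j - 1 else if j = k - i then k - i + 1 else j

theorem undefIdx_mem {i : ℕ} (hi : i < k) : 1 ≤ undefIdx k i ∧ undefIdx k i ≤ k := by
  rw [undefIdx]
  split_ifs <;> omega

theorem imageIdx_mem {i j : ℕ} (hi : i < k) (h1 : 1 ≤ j) (h2 : j ≤ k) (hj : j ≠ undefIdx k i) :
    1 ≤ imageIdx k i j ∧ imageIdx k i j ≤ k := by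
  rw [undefIdx] at hj
  rw [imageIdx]
  split_ifs at hj ⊢ <;> omega

/-- The pairs of an index `i` and a point in the domain of `x_i`. -/
def domPairs (k : ℕ) : Finset (Σ _ : ℕ, ℕ) :=
  (Finset.range k).sigma fun i => (Finset.Icc 1 k).erase (undefIdx k i)

theorem mem_domPairs {p : Σ _ : ℕ, ℕ} :
    p ∈ domPairs k ↔ p.1 < k ∧ 1 ≤ p.2 ∧ p.2 ≤ k ∧ p.2 ≠ undefIdx k p.1 := by
  simp only [domPairs, Finset.mem_sigma, Finset.mem_erase, Finset.mem_Icc, Finset.mem_range]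
  tauto

theorem card_domPairs (k : ℕ) : (domPairs k).card = k * (k - 1) := by
  rw [domPairs, Finset.card_sigma, Finset.sum_const_nat (m := k - 1), Finset.card_range]
  intro i hi
  rw [Finset.mem_range] at hi
  rw [Finset.card_erase_of_mem (Finset.mem_Icc.2 (undefIdx_mem hi)), Nat.card_Icc]
  omega

/-- The relations by which the letters `x_i` absorb the words `g j` on the left. -/
def absorbLeft (g : ℕ → FreeMonoid (Letter k)) (i : ℕ) :
    FreeMonoid (Letter k) × FreeMonoid (Letter k) := (g (undefIdx k i) * x k i, x k i)

/-- The relations by which the letters `x_i` absorb the words `g j` on the right. -/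
def absorbRight (g : ℕ → FreeMonoid (Letter k)) (i : ℕ) :
    FreeMonoid (Letter k) × FreeMonoid (Letter k) := (x k i * g (k - i), x k i)

/-- The relations by which the words `g j` move past the letters `x_i`. -/
def movePast (g : ℕ → FreeMonoid (Letter k)) (p : Σ _ : ℕ, ℕ) :
    FreeMonoid (Letter k) × FreeMonoid (Letter k) :=
  (x k p.1 * g (imageIdx k p.1 p.2), g p.2 * x k p.1)

/-- All relations between the letters `x_i` and the words `g j`. -/
def mixedRels (g : ℕ → FreeMonoid (Letter k)) :
    Set (FreeMonoid (Letter k) × FreeMonoid (Letter k)) :=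
  absorbLeft g '' (Finset.range k : Finset ℕ) ∪ (absorbRight g '' (Finset.range k : Finset ℕ) ∪
    (movePast g '' (domPairs k) ∪ ∅))

/-- For each of the two families of unit words, a letter `x_i` has one relation for the point
outside its domain, one for the point outside its image and one for each point of its domain. -/
theorem setOf_V'_eq (hk : 2 ≤ k) :
    {r : FreeMonoid (Letter k) × FreeMonoid (Letter k) | V' k m r.1 r.2} =
      mixedRels (fun i => transElt k m (d k) i) ∪ mixedRels (fun i => d k i ^ (m - 1) ^ 2) := by
  have hr : ∀ i, i ∈ ((Finset.range k : Finset ℕ) : Set ℕ) ↔ i < k := fun i => by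
    rw [Finset.mem_coe, Finset.mem_range]
  have hp : ∀ {i}, 1 ≤ i → prevIdx k (i + 1) = i := fun h => prevIdx_succ k h
  have hp' : ∀ {i j}, i = j + 1 → 1 ≤ j → prevIdx k i = j := fun h h1 => h ▸ prevIdx_succ k h1
  have hu : ∀ i, i ≠ 0 → undefIdx k i = k - i + 1 := fun i h => if_neg h
  have hi0 : ∀ j, imageIdx k 0 j = j - 1 := fun j => if_pos rfl
  have hi1 : ∀ i, i ≠ 0 → imageIdx k i (k - i) = k - i + 1 := fun i h => by
    rw [imageIdx, if_neg h, if_pos rfl]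
  have hi2 : ∀ i j, i ≠ 0 → j ≠ k - i → imageIdx k i j = j := fun i j h h' => by
    rw [imageIdx, if_neg h, if_neg h']
  have hd : ∀ i j, i < k → 1 ≤ j → j ≤ k → j ≠ undefIdx k i →
      (⟨i, j⟩ : Σ _ : ℕ, ℕ) ∈ (domPairs k : Set (Σ _ : ℕ, ℕ)) := fun i j h1 h2 h3 h4 =>
    mem_domPairs.2 ⟨h1, h2, h3, h4⟩
  ext ⟨u, v⟩
  constructor
  · intro h
    change V' k m u v at h
    cases h with
    | v1_a => exact .inl (.inl ⟨0, (hr _).2 (by omega), rfl⟩)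
    | v1_b => exact .inr (.inl ⟨0, (hr _).2 (by omega), rfl⟩)
    | v2_a_first =>
      refine .inl (.inr (.inr (.inl ⟨⟨0, 2⟩, hd _ _ (by omega) (by omega) hk (show 2 ≠ 1 by omega), ?_⟩)))
      simp only [movePast, hi0, transElt, prevIdx_one, hp' (show 2 = 1 + 1 from rfl) le_rfl,
        show 2 - 1 = 1 from rfl, ← mul_assoc]
    | v2_a i h1 h2 =>
      refine .inl (.inr (.inr (.inl ⟨⟨0, i + 2⟩,
        hd _ _ (by omega) (by omega) (by omega) (show i + 2 ≠ 1 by omega), ?_⟩)))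
      simp only [movePast, hi0, transElt, hp h1, hp (show 1 ≤ i + 1 by omega),
        show i + 2 - 1 = i + 1 by omega, ← mul_assoc]
    | v2_b i h1 h2 =>
      refine .inr (.inr (.inr (.inl ⟨⟨0, i + 1⟩,
        hd _ _ (by omega) (by omega) (by omega) (show i + 1 ≠ 1 by omega), ?_⟩)))
      simp only [movePast, hi0, Nat.add_sub_cancel]
    | v3_a i h =>
      refine .inl (.inr (.inl ⟨i, (hr _).2 (by omega), ?_⟩))
      simp only [absorbRight, transElt, ← mul_assoc,
        hp' (show k - i = k - i - 1 + 1 by omega) (by omega)]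
    | v3_a_last =>
      refine .inl (.inr (.inl ⟨k - 1, (hr _).2 (by omega), ?_⟩))
      simp only [absorbRight, transElt, ← mul_assoc, show k - (k - 1) = 1 by omega, prevIdx_one]
    | v3_b i h => exact .inr (.inr (.inl ⟨i, (hr _).2 (by omega), rfl⟩))
    | v4_a i h1 h2 =>
      refine .inl (.inl ⟨k - i, (hr _).2 (by omega), ?_⟩)
      simp only [absorbLeft, transElt, hu (k - i) (by omega), show k - (k - i) = i by omega, hp h1]
    | v4_b i h1 h2 =>
      refine .inr (.inl ⟨k - i, (hr _).2 (by omega), ?_⟩)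
      simp only [absorbLeft, hu (k - i) (by omega), show k - (k - i) = i by omega]
    | v5_a i h1 h2 =>
      refine .inl (.inr (.inr (.inl ⟨⟨i, k - i⟩, hd _ _ (by omega) (by omega) (by omega)
        (by rw [hu i (by omega)]; omega), ?_⟩)))
      simp only [movePast, hi1 i (by omega), transElt, ← mul_assoc,
        hp (show 1 ≤ k - i by omega),
        hp' (show k - i = k - i - 1 + 1 by omega) (show 1 ≤ k - i - 1 by omega)]
    | v5_a_last =>
      refine .inl (.inr (.inr (.inl ⟨⟨k - 1, 1⟩, hd _ _ (by omega) (by omega) (by omega)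
        (by rw [hu _ (by omega)]; omega), ?_⟩)))
      have e := hi1 (k - 1) (by omega)
      rw [show k - (k - 1) = 1 by omega] at e
      simp only [movePast, e, transElt, ← mul_assoc, hp le_rfl, prevIdx_one]
    | v5_b i h1 h2 =>
      refine .inr (.inr (.inr (.inl ⟨⟨i, k - i⟩, hd _ _ (by omega) (by omega) (by omega)
        (by rw [hu i (by omega)]; omega), ?_⟩)))
      simp only [movePast, hi1 i (by omega)]
    | v6_a_first i h1 h2 =>
      refine .inl (.inr (.inr (.inl ⟨⟨i, 1⟩, hd _ _ (by omega) (by omega) (by omega)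
        (by rw [hu i (by omega)]; omega), ?_⟩)))
      simp only [movePast, hi2 i 1 (by omega) (by omega), transElt, ← mul_assoc, prevIdx_one]
    | v6_a i j h1 h2 h3 h4 h5 h6 =>
      refine .inl (.inr (.inr (.inl ⟨⟨i, j + 1⟩, hd _ _ (by omega) (by omega) (by omega)
        (by rw [hu i (by omega)]; omega), ?_⟩)))
      simp only [movePast, hi2 i (j + 1) (by omega) (by omega), transElt, ← mul_assoc, hp h3]
    | v6_b i j h1 h2 h3 h4 h5 h6 =>
      refine .inr (.inr (.inr (.inl ⟨⟨i, j⟩, hd _ _ (by omega) (by omega) (by omega)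
        (by rw [hu i (by omega)]; omega), ?_⟩)))
      simp only [movePast, hi2 i j (by omega) (by omega)]
  · rintro ((⟨i, hi, e⟩ | ⟨i, hi, e⟩ | ⟨⟨i, j⟩, hi, e⟩ | h) |
      (⟨i, hi, e⟩ | ⟨i, hi, e⟩ | ⟨⟨i, j⟩, hi, e⟩ | h))
    · obtain ⟨rfl, rfl⟩ := Prod.ext_iff.1 e
      rw [hr] at hi
      rcases Nat.eq_zero_or_pos i with rfl | h0
      · exact V'.v1_a
      · have := V'.v4_a (k := k) (m := m) (k - i) (by omega) (by omega)
        rw [show k - (k - i) = i by omega] at this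
        simpa only [absorbLeft, transElt, hu i (by omega), hp (show 1 ≤ k - i by omega)] using! this
    · obtain ⟨rfl, rfl⟩ := Prod.ext_iff.1 e
      rw [hr] at hi
      rcases Nat.lt_or_ge (k - 2) i with h0 | h0
      · obtain rfl : i = k - 1 := by omega
        simpa only [absorbRight, transElt, ← mul_assoc, show k - (k - 1) = 1 by omega,
          prevIdx_one] using! V'.v3_a_last (k := k) (m := m)
      · simpa only [absorbRight, transElt, ← mul_assoc,
          hp' (show k - i = k - i - 1 + 1 by omega) (show 1 ≤ k - i - 1 by omega)]
          using! V'.v3_a (m := m) i h0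
    · obtain ⟨rfl, rfl⟩ := Prod.ext_iff.1 e
      obtain ⟨h1, h2, h3, h4⟩ := mem_domPairs.1 hi
      simp only at h1 h2 h3 h4
      rcases Nat.eq_zero_or_pos i with rfl | h0
      · change j ≠ 1 at h4
        rcases Nat.lt_or_ge 2 j with h5 | h5
        · obtain ⟨l, rfl⟩ : ∃ l, j = l + 2 := ⟨j - 2, by omega⟩
          simpa only [movePast, hi0, transElt, hp (show 1 ≤ l by omega),
            hp (show 1 ≤ l + 1 by omega), show l + 2 - 1 = l + 1 by omega, ← mul_assoc]
            using! V'.v2_a (m := m) l (by omega) (by omega)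
        · obtain rfl : j = 2 := by omega
          simpa only [movePast, hi0, transElt, prevIdx_one, hp' (show 2 = 1 + 1 from rfl) le_rfl,
            show 2 - 1 = 1 from rfl, ← mul_assoc] using! V'.v2_a_first (k := k) (m := m)
      · rw [hu i (by omega)] at h4
        by_cases h5 : j = k - i
        · subst h5
          rcases Nat.lt_or_ge (k - 2) i with h6 | h6
          · obtain rfl : i = k - 1 := by omega
            have e := hi1 (k - 1) (by omega)
            rw [show k - (k - 1) = 1 by omega] at e
            simpa only [movePast, e, transElt, ← mul_assoc, hp le_rfl, prevIdx_one,
              show k - (k - 1) = 1 by omega] using! V'.v5_a_last (k := k) (m := m)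
          · simpa only [movePast, hi1 i (by omega), transElt, ← mul_assoc,
              hp (show 1 ≤ k - i by omega), hp' (show k - i = k - i - 1 + 1 by omega)
                (show 1 ≤ k - i - 1 by omega)] using! V'.v5_a (m := m) i h0 h6
        · rcases Nat.eq_or_lt_of_le h2 with h6 | h6
          · subst h6
            simpa only [movePast, hi2 i 1 (by omega) (by omega), transElt, ← mul_assoc,
              prevIdx_one] using! V'.v6_a_first (m := m) i h0 (by omega)
          · obtain ⟨l, rfl⟩ : ∃ l, j = l + 1 := ⟨j - 1, by omega⟩
            simpa only [movePast, hi2 i (l + 1) (by omega) (by omega), transElt, ← mul_assoc,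
              hp (show 1 ≤ l by omega)] using! V'.v6_a (m := m) i l h0 (by omega) (by omega)
                (by omega) (by omega) (by omega)
    · exact h.elim
    · obtain ⟨rfl, rfl⟩ := Prod.ext_iff.1 e
      rw [hr] at hi
      rcases Nat.eq_zero_or_pos i with rfl | h0
      · exact V'.v1_b
      · have := V'.v4_b (k := k) (m := m) (k - i) (by omega) (by omega)
        rw [show k - (k - i) = i by omega] at this
        simpa only [absorbLeft, hu i (by omega)] using! this
    · obtain ⟨rfl, rfl⟩ := Prod.ext_iff.1 e
      rw [hr] at hi
      exact V'.v3_b i (by omega)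
    · obtain ⟨rfl, rfl⟩ := Prod.ext_iff.1 e
      obtain ⟨h1, h2, h3, h4⟩ := mem_domPairs.1 hi
      simp only at h1 h2 h3 h4
      rcases Nat.eq_zero_or_pos i with rfl | h0
      · change j ≠ 1 at h4
        obtain ⟨l, rfl⟩ : ∃ l, j = l + 1 := ⟨j - 1, by omega⟩
        simpa only [movePast, hi0, Nat.add_sub_cancel]
          using! V'.v2_b (m := m) l (by omega) (by omega)
      · rw [hu i (by omega)] at h4
        by_cases h5 : j = k - i
        · subst h5
          simpa only [movePast, hi1 i (by omega)] using! V'.v5_b (m := m) i h0 (by omega)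
        · simpa only [movePast, hi2 i j (by omega) h5] using!
            V'.v6_b (m := m) i j h0 (by omega) h2 h3 h5 h4
    · exact h.elim

namespace IsUnitWordFamily

variable {c : ℕ} {g : ℕ → FreeMonoid (Letter k)}

theorem dCount_mixedRels (hg : IsUnitWordFamily k c g)
    {r : FreeMonoid (Letter k) × FreeMonoid (Letter k)} (hr : r ∈ mixedRels g) :
    dCount r.1 = c ∧ xCount r.2 ≠ 0 := by
  rcases hr with ⟨i, hi, rfl⟩ | ⟨i, hi, rfl⟩ | ⟨⟨i, j⟩, hi, rfl⟩ | h
  · have hi : i < k := Finset.mem_range.1 hi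
    have := undefIdx_mem hi
    rw [absorbLeft, dCount_mul, dCount_x, hg.dCount_eq _ this.1 this.2, xCount_x hi]
    omega
  · have hi : i < k := Finset.mem_range.1 hi
    rw [absorbRight, dCount_mul, dCount_x, hg.dCount_eq _ (by omega) (by omega), xCount_x hi]
    omega
  · obtain ⟨h1, h2, h3, h4⟩ := mem_domPairs.1 hi
    have := imageIdx_mem h1 h2 h3 h4
    rw [movePast, dCount_mul, dCount_x, hg.dCount_eq _ this.1 this.2, xCount_mul, xCount_x h1]
    omega
  · exact h.elim

/-- The three kinds differ in whether the left and the right word begin with a letter `d` (code at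
most `k`) or a letter `x` (code above `k`). Within a kind, the codes determine the parameters. The
total is `k + k + k(k-1)`. -/
theorem ncard_mixedRels (hg : IsUnitWordFamily k c g) :
    (mixedRels g).Finite ∧ (mixedRels g).ncard = k * (k + 1) := by
  have hr : ∀ {i}, i ∈ ((Finset.range k : Finset ℕ) : Set ℕ) ↔ i < k := Finset.mem_range
  have hleft : ∀ {i}, i ∈ Finset.range k →
      lead (absorbLeft g i).1 ≤ k ∧ lead (absorbLeft g i).2 = k + 1 + i := fun {i} hi => by
    have hi := Finset.mem_range.1 hi
    have h1 := undefIdx_mem hi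
    have h2 := hg.lead_mem _ h1.1 h1.2
    rw [absorbLeft, lead_mul (by omega), lead_x hi]
    omega
  have hright : ∀ {i}, i ∈ Finset.range k →
      lead (absorbRight g i).1 = k + 1 + i ∧ lead (absorbRight g i).2 = k + 1 + i :=
    fun {i} hi => by
      have hi := Finset.mem_range.1 hi
      rw [absorbRight, lead_x_mul hi, lead_x hi]
      omega
  have hmove : ∀ {p}, p ∈ domPairs k → lead (movePast g p).1 = k + 1 + p.1 ∧
      lead (movePast g p).2 = lead (g p.2) ∧ lead (g p.2) ≤ k := fun {p} hp => by
    obtain ⟨h1, h2, h3, h4⟩ := mem_domPairs.1 hp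
    have h5 := hg.lead_mem _ h2 h3
    rw [movePast, lead_x_mul h1, lead_mul (by omega)]
    exact ⟨rfl, rfl, h5.2⟩
  have key3 := ncard_image_union (I := domPairs k) (f := movePast g) (S := ∅)
    (fun ⟨i, j⟩ hp ⟨i', j'⟩ hp' e => by
      have h := hmove hp
      have h' := hmove hp'
      rw [e] at h
      obtain ⟨-, h2, h3, -⟩ := mem_domPairs.1 hp
      obtain ⟨-, h2', h3', -⟩ := mem_domPairs.1 hp'
      obtain rfl : i = i' := by
        have := h.1.symm.trans h'.1
        simp only at this
        omega
      obtain rfl : j = j' := hg.lead_inj _ _ h2 h3 h2' h3' (h.2.1.symm.trans h'.2.1)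
      rfl) Set.finite_empty (fun _ _ h => h)
  have key2 := ncard_image_union (I := Finset.range k) (f := absorbRight g)
    (fun i hi i' hi' e => by
      have h := hright hi
      have h' := hright hi'
      rw [e] at h
      omega) key3.1 (by
      rintro i hi (⟨p, hp, e⟩ | h)
      · have h := hright hi
        have h' := hmove hp
        rw [e] at h'
        omega
      · exact h)
  have key1 := ncard_image_union (I := Finset.range k) (f := absorbLeft g)
    (fun i hi i' hi' e => by
      have h := hleft hi
      have h' := hleft hi'
      rw [e] at h
      omega) key2.1 (by
      rintro i hi (⟨j, hj, e⟩ | ⟨p, hp, e⟩ | h)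
      · have h := hleft hi
        have h' := hright hj
        rw [e] at h'
        omega
      · have h := hleft hi
        have h' := hmove hp
        rw [e] at h'
        omega
      · exact h)
  refine ⟨key1.1, ?_⟩
  rw [mixedRels, key1.2, key2.2, key3.2, Set.ncard_empty, Finset.card_range, card_domPairs]
  rcases Nat.eq_zero_or_pos k with rfl | hk
  · rfl
  · obtain ⟨n, rfl⟩ : ∃ n, k = n + 1 := ⟨k - 1, by omega⟩
    rw [Nat.add_sub_cancel]
    ring

end IsUnitWordFamily

/-- The left words of the two families contain `2m - 1` and `(m-1)²` letters `d`. These numbers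
differ, since equality would mean `(m-2)² = 2`. -/
theorem ncard_V' (hk : 2 ≤ k) (hm : 2 ≤ m) :
    {r : FreeMonoid (Letter k) × FreeMonoid (Letter k) | V' k m r.1 r.2}.Finite ∧
    {r : FreeMonoid (Letter k) × FreeMonoid (Letter k) | V' k m r.1 r.2}.ncard =
      2 * (k * (k + 1)) := by
  have hT := isUnitWordFamily_transElt (k := k) hm
  have hB := isUnitWordFamily_pow (k := k) hm
  rw [setOf_V'_eq hk]
  refine ⟨hT.ncard_mixedRels.1.union hB.ncard_mixedRels.1, ?_⟩
  rw [Set.ncard_union_eq _ hT.ncard_mixedRels.1 hB.ncard_mixedRels.1, hT.ncard_mixedRels.2,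
    hB.ncard_mixedRels.2, two_mul]
  rw [Set.disjoint_left]
  intro r h h'
  have e := (hT.dCount_mixedRels h).1.symm.trans (hB.dCount_mixedRels h').1
  obtain ⟨l, rfl⟩ : ∃ l, m = l + 2 := ⟨m - 2, by omega⟩
  rw [show l + 2 - 1 = l + 1 by omega] at e
  rcases Nat.lt_or_ge l 2 with h1 | h1
  · interval_cases l <;> omega
  · nlinarith

end CountV'

/-! ### The total number of relations -/

section Total

variable {k m : ℕ}

theorem xCount_right_of_V {u v : FreeMonoid (Letter k)} (h : V k m u v) :
    xCount v = 0 := by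
  cases h <;> simp only [xCount_mul, xCount_pow, xCount_d, xCount_one, mul_zero, add_zero]

theorem dCount_left_of_W {u v : FreeMonoid (Letter k)} (h : W k u v) : dCount u = 0 := by
  cases h <;> simp only [dCount_mul, dCount_pow, dCount_x, dCount_xRun, mul_zero, add_zero]

theorem xCount_right_of_W (hk : 2 ≤ k) {u v : FreeMonoid (Letter k)} (h : W k u v) :
    xCount v ≠ 0 := by
  cases h with
  | w1 i h1 h2 => rw [xCount_mul, xCount_x (by omega)]; omega
  | w2 i j h1 h2 h3 => rw [xCount_mul, xCount_x (by omega)]; omega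
  | w3_left => rw [xCount_pow, xCount_x (by omega)]; omega
  | w3_right => rw [xCount_mul, xCount_x (by omega)]; omega
  | w4_left i h1 h2 => rw [xCount_mul, xCount_x (by omega)]; omega
  | w4_right i h1 h2 => rw [xCount_mul, xCount_x (i := i) (by omega)]; omega
  | w5 i h => rw [xCount_x (by omega)]; omega
  | w6 i h1 h2 => rw [xCount_pow, xCount_x (by omega)]; omega

/-- The three sets are disjoint: right sides of `V` contain no `x`, in contrast to those of `W` and
`V'`, and left sides of `W` contain no `d`, in contrast to those of `V'`. -/
theorem two_mul_ncard_rels (hk : 2 ≤ k) (hm : 2 ≤ m) :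
    2 * {r : FreeMonoid (Letter k) × FreeMonoid (Letter k) | Rels k m r.1 r.2}.ncard =
      2 * (4 * k + k * (m - 3) + k * (k - 1) + k * (k - 2)) +
        ((k - 2) * (k - 2 - 1) + 10 * (k - 1)) + 2 * (2 * (k * (k + 1))) := by
  obtain ⟨f1, c1⟩ := ncard_V hk hm
  obtain ⟨f2, c2⟩ := ncard_W hk
  obtain ⟨f3, c3⟩ := ncard_V' hk hm
  have hV' : ∀ {r : FreeMonoid (Letter k) × FreeMonoid (Letter k)}, V' k m r.1 r.2 →
      dCount r.1 ≠ 0 ∧ xCount r.2 ≠ 0 := fun {r} h => by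
    have h : r ∈ {r : FreeMonoid (Letter k) × FreeMonoid (Letter k) | V' k m r.1 r.2} := h
    rw [setOf_V'_eq hk] at h
    rcases h with h | h
    · have := (isUnitWordFamily_transElt hm).dCount_mixedRels h
      omega
    · have h1 := (isUnitWordFamily_pow hm).dCount_mixedRels h
      have h2 : (m - 1) ^ 2 ≠ 0 := pow_ne_zero 2 (by omega)
      rw [h1.1]
      exact ⟨h2, h1.2⟩
  have e : {r : FreeMonoid (Letter k) × FreeMonoid (Letter k) | Rels k m r.1 r.2} =
      {r | V k m r.1 r.2} ∪ ({r | W k r.1 r.2} ∪ {r | V' k m r.1 r.2}) := rfl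
  have hWV' : Disjoint {r : FreeMonoid (Letter k) × FreeMonoid (Letter k) | W k r.1 r.2}
      {r | V' k m r.1 r.2} :=
    Set.disjoint_left.2 fun r h h' => (hV' h').1 (dCount_left_of_W h)
  have hVWV' : Disjoint {r : FreeMonoid (Letter k) × FreeMonoid (Letter k) | V k m r.1 r.2}
      ({r | W k r.1 r.2} ∪ {r | V' k m r.1 r.2}) := by
    refine Set.disjoint_left.2 fun r h h' => ?_
    rcases h' with h' | h'
    · exact xCount_right_of_W hk h' (xCount_right_of_V h)
    · exact (hV' h').2 (xCount_right_of_V h)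
  rw [e, Set.ncard_union_eq hVWV' f1 (f2.union f3), Set.ncard_union_eq hWV' f2 f3, mul_add,
    mul_add _ (Set.ncard _), c1, c2, c3, add_assoc (2 * _)]

theorem ncard_rels_of_three_le (hk : 2 ≤ k) (hm : 3 ≤ m) :
    ({r : FreeMonoid (Letter k) × FreeMonoid (Letter k) | Rels k m r.1 r.2}.ncard : ℚ) =
      (9 * (k : ℚ) ^ 2 + (2 * (m : ℚ) + 5) * k - 4) / 2 := by
  have h := two_mul_ncard_rels (k := k) (m := m) hk (by omega)
  generalize Set.ncard _ = N at h ⊢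
  obtain ⟨n, rfl⟩ : ∃ n, k = n + 2 := ⟨k - 2, by omega⟩
  obtain ⟨l, rfl⟩ : ∃ l, m = l + 3 := ⟨m - 3, by omega⟩
  -- This removes the truncated subtraction that comes from the pairs in `W`; it also holds for `n =
  -- 0`.
  have hn : n * (n - 1) + n = n * n := by cases n <;> simp [Nat.mul_succ]
  simp only [Nat.add_sub_cancel, show n + 2 - 1 = n + 1 by omega] at h
  -- The summand `4` is moved to the left so that the identity holds in the naturals before it is
  -- cast to the rationals.
  have e : 2 * N + 4 = 9 * (n + 2) ^ 2 + (2 * (l + 3) + 5) * (n + 2) := by linarith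
  have e' : 2 * (N : ℚ) + 4 = 9 * ((n : ℚ) + 2) ^ 2 + (2 * ((l : ℚ) + 3) + 5) * (n + 2) := by
    exact_mod_cast e
  push_cast
  linarith

/-- For `m = 2` the term `m - 3` truncates to `0`, so the number is the same as for `m = 3`. -/
theorem ncard_rels_of_eq_two (hk : 2 ≤ k) (hm : m = 2) :
    ({r : FreeMonoid (Letter k) × FreeMonoid (Letter k) | Rels k m r.1 r.2}.ncard : ℚ) =
      (9 * (k : ℚ) ^ 2 + 11 * k - 4) / 2 := by
  have h := two_mul_ncard_rels (k := k) (m := m) hk (by omega)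
  generalize Set.ncard _ = N at h ⊢
  obtain ⟨n, rfl⟩ : ∃ n, k = n + 2 := ⟨k - 2, by omega⟩
  subst hm
  have hn : n * (n - 1) + n = n * n := by cases n <;> simp [Nat.mul_succ]
  simp only [Nat.add_sub_cancel, show n + 2 - 1 = n + 1 by omega, show 2 - 3 = 0 from rfl,
    mul_zero] at h
  have e : 2 * N + 4 = 9 * (n + 2) ^ 2 + 11 * (n + 2) := by linarith
  have e' : 2 * (N : ℚ) + 4 = 9 * ((n : ℚ) + 2) ^ 2 + 11 * (n + 2) := by
    exact_mod_cast e
  push_cast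
  linarith

end Total

end POIPresentation

/-- The monoid is defined by the presentation, through the generators `d̄_i` and `x̄_i`; the
presentation has `2k` letters and, as a set of pairs of words, the stated number of relations. -/
theorem theorem3p12 (k m : ℕ) (hk : 2 ≤ k) (hm : 2 ≤ m) :
    (∃ e : PresentedMonoid (POIPresentation.Rels k m) ≃* POIPresentation.POI k m,
      (∀ i : Fin k,
        (e (PresentedMonoid.of _ (POIPresentation.Letter.d i)) :
          POIPresentation.PartialPerm (Fin (k * m))) = POIPresentation.dBar k m i) ∧
      (∀ i : Fin k,
        (e (PresentedMonoid.of _ (POIPresentation.Letter.x i)) :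
          POIPresentation.PartialPerm (Fin (k * m))) = POIPresentation.xBar k m i)) ∧
    Nat.card (POIPresentation.Letter k) = 2 * k ∧
    (3 ≤ m →
      ({r : FreeMonoid (POIPresentation.Letter k) × FreeMonoid (POIPresentation.Letter k) |
        POIPresentation.Rels k m r.1 r.2}.ncard : ℚ) =
          (9 * (k : ℚ) ^ 2 + (2 * (m : ℚ) + 5) * k - 4) / 2) ∧
    (m = 2 →
      ({r : FreeMonoid (POIPresentation.Letter k) × FreeMonoid (POIPresentation.Letter k) |
        POIPresentation.Rels k m r.1 r.2}.ncard : ℚ) =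
          (9 * (k : ℚ) ^ 2 + 11 * k - 4) / 2) := by
  exact ⟨POIPresentation.exists_mulEquiv_POI hk hm, POIPresentation.card_letter k,
    fun h => POIPresentation.ncard_rels_of_three_le hk h,
    fun h => POIPresentation.ncard_rels_of_eq_two hk h⟩
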